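/- Let $n\ge 5$ and let $P_n=\langle s_1,\dots,s_n \mid s_i^2=1,\ (s_is_{i+1})^2=1\rangle$ (indices modulo $n$), a Coxeter group with generating set $S=\{s_1,\dots,s_n\}$, length function $\ell$, Bruhat order $\le$ and Hecke algebra $\mathcal H$ over $\mathcal A=\mathbb Z[q^{1/2},q^{-1/2}]$ with standard basis $T_w$. Let $P_{y,w}$ be the Kazhdan--Lusztig polynomials. Write $y\prec w$ if $y<w$ and $\deg P_{y,w}=\frac12(\ell(w)-\ell(y)-1)$; in this case let $\mu(y,w)=\mu(w,y)$ be the leading coefficient of $P_{y,w}$, and let $\mu=0$ on all pairs that are not related by $\prec$ in either order. Put $\mathcal L(w)=\{s\in S: sw<w\}$. Let $\le_L$ be the preorder generated by the relations $y\le_L w$ for $\mu(y,w)\ne0$ and $\mathcal L(y)\not\subset\mathcal L(w)$; let $y\le_R w$ mean $y^{-1}\le_L w^{-1}$; and let $\le_{LR}$ be the preorder generated by $\le_L$ and $\le_R$. The left (two-sided) cells are the equivalence classes of the equivalence relation $\sim_L$ ($\sim_{LR}$) associated with $\le_L$ ($\le_{LR}$). For $X\subseteq P_n$ the $W$-graph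 of $X$ has vertex set $X$, each vertex $x$ carrying the set $\mathcal L(x)$, and an edge from $x$ to $y$, labelled by $\mu(x,y)$, whenever $\mu(x,y)\neq0$ and $\mathcal L(x)\not\subset\mathcal L(y)$; the operators attached to it on the free $\mathcal A$-module on $X$ are $\tau_s x=-x$ if $s\in\mathcal L(x)$, and $\tau_s x=qx+q^{1/2}\sum_{y\in X,\,s\in\mathcal L(y)}\mu(x,y)y$ otherwise. Trees and cycles refer to the underlying undirected simple graph. A line is an element with a unique reduced expression. In a reduced word $aub$ a nonempty subword $u$ is a segment if it is maximal (with respect to inclusion of subwords of $aub$) with the following property: $u$ represents a line and every reduced expression of the element $aub$ has the form $a'ub'$ with $a=a'$ and $b=b'$ in $P_n$. Two elements $w_1,w_2$ lie in the same left precell if $w_1=w_2=1$, or if for some $w_L\neq1$ they have reduced expressions $w_1'w_L$, $w_2'w_L$ such that each $w_i'$ is trivial or a segment in $w_i$ when $\ell(w_L)>1$, and $w_1,w_2$ are lines when $\ell(w_L)=1$. The dimension of a non-unit left precell is $\#\mathcal L(w_L)$ for its unique shortest element $w_L$ (its canonical representative). A union of $d$-dimensional left precells is called $d$-dimensional. A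 left cell is of type (i) if it is a $1$-dimensional left precell of a generator $s_i$. It is of type (ii) if it is the left cell of a left precell whose canonical representative has a reduced expression $t_1t_2w'$ with $t_1\ne t_2$ in $S$ commuting and $w'$ trivial or a segment. Then $P_n$ has exactly three two-sided cells: - the unit cell $\{1\}$, whose $W$-graph gives the trivial representation of $\mathcal H$ (rank one, $T_w\mapsto q^{\ell(w)}$ for all $w$); - the union of the left cells of type (i). It is $1$-dimensional. The $W$-graph of each left cell of type (i) is an infinite tree, and the $W$-graph of the whole two-sided cell is the disjoint union of these trees, i.e. it is acyclic and its connected components are the left cells of type (i); - the union of the left cells of type (ii). It is $2$-dimensional. The $W$-graph of each left cell of type (ii), and hence of the whole two-sided cell, has infinitely many different cycles. -/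

import Mathlib

open scoped LaurentPolynomial Polynomial

noncomputable section

/-- The Coxeter matrix of `P_n`: generators are indexed by `ℤ/n`, cyclically adjacent generators
commute, all other products of two distinct generators have infinite order (entry `0`). -/
def polygonMatrix (n : ℕ) : CoxeterMatrix (ZMod n) where
  M := Matrix.of fun i j => if i = j then 1 else if j = i + 1 ∨ i = j + 1 then 2 else 0
  isSymm := by
    ext i j
    simp only [Matrix.transpose_apply, Matrix.of_apply, eq_comm (a := j) (b := i),
      or_comm (a := i = j + 1)]
  diagonal := by simp
  off_diagonal := by
    intro i j h
    simp only [Matrix.of_apply, if_neg h]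
    split_ifs <;> decide

/-- The group `P_n = ⟨s_i (i ∈ ℤ/n) ∣ s_i² = 1, (s_i s_{i+1})² = 1⟩` (for `n ≥ 3`). -/
abbrev PolygonGroup (n : ℕ) : Type := (polygonMatrix n).Group

/-- `P_n` with its set of simple reflections. -/
def polygonSystem (n : ℕ) : CoxeterSystem (polygonMatrix n) (PolygonGroup n) :=
  (polygonMatrix n).toCoxeterSystem

/-- The ring `𝒜 = ℤ[q^{1/2}, q^{-1/2}]`; the Laurent variable `T 1` is `q^{1/2}`. -/
abbrev HeckeScalars : Type := ℤ[T;T⁻¹]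

namespace HeckeScalars

/-- `q^{k/2}`. -/
def qHalf (k : ℤ) : HeckeScalars := LaurentPolynomial.T k

/-- The element `q`. -/
def q : HeckeScalars := qHalf 2

/-- The involution of `𝒜` with `q^{1/2} ↦ q^{-1/2}`. -/
def bar (a : HeckeScalars) : HeckeScalars := LaurentPolynomial.invert a

/-- A polynomial in `q` with integer coefficients, as an element of `𝒜`. -/
def ofPoly (p : ℤ[X]) : HeckeScalars := Polynomial.aeval q p

end HeckeScalars

namespace CoxeterSystem

open HeckeScalars

variable {B : Type*} {M : CoxeterMatrix B} {W : Type*} [Group W] (cs : CoxeterSystem M W)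

/-! ### Bruhat order and descent sets -/

/-- `x < y` in the Bruhat order: the order generated by `x < x t` for `t` a reflection with
`ℓ(x) < ℓ(x t)`. -/
def BruhatLT : W → W → Prop :=
  Relation.TransGen fun x y => ∃ t, cs.IsReflection t ∧ y = x * t ∧ cs.length x < cs.length y

/-- The set `ℒ(w) = {s ∣ s w < w}` (indices of simple reflections). -/
def leftDescents (w : W) : Set B := {i | cs.IsLeftDescent w i}

/-! ### The Hecke algebra

The Hecke algebra acts faithfully on itself by left multiplication, so it is realized as an algebra
of operators on the free module with basis indexed by `W`. -/

open Classical in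
/-- Left multiplication by `T_s` on the free module with basis `T_w`, `w ∈ W`:
`T_s T_w = T_{sw}` if `ℓ(sw) > ℓ(w)`, and `T_s T_w = (q - 1) T_w + q T_{sw}` otherwise. -/
def heckeLeft (i : B) : Module.End HeckeScalars (W →₀ HeckeScalars) :=
  Finsupp.linearCombination HeckeScalars fun w =>
    if cs.IsLeftDescent w i then
      (q - 1) • Finsupp.single w (1 : HeckeScalars)
        + q • Finsupp.single (cs.simple i * w) (1 : HeckeScalars)
    else Finsupp.single (cs.simple i * w) 1

/-- The Hecke algebra `ℋ` of `(W, S)` over `𝒜`, in its left regular representation. -/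
def hecke : Subalgebra HeckeScalars (Module.End HeckeScalars (W →₀ HeckeScalars)) :=
  Algebra.adjoin HeckeScalars (Set.range cs.heckeLeft)

/-- The generator `T_s` of `ℋ`. -/
def heckeGen (i : B) : cs.hecke :=
  ⟨cs.heckeLeft i, Algebra.subset_adjoin ⟨i, rfl⟩⟩

/-- A reduced expression of `w`. -/
def reducedWord (w : W) : List B := (cs.exists_isReduced w).choose

/-- The basis element `T_w = T_{s_1} ⋯ T_{s_k}`, where `s_1 ⋯ s_k` is a reduced expression of `w`
(the product does not depend on which one). -/
def heckeT (w : W) : cs.hecke := ((cs.reducedWord w).map cs.heckeGen).prod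

/-- The coefficients `a_w` of `h = ∑ a_w T_w`: in the left regular representation they are the
coordinates of `h · T_1`. -/
def heckeCoeff (h : cs.hecke) : W →₀ HeckeScalars :=
  (h : Module.End HeckeScalars (W →₀ HeckeScalars)) (Finsupp.single 1 1)

/-- The involution `∑ a_w T_w ↦ ∑ \bar a_w (T_{w⁻¹})⁻¹` of `ℋ`. -/
def heckeBar (h : cs.hecke) : cs.hecke :=
  (cs.heckeCoeff h).sum fun w a => bar a • Ring.inverse (cs.heckeT w⁻¹)

/-! ### Kazhdan–Lusztig polynomials -/

/-- The element `ε_w q_w^{1/2} ∑_y ε_y q_y^{-1} \bar{p_y} T_y` of `ℋ`. -/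
def klCombination (w : W) (p : W →₀ ℤ[X]) : cs.hecke :=
  ((-1) ^ cs.length w * qHalf (cs.length w)) •
    p.sum fun y P =>
      ((-1) ^ cs.length y * qHalf (-2 * cs.length y) * bar (ofPoly P)) • cs.heckeT y

/-- `p = (P_{y,w})_y` is the family of polynomials in `q` which defines the element `C_w`. -/
structure IsKLFamily (w : W) (p : W →₀ ℤ[X]) : Prop where
  self : p w = 1
  eq_zero : ∀ y, y ≠ w → ¬ cs.BruhatLT y w → p y = 0
  degree_le : ∀ y, cs.BruhatLT y w → 2 * (p y).natDegree + cs.length y + 1 ≤ cs.length w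
  bar_eq : cs.heckeBar (cs.klCombination w p) = cs.klCombination w p

open Classical in
/-- The Kazhdan–Lusztig polynomial `P_{y,w}` (zero unless `y ≤ w`), as a polynomial in `q`.
Kazhdan and Lusztig showed that there is exactly one family as in the definition. -/
def klPoly (y w : W) : ℤ[X] :=
  if h : ∃ p, cs.IsKLFamily w p then h.choose y else 0

/-- `y ≺ w`: `y < w` and `P_{y,w}` has degree exactly `(ℓ(w) - ℓ(y) - 1) / 2`. -/
def KLPrec (y w : W) : Prop :=
  cs.BruhatLT y w ∧ ∃ d : ℕ, (cs.klPoly y w).degree = d ∧ cs.length w = cs.length y + 2 * d + 1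

open Classical in
/-- The symmetric function `μ(y, w)`. -/
def klMu (y w : W) : ℤ :=
  if cs.KLPrec y w then (cs.klPoly y w).leadingCoeff
  else if cs.KLPrec w y then (cs.klPoly w y).leadingCoeff
  else 0

/-! ### Cells -/

/-- `y - w` and `ℒ(y) ⊄ ℒ(w)`. -/
def WEdge (y w : W) : Prop :=
  cs.klMu y w ≠ 0 ∧ ¬ cs.leftDescents y ⊆ cs.leftDescents w

/-- The preorder `y ≤_L w`. -/
def LeL : W → W → Prop := Relation.ReflTransGen cs.WEdge

/-- The preorder `y ≤_R w`. -/
def LeR (y w : W) : Prop := cs.LeL y⁻¹ w⁻¹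

/-- The preorder `y ≤_{LR} w`. -/
def LeLR : W → W → Prop := Relation.ReflTransGen fun y w => cs.LeL y w ∨ cs.LeR y w

/-- `y ∼_L w`. -/
def EquivL (y w : W) : Prop := cs.LeL y w ∧ cs.LeL w y

/-- `y ∼_{LR} w`. -/
def EquivLR (y w : W) : Prop := cs.LeLR y w ∧ cs.LeLR w y

/-- Left cells: the equivalence classes of `∼_L`. -/
def IsLeftCell (C : Set W) : Prop := ∃ w, C = {y | cs.EquivL y w}

/-- Two-sided cells: the equivalence classes of `∼_{LR}`. -/
def IsTwoSidedCell (C : Set W) : Prop := ∃ w, C = {y | cs.EquivLR y w}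

/-! ### W-graphs -/

/-- The underlying graph of the W-graph of a set `X ⊆ W`: the full subgraph on `X` of the W-graph
of `W`, in which there is an edge from `x` to `y` when `μ(x, y) ≠ 0` and `ℒ(x) ⊄ ℒ(y)`. -/
def wGraph (X : Set W) : SimpleGraph X :=
  SimpleGraph.fromRel fun x y : X => cs.WEdge x y

open Classical in
/-- The operator `τ_s` on the free module `𝒜(X)` given by the W-graph of `X`:
`τ_s x = -x` if `s ∈ ℒ(x)`, and `τ_s x = q x + q^{1/2} ∑_{y ∈ X, s ∈ ℒ(y)} μ(x, y) y` otherwise. -/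
def wGraphTau (X : Set W) (i : B) : Module.End HeckeScalars (X →₀ HeckeScalars) :=
  Finsupp.linearCombination HeckeScalars fun x =>
    if i ∈ cs.leftDescents (x : W) then -Finsupp.single x (1 : HeckeScalars)
    else q • Finsupp.single x (1 : HeckeScalars) + qHalf 1 •
      ∑ᶠ (y : X) (_ : i ∈ cs.leftDescents (y : W)),
        Finsupp.single y (cs.klMu x y : HeckeScalars)

/-- The W-graph of `X` defines the trivial representation of `ℋ`: the free module `𝒜(X)` has rank
one, and the `τ_s` extend to a representation of `ℋ` in which each `T_w` acts as `q^{ℓ(w)}`. -/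
def GivesTrivialRepresentation (X : Set W) : Prop :=
  X.ncard = 1 ∧
  ∃ ρ : cs.hecke →ₐ[HeckeScalars] Module.End HeckeScalars (X →₀ HeckeScalars),
    (∀ i, ρ (cs.heckeGen i) = cs.wGraphTau X i) ∧
    ∀ w, ρ (cs.heckeT w) = q ^ cs.length w • LinearMap.id

/-! ### Lines, segments and left precells -/

/-- A line is an element with a unique reduced expression. -/
def IsLine (w : W) : Prop := ∃! ω : List B, cs.IsReduced ω ∧ cs.wordProd ω = w

/-- In the reduced word `a u b` the nonempty subword `u` represents a line, and every reduced
expression of the same element has the form `a' u b'` with `a = a'`, `b = b'` in `W`. -/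
def IsRigidSubword (a u b : List B) : Prop :=
  cs.IsReduced (a ++ u ++ b) ∧ u ≠ [] ∧ cs.IsLine (cs.wordProd u) ∧
  ∀ ω : List B, cs.IsReduced ω → cs.wordProd ω = cs.wordProd (a ++ u ++ b) →
    ∃ a' b' : List B, ω = a' ++ u ++ b' ∧
      cs.wordProd a' = cs.wordProd a ∧ cs.wordProd b' = cs.wordProd b

/-- The subword `u` of `a u b` is a segment: it is a maximal rigid subword. -/
def IsSegment (a u b : List B) : Prop :=
  cs.IsRigidSubword a u b ∧
  ∀ a₁ a₂ b₁ b₂ : List B, a = a₁ ++ a₂ → b = b₁ ++ b₂ →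
    cs.IsRigidSubword a₁ (a₂ ++ u ++ b₁) b₂ → a₂ = [] ∧ b₁ = []

/-- `w` has a reduced expression `w' w_L` such that `w'` is trivial or a segment in `w` if
`ℓ(w_L) > 1`, and such that `w` is a line if `ℓ(w_L) = 1`. -/
def IsPrecellExtension (wL w : W) : Prop :=
  ∃ a b : List B, cs.IsReduced (a ++ b) ∧ cs.wordProd (a ++ b) = w ∧ cs.wordProd b = wL ∧
    (1 < cs.length wL → a = [] ∨ cs.IsSegment [] a b) ∧ (cs.length wL = 1 → cs.IsLine w)

/-- The relation `w₁ ∼_{lp} w₂`. -/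
def EquivLP (w₁ w₂ : W) : Prop :=
  (w₁ = 1 ∧ w₂ = 1) ∨
    ∃ wL, wL ≠ 1 ∧ cs.IsPrecellExtension wL w₁ ∧ cs.IsPrecellExtension wL w₂

/-- The left precell of `w`. -/
def leftPrecell (w : W) : Set W := {y | cs.EquivLP y w}

/-- `wL` is the canonical representative, i.e. the unique shortest element, of `Γ`. -/
def IsCanonicalRep (Γ : Set W) (wL : W) : Prop :=
  wL ∈ Γ ∧ ∀ w ∈ Γ, w ≠ wL → cs.length wL < cs.length w

/-- The left precell `Γ` is non-unit and has dimension `d`, the number of elements of `ℒ(w_L)`. -/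
def HasPrecellDim (Γ : Set W) (d : ℕ) : Prop :=
  ∃ wL, wL ≠ 1 ∧ cs.IsCanonicalRep Γ wL ∧ (cs.leftDescents wL).ncard = d

/-- `X` is a union of `d`-dimensional left precells. -/
def IsOfDim (X : Set W) (d : ℕ) : Prop :=
  ∀ w ∈ X, cs.leftPrecell w ⊆ X ∧ cs.HasPrecellDim (cs.leftPrecell w) d

/-- Left cells of type (i): those given by a `1`-dimensional left precell of a generator. -/
def IsTypeOneCell (C : Set W) : Prop :=
  cs.IsLeftCell C ∧
    ∃ i, C = cs.leftPrecell (cs.simple i) ∧ cs.HasPrecellDim (cs.leftPrecell (cs.simple i)) 1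

/-- Left cells of type (ii): the left cells of left precells whose canonical representative has a
reduced expression `t₁ t₂ w'` where `t₁ ≠ t₂` commute and `w'` is trivial or a segment. -/
def IsTypeTwoCell (C : Set W) : Prop :=
  ∃ (wL : W) (t₁ t₂ : B) (u : List B),
    C = {w | cs.EquivL w wL} ∧ cs.IsCanonicalRep (cs.leftPrecell wL) wL ∧
    cs.IsReduced (t₁ :: t₂ :: u) ∧ cs.wordProd (t₁ :: t₂ :: u) = wL ∧
    Commute (cs.simple t₁) (cs.simple t₂) ∧ (u = [] ∨ cs.IsSegment [t₁, t₂] u [])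

end CoxeterSystem

/-- The graph has infinitely many different cycles (cycles are counted as sets of edges). -/
def SimpleGraph.HasInfinitelyManyCycles {V : Type*} (G : SimpleGraph V) : Prop :=
  {E : Set (Sym2 V) | ∃ (v : V) (c : G.Walk v v), c.IsCycle ∧ E = {e | e ∈ c.edges}}.Infinite

end

/-! The three two-sided cells are the unit element, the non-unit lines, and the elements that are
not lines. The Coxeter matrix enters through two properties. It is right-angled, so distinct left
descents of an element commute, and strong exchange and Matsumoto's theorem need only commutation
relations. No three generators commute pairwise, so an element has at most two left descents. The
Kazhdan–Lusztig basis `C_w` is built from these facts and its uniqueness identifies it with the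
polynomials in the statement.

Lines: if `s` is a left descent of `w`, then `C_s C_w = -(q^{1/2} + q^{-1/2}) C_w`. When `s` is not
a descent of `y`, comparing coordinates shows that `y ≺ w` only for `w = s y` (`kl_coeff_one`). A
non-unit line has exactly one left descent, so an edge from a line to a non-unit element is
multiplication by one generator. Hence the non-lines are closed downwards under `≤_{LR}`
(`not_isLine_of_leLR`), and the left cell of `s_i` is the set of lines ending in `i`
(`equivL_simple_iff`). A line has at most one shorter neighbour in its W-graph, obtained by deleting
the first letter, so these graphs are trees.

Non-lines: in the normalized basis `q^{-ℓ(w)/2} T_w`, written `T̃_w`, structure constants are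
polynomials in `ξ = q^{1/2} - q^{-1/2}` with natural coefficients and degree at most two
(`natDegree_redProd_polyOp_le_two`). Suppose `c` has two left descents `a`, `b` and the product `x
c` is reduced. Then `T̃_a T̃_b T̃_{x⁻¹} T̃_{xc}` contains `ξ² T̃_c`, which positivity protects from
cancellation and which no lower term of `C_{xc}` can match. So `C_c` occurs in the left ideal of
`C_{xc}`, giving `c ≤_L x c`; the converse is elementary (`equivL_mul_of_two_descents`). Every
non-line ends in such a `c`, so left ascents stay in its left cell, and pairs of commuting ascents
produce squares in the W-graph. Using this on both sides reduces a non-line to some `s_i s_j` with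
`M i j = 2`, and words of three letters carry one such pair to the next around the polygon.

Precells: the reduced expressions of a non-line `w` have a longest common prefix `a`, and `w = a c`
where `c` has two left descents. The core `c` is the canonical representative, which gives dimension
two.

The bound `n ≥ 5` supplies, for each generator, two adjacent generators that do not commute with it.
This gives infinite trees, commuting ascents, and links between all generators. -/

noncomputable section

/-! ### Signed reflections and strong exchange. -/

namespace CoxeterMatrix

/-- A Coxeter matrix is right-angled if its off-diagonal entries are `2` or `∞` (encoded as `0`). -/
def IsRightAngled {B : Type*} (M : CoxeterMatrix B) : Prop :=
  ∀ i j, i ≠ j → M i j = 2 ∨ M i j = 0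

end CoxeterMatrix

namespace CoxeterSystem

section RightAngled

variable {B : Type*} {M : CoxeterMatrix B} {W : Type*} [Group W] (cs : CoxeterSystem M W)

theorem simple_commute {i j : B} (h : M i j = 2) :
    cs.simple i * cs.simple j = cs.simple j * cs.simple i := by
  have h1 := cs.simple_mul_simple_pow i j
  rw [h, pow_two] at h1
  have h2 := eq_inv_of_mul_eq_one_left h1
  simpa using h2

open Classical in
/-- The action of a simple reflection on signed reflections. -/
def signedConj (i : B) : Function.End (W × ZMod 2) :=
  fun p => (cs.simple i * p.1 * cs.simple i, p.2 + if p.1 = cs.simple i then 1 else 0)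

open Classical in
theorem signedConj_sq (i : B) : cs.signedConj i * cs.signedConj i = 1 := by
  funext p
  change cs.signedConj i (cs.signedConj i p) = p
  have h : cs.simple i * p.1 * cs.simple i = cs.simple i ↔ p.1 = cs.simple i := by
    constructor
    · intro h
      have := congrArg (fun x => cs.simple i * x * cs.simple i) h
      simpa [mul_assoc] using this
    · rintro h; simp [h]
  ext
  · simp [signedConj, mul_assoc]
  · change (p.2 + if p.1 = cs.simple i then 1 else 0) +
      (if cs.simple i * p.1 * cs.simple i = cs.simple i then 1 else 0) = p.2
    by_cases hp : p.1 = cs.simple i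
    · rw [if_pos hp, if_pos (h.2 hp), add_assoc, show (1 : ZMod 2) + 1 = 0 from by decide,
        add_zero]
    · rw [if_neg hp, if_neg (mt h.1 hp), add_zero, add_zero]

open Classical in
theorem signedConj_comm {i j : B} (h : M i j = 2) :
    cs.signedConj i * cs.signedConj j = cs.signedConj j * cs.signedConj i := by
  have hc := cs.simple_commute h
  have key : ∀ i j : B, cs.simple i * cs.simple j = cs.simple j * cs.simple i → ∀ x : W,
      (cs.simple j * x * cs.simple j = cs.simple i ↔ x = cs.simple i) := by
    intro i j hc x
    constructor
    · intro h
      have h' := congrArg (fun x => cs.simple j * x * cs.simple j) h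
      simp only [mul_assoc, simple_mul_simple_cancel_left, simple_mul_simple_self, mul_one] at h'
      rw [h', hc]; simp
    · rintro rfl
      rw [← hc]; simp
  funext p
  change cs.signedConj i (cs.signedConj j p) = cs.signedConj j (cs.signedConj i p)
  ext
  · simp only [signedConj]
    calc cs.simple i * (cs.simple j * p.1 * cs.simple j) * cs.simple i
        = (cs.simple i * cs.simple j) * p.1 * (cs.simple j * cs.simple i) := by group
      _ = (cs.simple j * cs.simple i) * p.1 * (cs.simple i * cs.simple j) := by rw [hc]
      _ = _ := by group
  · change (p.2 + if p.1 = cs.simple j then 1 else 0) +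
      (if cs.simple j * p.1 * cs.simple j = cs.simple i then 1 else 0) =
      (p.2 + if p.1 = cs.simple i then 1 else 0) +
      (if cs.simple i * p.1 * cs.simple i = cs.simple j then 1 else 0)
    rw [if_congr (key i j hc p.1) rfl rfl, if_congr (key j i hc.symm p.1) rfl rfl]
    ring

variable (hM : M.IsRightAngled)
include hM

/-- An infinite bond is encoded as `0` and imposes an empty relation, so only involutivity and
commuting pairs have to be checked. -/
theorem signedConj_isLiftable : M.IsLiftable cs.signedConj := by
  intro i j
  by_cases hij : i = j
  · subst hij
    rw [M.diagonal, pow_one, signedConj_sq]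
  · rcases hM i j hij with h | h
    · rw [h, pow_two, mul_assoc, ← mul_assoc (cs.signedConj j), ← signedConj_comm cs h,
        mul_assoc, signedConj_sq, mul_one, signedConj_sq]
    · rw [h, pow_zero]

/-- The action of `W` on signed reflections. -/
def signedConjHom : W →* Function.End (W × ZMod 2) :=
  cs.lift ⟨cs.signedConj, cs.signedConj_isLiftable hM⟩

theorem signedConjHom_simple (i : B) : cs.signedConjHom hM (cs.simple i) = cs.signedConj i :=
  cs.lift_apply_simple _ i

/-- The parity of the number of occurrences of `t` in the left inversion sequence of a word
for `w`. -/
def invParity (w t : W) : ZMod 2 := (cs.signedConjHom hM w⁻¹ (t, 0)).2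

theorem signedConjHom_apply (w : W) (t : W) (e : ZMod 2) :
    cs.signedConjHom hM w (t, e) = (w * t * w⁻¹, e + (cs.signedConjHom hM w (t, 0)).2) := by
  induction w using cs.simple_induction_left generalizing t e with
  | one => simp [map_one, Function.End.one_def]
  | mul_simple_left w i ih =>
    rw [map_mul, signedConjHom_simple]
    change cs.signedConj i (cs.signedConjHom hM w (t, e)) = _
    have h0 : (cs.signedConj i * cs.signedConjHom hM w) (t, 0) =
      cs.signedConj i (cs.signedConjHom hM w (t, 0)) := rfl
    rw [h0, ih, ih t 0]
    ext
    · simp [signedConj, mul_assoc]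
    · simp only [signedConj]
      ring

theorem invParity_mul (x y t : W) :
    cs.invParity hM (x * y) t = cs.invParity hM x t + cs.invParity hM y (x⁻¹ * t * x) := by
  unfold invParity
  rw [mul_inv_rev, map_mul]
  change (cs.signedConjHom hM y⁻¹ (cs.signedConjHom hM x⁻¹ (t, 0))).2 = _
  conv_lhs => rw [cs.signedConjHom_apply hM x⁻¹, cs.signedConjHom_apply hM y⁻¹]
  simp

open Classical in
theorem invParity_simple (i : B) (t : W) :
    cs.invParity hM (cs.simple i) t = if t = cs.simple i then 1 else 0 := by
  simp [invParity, signedConjHom_simple, signedConj]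

theorem invParity_one (t : W) : cs.invParity hM 1 t = 0 := by
  simp [invParity, Function.End.one_def]

open Classical in
-- The left side depends only on the group element, hence so does the parity of the number of
-- occurrences of `t`. Strong exchange comes from this independence.
theorem invParity_wordProd (ω : List B) (t : W) :
    cs.invParity hM (cs.wordProd ω) t = ((cs.leftInvSeq ω).count t : ZMod 2) := by
  induction ω generalizing t with
  | nil => simp [invParity_one]
  | cons i ω ih =>
    rw [wordProd_cons, invParity_mul, ih, invParity_simple, leftInvSeq, List.count_cons]
    have h : ((cs.leftInvSeq ω).map (MulAut.conj (cs.simple i))).count t =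
        (cs.leftInvSeq ω).count ((cs.simple i)⁻¹ * t * cs.simple i) := by
      have h1 := List.count_map_of_injective (cs.leftInvSeq ω) (MulAut.conj (cs.simple i))
        (MulAut.conj (cs.simple i)).injective ((cs.simple i)⁻¹ * t * cs.simple i)
      rw [← h1]
      congr 1
      simp [MulAut.conj_apply, mul_assoc]
    rw [h]
    by_cases ht : t = cs.simple i
    · simp [ht, add_comm]
    · simp [ht, Ne.symm ht]

theorem invParity_self {t : W} (ht : cs.IsReflection t) : cs.invParity hM t t = 1 := by
  obtain ⟨u, i, rfl⟩ := ht
  have h1 : cs.invParity hM u (u * cs.simple i * u⁻¹) + cs.invParity hM u⁻¹ (cs.simple i) = 0 := by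
    have := cs.invParity_mul hM u u⁻¹ (u * cs.simple i * u⁻¹)
    rw [mul_inv_cancel, invParity_one] at this
    rw [this]
    congr 2
    group
  conv_lhs => rw [mul_assoc u (cs.simple i) u⁻¹]
  rw [invParity_mul, invParity_mul, invParity_simple]
  have e1 : u⁻¹ * (u * (cs.simple i * u⁻¹)) * u = cs.simple i := by group
  rw [e1, inv_mul_cancel, one_mul, if_pos rfl, ← mul_assoc]
  linear_combination h1

/-- An odd count puts `t` into the inversion sequence of a reduced word, so `t` shortens `w`. If the
count is even, the count for `t w` is odd because `t` itself contributes one, and `t` lengthens `w`.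
-/
theorem invParity_eq_one_iff {t : W} (ht : cs.IsReflection t) (w : W) :
    cs.invParity hM w t = 1 ↔ cs.length (t * w) < cs.length w := by
  classical
  have key : ∀ w, cs.invParity hM w t = 1 → cs.length (t * w) < cs.length w := by
    intro w h
    obtain ⟨ω, hω, rfl⟩ := cs.exists_isReduced w
    rw [invParity_wordProd] at h
    have hmem : t ∈ cs.leftInvSeq ω := by
      by_contra hn
      rw [List.count_eq_zero_of_not_mem hn] at h
      simp at h
    exact (cs.isLeftInversion_of_mem_leftInvSeq hω hmem).2
  refine ⟨key w, fun h => ?_⟩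
  by_contra hn
  have h0 : cs.invParity hM w t = 0 := by
    revert hn
    generalize cs.invParity hM w t = a
    revert a; decide
  have h1 : cs.invParity hM (t * w) t = 1 := by
    rw [invParity_mul, invParity_self cs hM ht]
    simp [h0]
  have h2 := key _ h1
  rw [← mul_assoc, ht.mul_self, one_mul] at h2
  omega

/-- Strong exchange, in the form: if `t ≠ s` is a reflection then `t` is a left inversion of `w` iff
`s t s` is a left inversion of `s w`. -/
theorem length_reflection_mul_lt_iff {t : W} (ht : cs.IsReflection t) {i : B}
    (hti : t ≠ cs.simple i) (w : W) :
    cs.length (t * w) < cs.length w ↔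
      cs.length (cs.simple i * (t * w)) < cs.length (cs.simple i * w) := by
  have h2 : cs.IsReflection (cs.simple i * t * cs.simple i) := by
    simpa using ht.conj (cs.simple i)
  rw [← cs.invParity_eq_one_iff hM ht]
  have h3 := cs.invParity_eq_one_iff hM h2 (cs.simple i * w)
  rw [show cs.simple i * t * cs.simple i * (cs.simple i * w) = cs.simple i * (t * w) by
    simp [mul_assoc]] at h3
  rw [← h3, invParity_mul, invParity_simple, if_neg]
  · simp [mul_assoc]
  · intro h
    apply hti
    have := congrArg (fun x => cs.simple i * x * cs.simple i) h
    simpa [mul_assoc] using this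

/-- The inversion sequence lists the reflections that coincide, at some stage, with the letter being
stripped. Avoiding them lets the one-letter exchange be iterated. -/
theorem length_reflection_mul_lt_iff_of_not_mem {t : W} (ht : cs.IsReflection t) (ω : List B)
    (hω : t ∉ cs.leftInvSeq ω) (w : W) :
    cs.length (t * w) < cs.length w ↔
      cs.length ((cs.wordProd ω)⁻¹ * (t * w)) < cs.length ((cs.wordProd ω)⁻¹ * w) := by
  induction ω generalizing t w with
  | nil => simp
  | cons i ω ih =>
    simp only [leftInvSeq, List.mem_cons, List.mem_map, not_or, not_exists, not_and] at hω
    have h2 : cs.IsReflection (cs.simple i * t * cs.simple i) := by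
      simpa using ht.conj (cs.simple i)
    rw [cs.length_reflection_mul_lt_iff hM ht hω.1]
    have h3 := ih h2 (fun hm => hω.2 _ hm (by simp [MulAut.conj_apply, mul_assoc]))
      (cs.simple i * w)
    rw [show cs.simple i * t * cs.simple i * (cs.simple i * w) = cs.simple i * (t * w) by
      simp [mul_assoc]] at h3
    rw [h3, wordProd_cons]
    simp [mul_assoc]

omit hM in
/-- The alternating word `i j i ⋯` of length `m`. -/
def altWord (i j : B) : ℕ → List B
  | 0 => []
  | m + 1 => i :: altWord j i m

end RightAngled

end CoxeterSystem


/-! ### Descents, reduced words and the Bruhat order. -/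

namespace CoxeterSystem

section RightAngled

variable {B : Type*} {M : CoxeterMatrix B} {W : Type*} [Group W] (cs : CoxeterSystem M W)

theorem exists_pow_of_mem_leftInvSeq_altWord {i j : B} {m : ℕ} {r : W}
    (h : r ∈ cs.leftInvSeq (altWord i j m)) :
    ∃ k : ℕ, r = (cs.simple i * cs.simple j) ^ k * cs.simple i := by
  induction m generalizing i j r with
  | zero => simp [altWord] at h
  | succ m ih =>
    simp only [altWord, leftInvSeq, List.mem_cons, List.mem_map] at h
    rcases h with h | ⟨r', hr', rfl⟩
    · exact ⟨0, by simpa using h⟩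
    · obtain ⟨k, rfl⟩ := ih hr'
      refine ⟨k + 1, ?_⟩
      rw [MulAut.conj_apply, inv_simple]
      have h2 : ∀ k : ℕ, cs.simple i * (cs.simple j * cs.simple i) ^ k =
          (cs.simple i * cs.simple j) ^ k * cs.simple i := by
        intro k
        induction k with
        | zero => simp
        | succ k ih => rw [pow_succ, ← mul_assoc, ih, pow_succ]; simp only [mul_assoc]
      rw [← mul_assoc, h2, pow_succ]
      simp only [mul_assoc]

theorem wordProd_altWord_length (i j : B) (m : ℕ) : (altWord i j m).length = m := by
  induction m generalizing i j with
  | zero => rfl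
  | succ m ih => simp [altWord, ih]

theorem length_simple_mul_of_isLeftDescent {w : W} {i : B} (h : cs.IsLeftDescent w i) :
    cs.length (cs.simple i * w) + 1 = cs.length w := cs.isLeftDescent_iff.1 h

theorem length_simple_mul_of_not_isLeftDescent {w : W} {i : B} (h : ¬ cs.IsLeftDescent w i) :
    cs.length (cs.simple i * w) = cs.length w + 1 := cs.not_isLeftDescent_iff.1 h

theorem isLeftDescent_simple_mul_iff {w : W} {i : B} :
    cs.IsLeftDescent (cs.simple i * w) i ↔ ¬ cs.IsLeftDescent w i := by
  unfold IsLeftDescent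
  rw [simple_mul_simple_cancel_left]
  have := cs.length_simple_mul_ne w i
  omega

theorem isReduced_cons_iff {i : B} {ω : List B} :
    cs.IsReduced (i :: ω) ↔ cs.IsReduced ω ∧ ¬ cs.IsLeftDescent (cs.wordProd ω) i := by
  unfold IsReduced
  rw [wordProd_cons, not_isLeftDescent_iff, List.length_cons]
  have h1 := cs.length_wordProd_le ω
  have h2 := cs.length_simple_mul (cs.wordProd ω) i
  omega

/-- The Bruhat order (reflexive version). -/
def BruhatLE (x y : W) : Prop := x = y ∨ cs.BruhatLT x y

variable (hM : M.IsRightAngled)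
include hM

open Classical in
-- Every relator contains each generator an even number of times, so a homomorphism to `ℤ/2` can
-- single out one generator.
theorem simple_injective_of_isRightAngled {i j : B} (h : cs.simple i = cs.simple j) : i = j := by
  by_contra hij
  let f : B → Multiplicative (ZMod 2) := fun k => if k = i then Multiplicative.ofAdd 1 else 1
  have hf : M.IsLiftable f := by
    have hsq : ∀ a : Multiplicative (ZMod 2), a * a = 1 := by decide
    intro k l
    by_cases hkl : k = l
    · subst hkl
      rw [M.diagonal, pow_one]
      exact hsq _
    · rcases hM k l hkl with h | h
      · rw [h, pow_two]
        exact hsq _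
      · rw [h, pow_zero]
  have h1 := congrArg (cs.lift ⟨f, hf⟩) h
  rw [cs.lift_apply_simple hf, cs.lift_apply_simple hf] at h1
  simp only [f, if_true, if_neg (Ne.symm hij)] at h1
  exact absurd h1 (by decide)

open Classical in
-- Killing all other generators maps the system to the infinite dihedral group. The commutation
-- relations survive because none of them involves both `i` and `j`.
theorem simple_mul_simple_pow_ne_one {i j : B} (h : M i j = 0) {k : ℕ} (hk : k ≠ 0) :
    (cs.simple i * cs.simple j) ^ k ≠ 1 := by
  have hij : i ≠ j := by
    rintro rfl
    rw [M.diagonal] at h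
    exact one_ne_zero h
  let f : B → DihedralGroup 0 := fun l =>
    if l = i then DihedralGroup.sr 0 else if l = j then DihedralGroup.sr 1 else 1
  have hsq : ∀ l, f l * f l = 1 := by
    intro l
    simp only [f]
    split_ifs <;> simp
  have hf : M.IsLiftable f := by
    intro k l
    by_cases hkl : k = l
    · subst hkl
      rw [M.diagonal, pow_one, hsq]
    · rcases hM k l hkl with h' | h'
      · have h1 : f k = 1 ∨ f l = 1 := by
          by_contra hcon
          push Not at hcon
          have hk : k = i ∨ k = j := by
            by_contra hn; push Not at hn
            exact hcon.1 (by simp [f, hn])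
          have hl : l = i ∨ l = j := by
            by_contra hn; push Not at hn
            exact hcon.2 (by simp [f, hn])
          rcases hk with rfl | rfl <;> rcases hl with rfl | rfl
          · exact hkl rfl
          · omega
          · rw [M.symmetric] at h'; omega
          · exact hkl rfl
        rw [h', pow_two]
        rcases h1 with h1 | h1
        · simp [h1, hsq]
        · simp [h1, hsq]
      · rw [h', pow_zero]
  intro h1
  have h2 := congrArg (cs.lift ⟨f, hf⟩) h1
  rw [map_pow, map_mul, cs.lift_apply_simple hf, cs.lift_apply_simple hf, map_one] at h2
  have h3 : f i * f j = DihedralGroup.r 1 := by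
    simp [f, Ne.symm hij]
  rw [h3, DihedralGroup.r_one_pow, DihedralGroup.one_def, DihedralGroup.r.injEq] at h2
  exact hk (by exact_mod_cast h2)

/-- Two distinct left descents commute. -/
theorem eq_two_of_isLeftDescent {w : W} {i j : B} (hi : cs.IsLeftDescent w i)
    (hj : cs.IsLeftDescent w j) (hij : i ≠ j) : M i j = 2 := by
  refine (hM i j hij).resolve_right fun h0 => ?_
  -- If two unrelated letters were both descents, alternating words of every length could be split
  -- off `w`. The reflection `s_b` is never an inversion of the alternating word starting with `a`,
  -- so putting `b` in front of that word shortens the remainder once more.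
  have step : ∀ (a b : B), M a b = 0 → cs.IsLeftDescent w b → ∀ m : ℕ,
      cs.length ((cs.wordProd (altWord a b m))⁻¹ * w) + m = cs.length w →
      cs.length ((cs.wordProd (altWord b a (m + 1)))⁻¹ * w) + (m + 1) = cs.length w := by
    intro a b hab hb m hm
    have hnot : cs.simple b ∉ cs.leftInvSeq (altWord a b m) := by
      intro hmem
      obtain ⟨k, hk⟩ := cs.exists_pow_of_mem_leftInvSeq_altWord hmem
      apply cs.simple_mul_simple_pow_ne_one hM hab (Nat.succ_ne_zero k)
      rw [pow_succ, ← mul_assoc, ← hk, simple_mul_simple_self]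
    have h1 := (cs.length_reflection_mul_lt_iff_of_not_mem hM (cs.isReflection_simple b) _
      hnot w).1 hb
    have h2 : (cs.wordProd (altWord b a (m + 1)))⁻¹ * w =
        (cs.wordProd (altWord a b m))⁻¹ * (cs.simple b * w) := by
      simp [altWord, wordProd_cons, mul_assoc]
    have h3 := cs.length_le_length_mul_add_left (cs.wordProd (altWord a b m))⁻¹ (cs.simple b * w)
    have h4 := cs.length_wordProd_le (altWord a b m)
    rw [length_inv] at h3
    rw [wordProd_altWord_length] at h4
    have h5 := cs.length_simple_mul_of_isLeftDescent hb
    rw [h2]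
    omega
  have all : ∀ m : ℕ,
      cs.length ((cs.wordProd (altWord i j m))⁻¹ * w) + m = cs.length w ∧
      cs.length ((cs.wordProd (altWord j i m))⁻¹ * w) + m = cs.length w := by
    intro m
    induction m with
    | zero => simp [altWord]
    | succ m ih =>
      exact ⟨step j i (by rw [M.symmetric]; exact h0) hi m ih.2, step i j h0 hj m ih.1⟩
  -- No prefix can be longer than `w` itself.
  have := (all (cs.length w + 1)).1
  omega

theorem isLeftDescent_simple_mul_of_commute {w : W} {i j : B} (h : M i j = 2) :
    cs.IsLeftDescent (cs.simple i * w) j ↔ cs.IsLeftDescent w j := by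
  have hij : i ≠ j := by
    rintro rfl
    rw [M.diagonal] at h
    omega
  have h1 := cs.length_reflection_mul_lt_iff hM (cs.isReflection_simple j) (i := i)
    (fun h => hij (cs.simple_injective_of_isRightAngled hM h).symm) w
  unfold IsLeftDescent
  rw [h1, ← mul_assoc, ← cs.simple_commute h, mul_assoc]

theorem isLeftDescent_of_simple_mul {w : W} {i j : B} (hi : ¬ cs.IsLeftDescent w i)
    (hj : cs.IsLeftDescent (cs.simple i * w) j) (hij : i ≠ j) :
    M i j = 2 ∧ cs.IsLeftDescent w j := by
  have h := cs.eq_two_of_isLeftDescent hM (cs.isLeftDescent_simple_mul_iff.2 hi) hj hij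
  exact ⟨h, (cs.isLeftDescent_simple_mul_of_commute hM h).1 hj⟩

/-- Letters of `y` are handed over to `x` one at a time. When a letter `j` finally cancels, every
letter transferred before commutes with `j`, so `j` was already available at the original junction.
-/
theorem exists_common_descent {x y : W} (h : cs.length (x * y) < cs.length x + cs.length y) :
    ∃ i, cs.IsRightDescent x i ∧ cs.IsLeftDescent y i := by
  induction hn : cs.length y generalizing x y with
  | zero =>
    rw [cs.length_eq_zero_iff] at hn
    subst hn
    simp at h
  | succ n ih =>
    have hy : y ≠ 1 := by rintro rfl; simp at hn
    obtain ⟨i, hi⟩ := cs.exists_leftDescent_of_ne_one hy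
    by_cases hx : cs.IsRightDescent x i
    · exact ⟨i, hx, hi⟩
    · have hl := cs.length_simple_mul_of_isLeftDescent hi
      have hx' := cs.not_isRightDescent_iff.1 hx
      have hs : ¬ cs.IsLeftDescent (cs.simple i * y) i := by
        rw [isLeftDescent_simple_mul_iff]; simpa using hi
      obtain ⟨j, hj1, hj2⟩ := @ih (x * cs.simple i) (cs.simple i * y)
        (by rw [mul_assoc, simple_mul_simple_cancel_left]; omega) (by omega)
      have hij : i ≠ j := by rintro rfl; exact hs hj2
      rw [← isLeftDescent_inv_iff, mul_inv_rev, inv_simple] at hj1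
      obtain ⟨h2, hj1'⟩ := cs.isLeftDescent_of_simple_mul hM
        (by rwa [isLeftDescent_inv_iff]) hj1 hij
      refine ⟨j, by rwa [isLeftDescent_inv_iff] at hj1', ?_⟩
      exact (cs.isLeftDescent_simple_mul_of_commute hM h2).1 hj2

/-- Matsumoto's theorem for right-angled systems. -/
theorem prod_map_eq_of_isReduced {G : Type*} [Monoid G] (f : B → G)
    (hf : ∀ i j, M i j = 2 → f i * f j = f j * f i) {ω ω' : List B} (hω : cs.IsReduced ω)
    (hω' : cs.IsReduced ω') (h : cs.wordProd ω = cs.wordProd ω') :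
    (ω.map f).prod = (ω'.map f).prod := by
  induction hn : ω.length generalizing ω ω' with
  | zero =>
    have : ω'.length = 0 := by rw [← hω'.eq, ← h, hω.eq, hn]
    rw [List.length_eq_zero_iff.1 hn, List.length_eq_zero_iff.1 this]
  | succ n ih =>
    have hn' : ω'.length = n + 1 := by rw [← hω'.eq, ← h, hω.eq, hn]
    obtain ⟨i, α, rfl⟩ := List.exists_cons_of_length_eq_add_one hn
    obtain ⟨j, β, rfl⟩ := List.exists_cons_of_length_eq_add_one hn'
    obtain ⟨hα, hi⟩ := cs.isReduced_cons_iff.1 hω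
    obtain ⟨hβ, hj⟩ := cs.isReduced_cons_iff.1 hω'
    simp only [List.length_cons, Nat.add_right_cancel_iff] at hn hn'
    simp only [List.map_cons, List.prod_cons]
    by_cases hij : i = j
    · subst hij
      rw [wordProd_cons, wordProd_cons, mul_right_inj] at h
      rw [ih hα hβ h hn]
    · rw [wordProd_cons, wordProd_cons] at h
      have hj' : cs.IsLeftDescent (cs.simple i * cs.wordProd α) j := by
        rw [h, isLeftDescent_simple_mul_iff]; exact hj
      obtain ⟨h2, hjα⟩ := cs.isLeftDescent_of_simple_mul hM hi hj' hij
      -- `γ` is the common remainder: the two words are compared with `i j γ` and `j i γ` through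
      -- the induction hypothesis.
      obtain ⟨γ, hγ, hγ'⟩ := cs.exists_isReduced (cs.simple j * cs.wordProd α)
      have e1 : cs.wordProd α = cs.wordProd (j :: γ) := by
        rw [wordProd_cons, ← hγ', simple_mul_simple_cancel_left]
      have e2 : cs.wordProd β = cs.wordProd (i :: γ) := by
        rw [wordProd_cons, ← hγ', ← mul_assoc, cs.simple_commute h2, mul_assoc, h,
          simple_mul_simple_cancel_left]
      have hlen : γ.length + 1 = n := by
        rw [← hγ.eq, ← hγ', cs.length_simple_mul_of_isLeftDescent hjα, hα.eq, hn]
      have r1 : cs.IsReduced (j :: γ) := by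
        unfold IsReduced; rw [← e1, hα.eq, List.length_cons]; omega
      have r2 : cs.IsReduced (i :: γ) := by
        unfold IsReduced; rw [← e2, hβ.eq, List.length_cons]; omega
      rw [ih hα r1 e1 hn, ih hβ r2 e2 hn']
      simp only [List.map_cons, List.prod_cons]
      rw [← mul_assoc, hf i j h2, mul_assoc]

omit hM in
theorem length_lt_of_bruhatLT {x y : W} (h : cs.BruhatLT x y) : cs.length x < cs.length y := by
  induction h with
  | single h => obtain ⟨t, -, -, h⟩ := h; exact h
  | tail _ h ih => obtain ⟨t, -, -, h⟩ := h; omega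

omit hM in
theorem bruhatLT_simple_mul {w : W} {i : B} (h : ¬ cs.IsLeftDescent w i) :
    cs.BruhatLT w (cs.simple i * w) := by
  refine .single ⟨w⁻¹ * cs.simple i * w, ?_, by group, ?_⟩
  · simpa using (cs.isReflection_simple i).conj w⁻¹
  · rw [cs.length_simple_mul_of_not_isLeftDescent h]; omega

/-- By strong exchange, multiplying the step `x < x t` by `s` on the left reverses it only if `x t
x⁻¹ = s`. In that case `s x = x t`, which already lies below `w < s w`. -/
theorem bruhatLE_simple_mul_of_step {x t w : W} {i : B} (ht : cs.IsReflection t)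
    (hl : cs.length x < cs.length (x * t)) (hw : ¬ cs.IsLeftDescent w i)
    (h : cs.BruhatLE (x * t) w) (ih : cs.BruhatLE (cs.simple i * (x * t)) (cs.simple i * w)) :
    cs.BruhatLE (cs.simple i * x) (cs.simple i * w) := by
  by_cases hlt : cs.length (cs.simple i * x) < cs.length (cs.simple i * (x * t))
  · have h1 : cs.BruhatLT (cs.simple i * x) (cs.simple i * (x * t)) :=
      .single ⟨t, ht, by group, hlt⟩
    rcases ih with ih | ih
    · exact Or.inr (ih ▸ h1)
    · exact Or.inr (h1.trans ih)
  · have hr : cs.IsReflection (x * t * x⁻¹) := ht.conj x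
    have hx : x * t * x⁻¹ * (x * t) = x := by
      have : x * t * x⁻¹ * (x * t) = x * (t * t) := by group
      rw [this, ht.mul_self, mul_one]
    have heq : x * t * x⁻¹ = cs.simple i := by
      by_contra hne
      have h1 := (cs.length_reflection_mul_lt_iff hM hr hne (x * t)).1 (by rw [hx]; exact hl)
      rw [hx] at h1
      exact hlt h1
    have h2 : cs.simple i * x = x * t := by rw [← heq]; group
    rw [h2]
    rcases h with h | h
    · subst h
      exact Or.inr (cs.bruhatLT_simple_mul hw)
    · exact Or.inr (h.trans (cs.bruhatLT_simple_mul hw))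

theorem bruhatLE_simple_mul {x w : W} {i : B} (h : cs.BruhatLE x w)
    (hw : ¬ cs.IsLeftDescent w i) : cs.BruhatLE (cs.simple i * x) (cs.simple i * w) := by
  rcases h with rfl | h
  · exact Or.inl rfl
  · induction h using Relation.TransGen.head_induction_on with
    | single h =>
      obtain ⟨t, ht, rfl, hl⟩ := h
      exact cs.bruhatLE_simple_mul_of_step hM ht hl hw (Or.inl rfl) (Or.inl rfl)
    | head h h' ih =>
      obtain ⟨t, ht, rfl, hl⟩ := h
      exact cs.bruhatLE_simple_mul_of_step hM ht hl hw (Or.inr h') ih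

end RightAngled

end CoxeterSystem


/-! ### The Hecke algebra and its standard basis. -/

namespace CoxeterSystem

open HeckeScalars

section HeckeOperators

variable {B : Type*} {M : CoxeterMatrix B} {W : Type*} [Group W] (cs : CoxeterSystem M W)
variable {R : Type*} [CommSemiring R]

open Classical in
/-- Left multiplication by `T_s` in the Hecke algebra with relation `T_s² = a T_s + b`. -/
def genOp (a b : R) (i : B) : Module.End R (W →₀ R) :=
  Finsupp.linearCombination R fun w =>
    if cs.IsLeftDescent w i then
      a • Finsupp.single w (1 : R) + b • Finsupp.single (cs.simple i * w) (1 : R)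
    else Finsupp.single (cs.simple i * w) 1

theorem genOp_single_of_isLeftDescent (a b : R) {i : B} {w : W} (h : cs.IsLeftDescent w i) :
    cs.genOp a b i (Finsupp.single w 1) =
      a • Finsupp.single w (1 : R) + b • Finsupp.single (cs.simple i * w) (1 : R) := by
  simp [genOp, h]

theorem genOp_single_of_not_isLeftDescent (a b : R) {i : B} {w : W}
    (h : ¬ cs.IsLeftDescent w i) :
    cs.genOp a b i (Finsupp.single w 1) = Finsupp.single (cs.simple i * w) (1 : R) := by
  simp [genOp, h]

omit [Group W] in
theorem end_ext {f g : Module.End R (W →₀ R)}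
    (h : ∀ w, f (Finsupp.single w 1) = g (Finsupp.single w 1)) : f = g := by
  refine Finsupp.lhom_ext' fun w => LinearMap.ext_ring ?_
  exact h w

/-- The parameters stay general because three choices are used: `(q - 1, q)` for `T_s`, `(ξ, 1)` for
its normalized form, and `(X, 1)` over `ℕ[X]` for structure constants. -/
theorem genOp_sq (a b : R) (i : B) :
    cs.genOp a b i * cs.genOp a b i = a • cs.genOp a b i + b • 1 := by
  refine end_ext fun w => ?_
  simp only [Module.End.mul_apply, LinearMap.add_apply, LinearMap.smul_apply, Module.End.one_apply]
  by_cases h : cs.IsLeftDescent w i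
  · have h' : ¬ cs.IsLeftDescent (cs.simple i * w) i := by
      rw [isLeftDescent_simple_mul_iff]; simpa using h
    rw [cs.genOp_single_of_isLeftDescent a b h, map_add, map_smul, map_smul,
      cs.genOp_single_of_isLeftDescent a b h, cs.genOp_single_of_not_isLeftDescent a b h',
      simple_mul_simple_cancel_left]
  · have h' : cs.IsLeftDescent (cs.simple i * w) i := by
      rwa [isLeftDescent_simple_mul_iff]
    rw [cs.genOp_single_of_not_isLeftDescent a b h, cs.genOp_single_of_isLeftDescent a b h',
      simple_mul_simple_cancel_left]

theorem genOp_single_of_reduced (a b : R) {ω : List B} {y : W}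
    (h : cs.length (cs.wordProd ω * y) = ω.length + cs.length y) :
    (ω.map (cs.genOp a b)).prod (Finsupp.single y 1) = Finsupp.single (cs.wordProd ω * y) 1 := by
  induction ω with
  | nil => simp
  | cons i ω ih =>
    rw [wordProd_cons, mul_assoc, List.length_cons] at h
    have h1 := cs.length_mul_le (cs.wordProd ω) y
    have h2 := cs.length_wordProd_le ω
    have h3 := cs.length_simple_mul (cs.wordProd ω * y) i
    rw [List.map_cons, List.prod_cons, Module.End.mul_apply, ih (by omega),
      cs.genOp_single_of_not_isLeftDescent, wordProd_cons, mul_assoc]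
    rw [not_isLeftDescent_iff]
    omega

variable (hM : M.IsRightAngled)
include hM

theorem genOp_comm (a b : R) {i j : B} (h : M i j = 2) :
    cs.genOp a b i * cs.genOp a b j = cs.genOp a b j * cs.genOp a b i := by
  have h' : M j i = 2 := by rw [M.symmetric]; exact h
  have hc := cs.simple_commute h
  refine end_ext fun w => ?_
  simp only [Module.End.mul_apply]
  have d1 := cs.isLeftDescent_simple_mul_of_commute hM h (w := w)
  have d2 := cs.isLeftDescent_simple_mul_of_commute hM h' (w := w)
  have e : cs.simple i * (cs.simple j * w) = cs.simple j * (cs.simple i * w) := by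
    rw [← mul_assoc, hc, mul_assoc]
  by_cases hi : cs.IsLeftDescent w i <;> by_cases hj : cs.IsLeftDescent w j
  · simp only [cs.genOp_single_of_isLeftDescent a b hi, cs.genOp_single_of_isLeftDescent a b hj,
      map_add, map_smul, cs.genOp_single_of_isLeftDescent a b (d1.2 hj),
      cs.genOp_single_of_isLeftDescent a b (d2.2 hi), e]
    simp only [smul_add, smul_smul, mul_comm b a]
    abel
  · simp only [cs.genOp_single_of_isLeftDescent a b hi,
      cs.genOp_single_of_not_isLeftDescent a b hj, map_add, map_smul,
      cs.genOp_single_of_not_isLeftDescent a b (mt d1.1 hj),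
      cs.genOp_single_of_isLeftDescent a b (d2.2 hi), e]
  · simp only [cs.genOp_single_of_isLeftDescent a b hj,
      cs.genOp_single_of_not_isLeftDescent a b hi, map_add, map_smul,
      cs.genOp_single_of_not_isLeftDescent a b (mt d2.1 hi),
      cs.genOp_single_of_isLeftDescent a b (d1.2 hj), e]
  · simp only [cs.genOp_single_of_not_isLeftDescent a b hj,
      cs.genOp_single_of_not_isLeftDescent a b hi,
      cs.genOp_single_of_not_isLeftDescent a b (mt d2.1 hi),
      cs.genOp_single_of_not_isLeftDescent a b (mt d1.1 hj), e]

end HeckeOperators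

section ReducedProducts

variable {B : Type*} {M : CoxeterMatrix B} {W : Type*} [Group W] (cs : CoxeterSystem M W)
variable {G : Type*} [Monoid G]

/-- The product of the `f s` over a reduced word of `w`. -/
def redProd (f : B → G) (w : W) : G := ((cs.reducedWord w).map f).prod

theorem reducedWord_isReduced (w : W) : cs.IsReduced (cs.reducedWord w) :=
  (cs.exists_isReduced w).choose_spec.1

theorem wordProd_reducedWord (w : W) : cs.wordProd (cs.reducedWord w) = w :=
  (cs.exists_isReduced w).choose_spec.2.symm

theorem length_reducedWord (w : W) : (cs.reducedWord w).length = cs.length w := by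
  rw [← (cs.reducedWord_isReduced w).eq, wordProd_reducedWord]

theorem redProd_one (f : B → G) : cs.redProd f 1 = 1 := by
  have h := cs.length_reducedWord 1
  rw [length_one, List.length_eq_zero_iff] at h
  simp [redProd, h]

variable (hM : M.IsRightAngled) {f : B → G} (hf : ∀ i j, M i j = 2 → f i * f j = f j * f i)
include hM hf

theorem redProd_wordProd {ω : List B} (hω : cs.IsReduced ω) :
    cs.redProd f (cs.wordProd ω) = (ω.map f).prod :=
  cs.prod_map_eq_of_isReduced hM f hf (cs.reducedWord_isReduced _) hω (cs.wordProd_reducedWord _)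

theorem redProd_mul {x y : W} (h : cs.length (x * y) = cs.length x + cs.length y) :
    cs.redProd f (x * y) = cs.redProd f x * cs.redProd f y := by
  have h1 : cs.wordProd (cs.reducedWord x ++ cs.reducedWord y) = x * y := by
    rw [wordProd_append, wordProd_reducedWord, wordProd_reducedWord]
  have h2 : cs.IsReduced (cs.reducedWord x ++ cs.reducedWord y) := by
    unfold IsReduced
    rw [h1, h, List.length_append, length_reducedWord, length_reducedWord]
  rw [← h1, redProd_wordProd cs hM hf h2, List.map_append, List.prod_append]
  rfl

theorem redProd_simple (i : B) : cs.redProd f (cs.simple i) = f i := by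
  have h : cs.IsReduced [i] := by simp [IsReduced]
  have := cs.redProd_wordProd hM hf h
  simpa using this

theorem redProd_simple_mul {w : W} {i : B} (h : ¬ cs.IsLeftDescent w i) :
    cs.redProd f (cs.simple i * w) = f i * cs.redProd f w := by
  rw [redProd_mul cs hM hf, redProd_simple cs hM hf]
  rw [cs.length_simple_mul_of_not_isLeftDescent h, length_simple, add_comm]

end ReducedProducts

section HeckeAlgebra

variable {B : Type*} {M : CoxeterMatrix B} {W : Type*} [Group W] (cs : CoxeterSystem M W)

theorem heckeLeft_eq_genOp (i : B) : cs.heckeLeft i = cs.genOp (q - 1) q i := rfl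

theorem heckeT_eq_redProd (w : W) : cs.heckeT w = cs.redProd cs.heckeGen w := rfl

theorem heckeT_one : cs.heckeT 1 = 1 := cs.redProd_one _

theorem heckeGen_sq (i : B) :
    cs.heckeGen i * cs.heckeGen i = (q - 1) • cs.heckeGen i + q • 1 := by
  apply Subtype.ext
  exact cs.genOp_sq (q - 1) q i

variable (hM : M.IsRightAngled)
include hM

theorem heckeGen_comm (i j : B) (h : M i j = 2) :
    cs.heckeGen i * cs.heckeGen j = cs.heckeGen j * cs.heckeGen i :=
  Subtype.ext (cs.genOp_comm hM _ _ h)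

theorem heckeT_simple_mul {w : W} {i : B} (h : ¬ cs.IsLeftDescent w i) :
    cs.heckeT (cs.simple i * w) = cs.heckeGen i * cs.heckeT w :=
  cs.redProd_simple_mul hM (cs.heckeGen_comm hM) h

theorem heckeGen_mul_heckeT {w : W} {i : B} (h : cs.IsLeftDescent w i) :
    cs.heckeGen i * cs.heckeT w = (q - 1) • cs.heckeT w + q • cs.heckeT (cs.simple i * w) := by
  have h' : ¬ cs.IsLeftDescent (cs.simple i * w) i := by
    rw [isLeftDescent_simple_mul_iff]; simpa using h
  have h1 := cs.heckeT_simple_mul hM h'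
  rw [simple_mul_simple_cancel_left] at h1
  rw [h1, ← mul_assoc, heckeGen_sq]
  simp [add_mul]

/-- The element `∑ f_w T_w` of the Hecke algebra. -/
def ofCoeffs : (W →₀ HeckeScalars) →ₗ[HeckeScalars] cs.hecke :=
  Finsupp.linearCombination HeckeScalars cs.heckeT

omit hM in
theorem ofCoeffs_single (w : W) (a : HeckeScalars) :
    cs.ofCoeffs (Finsupp.single w a) = a • cs.heckeT w := by
  simp [ofCoeffs]

theorem ofCoeffs_heckeLeft (i : B) (f : W →₀ HeckeScalars) :
    cs.ofCoeffs (cs.heckeLeft i f) = cs.heckeGen i * cs.ofCoeffs f := by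
  have : cs.ofCoeffs ∘ₗ cs.heckeLeft i =
      (LinearMap.mulLeft HeckeScalars (cs.heckeGen i)) ∘ₗ cs.ofCoeffs := by
    refine Finsupp.lhom_ext' fun w => LinearMap.ext_ring ?_
    change cs.ofCoeffs (cs.heckeLeft i (Finsupp.single w 1)) =
      cs.heckeGen i * cs.ofCoeffs (Finsupp.single w 1)
    rw [ofCoeffs_single, one_smul, heckeLeft_eq_genOp]
    by_cases h : cs.IsLeftDescent w i
    · rw [cs.genOp_single_of_isLeftDescent _ _ h, heckeGen_mul_heckeT cs hM h, map_add, map_smul,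
        map_smul, ofCoeffs_single, ofCoeffs_single, one_smul, one_smul]
    · rw [cs.genOp_single_of_not_isLeftDescent _ _ h, ofCoeffs_single, one_smul,
        heckeT_simple_mul cs hM h]
  exact LinearMap.congr_fun this f

omit hM in
theorem heckeCoeff_heckeT (w : W) : cs.heckeCoeff (cs.heckeT w) = Finsupp.single w 1 := by
  have h1 : ((cs.heckeT w : cs.hecke) : Module.End HeckeScalars (W →₀ HeckeScalars)) =
      ((cs.reducedWord w).map (cs.genOp (q - 1) q)).prod := by
    have := map_list_prod cs.hecke.val ((cs.reducedWord w).map cs.heckeGen)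
    rw [List.map_map] at this
    exact this
  unfold heckeCoeff
  rw [h1, cs.genOp_single_of_reduced, wordProd_reducedWord, mul_one]
  rw [wordProd_reducedWord, mul_one, length_reducedWord, length_one, add_zero]

/-- Passing from coordinates to `∑ f_w T_w` intertwines the operators with left multiplication, so
an element of the algebra is recovered from its value at `T_1`. Together with `heckeCoeff_heckeT`
this makes the `T_w` a basis. -/
theorem ofCoeffs_heckeCoeff (h : cs.hecke) : cs.ofCoeffs (cs.heckeCoeff h) = h := by
  have key : ∀ x ∈ cs.hecke, ∀ f : W →₀ HeckeScalars,
      ((cs.ofCoeffs (x f) : cs.hecke) : Module.End HeckeScalars (W →₀ HeckeScalars)) =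
        x * cs.ofCoeffs f := by
    intro x hx
    induction hx using Algebra.adjoin_induction with
    | mem x hx =>
      obtain ⟨i, rfl⟩ := hx
      intro f
      rw [ofCoeffs_heckeLeft cs hM]
      rfl
    | algebraMap r =>
      intro f
      simp [Algebra.algebraMap_eq_smul_one]
    | add x y _ _ hx hy =>
      intro f
      rw [LinearMap.add_apply, map_add, Subalgebra.coe_add, hx, hy, add_mul]
    | mul x y _ _ hx hy =>
      intro f
      rw [Module.End.mul_apply, hx, hy, mul_assoc]
  apply Subtype.ext
  have := key h.1 h.2 (Finsupp.single 1 1)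
  rw [ofCoeffs_single, heckeT_one] at this
  simpa [heckeCoeff] using this

theorem ofCoeffs_surjective : Function.Surjective cs.ofCoeffs :=
  fun h => ⟨_, cs.ofCoeffs_heckeCoeff hM h⟩

end HeckeAlgebra

end CoxeterSystem


/-! ### Normalized coordinates and the bar involution. -/

namespace HeckeScalars

theorem qHalf_add (j k : ℤ) : qHalf (j + k) = qHalf j * qHalf k := LaurentPolynomial.T_add j k

theorem qHalf_zero : qHalf 0 = 1 := LaurentPolynomial.T_zero

theorem bar_qHalf (k : ℤ) : bar (qHalf k) = qHalf (-k) := LaurentPolynomial.invert_T k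

theorem bar_add (a b : HeckeScalars) : bar (a + b) = bar a + bar b :=
  map_add LaurentPolynomial.invert a b

theorem bar_mul (a b : HeckeScalars) : bar (a * b) = bar a * bar b :=
  map_mul LaurentPolynomial.invert a b

theorem bar_sub (a b : HeckeScalars) : bar (a - b) = bar a - bar b :=
  map_sub LaurentPolynomial.invert a b

theorem bar_zero : bar 0 = 0 := map_zero LaurentPolynomial.invert

theorem bar_one : bar 1 = 1 := map_one LaurentPolynomial.invert

theorem bar_intCast (m : ℤ) : bar m = m := map_intCast LaurentPolynomial.invert m

theorem coeff_bar (a : HeckeScalars) (e : ℤ) : (bar a).coeff e = a.coeff (-e) :=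
  LaurentPolynomial.invert_apply a e

theorem coeff_qHalf_mul (k : ℤ) (a : HeckeScalars) (e : ℤ) :
    (qHalf k * a).coeff e = a.coeff (e - k) := by
  have h := AddMonoidAlgebra.coeff_single_mul_apply a (1 : ℤ) k e
  rw [one_mul, neg_add_eq_sub] at h
  exact h

/-- The element `q^{1/2} - q^{-1/2}`. -/
def xi : HeckeScalars := qHalf 1 - qHalf (-1)

theorem bar_xi : bar xi = -xi := by
  simp [xi, bar_sub, bar_qHalf]

theorem q_eq : q = qHalf 1 * qHalf 1 := by
  rw [← qHalf_add]; rfl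

theorem qHalf_mul_neg (k : ℤ) : qHalf k * qHalf (-k) = 1 := by
  rw [← qHalf_add, add_neg_cancel, qHalf_zero]

end HeckeScalars

namespace CoxeterSystem

open HeckeScalars

section Bar

variable {B : Type*} {M : CoxeterMatrix B} {W : Type*} [Group W] (cs : CoxeterSystem M W)

/-- Left multiplication by `C_s = q^{-1/2} T_s - q^{1/2}` in normalized coordinates. -/
def cOp (i : B) : Module.End HeckeScalars (W →₀ HeckeScalars) :=
  cs.genOp xi 1 i + (-qHalf 1) • 1

/-- The element `∑ f_w q^{-ℓ(w)/2} T_w` of the Hecke algebra. -/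
def normElt : (W →₀ HeckeScalars) →ₗ[HeckeScalars] cs.hecke :=
  Finsupp.linearCombination HeckeScalars fun w => qHalf (-cs.length w) • cs.heckeT w

/-- The normalized generator `q^{-1/2} T_s`. -/
def normGen (i : B) : cs.hecke := qHalf (-1) • cs.heckeGen i

theorem normElt_single (w : W) (a : HeckeScalars) :
    cs.normElt (Finsupp.single w a) = a • qHalf (-cs.length w) • cs.heckeT w := by
  simp [normElt]

theorem normGen_sq (i : B) : cs.normGen i * cs.normGen i = xi • cs.normGen i + 1 := by
  rw [normGen, smul_mul_smul_comm, heckeGen_sq, smul_add, smul_smul, smul_smul, smul_smul, q_eq]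
  have h1 := qHalf_mul_neg 1
  rw [show qHalf (-1) * qHalf (-1) * (qHalf 1 * qHalf 1 - 1) = xi * qHalf (-1) by
      rw [xi]; linear_combination (qHalf 1 * qHalf (-1)) * h1,
    show qHalf (-1) * qHalf (-1) * (qHalf 1 * qHalf 1) = 1 by
      linear_combination (qHalf 1 * qHalf (-1) + 1) * h1, one_smul]

theorem heckeCoeff_normElt (f : W →₀ HeckeScalars) (w : W) :
    cs.heckeCoeff (cs.normElt f) w = f w * qHalf (-cs.length w) := by
  induction f using Finsupp.induction_linear with
  | zero => simp [heckeCoeff]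
  | add f g hf hg =>
    have : cs.heckeCoeff (cs.normElt (f + g)) =
        cs.heckeCoeff (cs.normElt f) + cs.heckeCoeff (cs.normElt g) := by
      simp [heckeCoeff, map_add]
    rw [this, Finsupp.add_apply, hf, hg, Finsupp.add_apply, add_mul]
  | single y a =>
    rw [normElt_single]
    change (a • qHalf (-cs.length y) • cs.heckeCoeff (cs.heckeT y)) w = _
    rw [heckeCoeff_heckeT]
    by_cases h : y = w
    · subst h; simp
    · simp [Finsupp.single_eq_of_ne' h]

theorem normElt_injective : Function.Injective cs.normElt := by
  intro f g h
  ext1 w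
  have h1 := cs.heckeCoeff_normElt f w
  rw [h, heckeCoeff_normElt] at h1
  have h2 := congrArg (· * qHalf (cs.length w)) h1
  simpa [mul_assoc, mul_comm (qHalf (-_)), qHalf_mul_neg] using h2.symm

variable (hM : M.IsRightAngled)
include hM

theorem normElt_surjective : Function.Surjective cs.normElt := by
  intro h
  obtain ⟨f, rfl⟩ := cs.ofCoeffs_surjective hM h
  change cs.ofCoeffs f ∈ LinearMap.range cs.normElt
  induction f using Finsupp.induction_linear with
  | zero => simp
  | add f g hf hg => rw [map_add]; exact add_mem hf hg
  | single w a =>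
    refine ⟨Finsupp.single w (a * qHalf (cs.length w)), ?_⟩
    rw [normElt_single, ofCoeffs_single, smul_smul, mul_assoc, qHalf_mul_neg, mul_one]

theorem normElt_genOp (i : B) (f : W →₀ HeckeScalars) :
    cs.normElt (cs.genOp xi 1 i f) = cs.normGen i * cs.normElt f := by
  have h1 := qHalf_mul_neg 1
  have : cs.normElt ∘ₗ cs.genOp xi 1 i =
      (LinearMap.mulLeft HeckeScalars (cs.normGen i)) ∘ₗ cs.normElt := by
    refine Finsupp.lhom_ext' fun w => LinearMap.ext_ring ?_
    change cs.normElt (cs.genOp xi 1 i (Finsupp.single w 1)) =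
      cs.normGen i * cs.normElt (Finsupp.single w 1)
    rw [normElt_single, one_smul, normGen, smul_mul_smul_comm]
    by_cases h : cs.IsLeftDescent w i
    · have hl : ((cs.length (cs.simple i * w) : ℕ) : ℤ) = cs.length w + (-1) := by
        have := cs.length_simple_mul_of_isLeftDescent h; omega
      rw [cs.genOp_single_of_isLeftDescent _ _ h, heckeGen_mul_heckeT cs hM h, map_add, map_smul,
        map_smul, normElt_single, normElt_single, one_smul, one_smul, one_smul, smul_add,
        smul_smul, smul_smul, smul_smul, hl, neg_add, neg_neg, qHalf_add, q_eq, xi]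
      congr 2
      · linear_combination (-qHalf 1 * qHalf (-↑(cs.length w))) * h1
      · linear_combination (-qHalf 1 * qHalf (-↑(cs.length w))) * h1
    · have hl : ((cs.length (cs.simple i * w) : ℕ) : ℤ) = 1 + cs.length w := by
        have := cs.length_simple_mul_of_not_isLeftDescent h; omega
      rw [cs.genOp_single_of_not_isLeftDescent _ _ h, normElt_single, one_smul,
        heckeT_simple_mul cs hM h, hl, neg_add, qHalf_add]
  exact LinearMap.congr_fun this f

theorem normElt_cOp (i : B) (f : W →₀ HeckeScalars) :
    cs.normElt (cs.cOp i f) = (cs.normGen i + (-qHalf 1) • 1) * cs.normElt f := by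
  rw [cOp, LinearMap.add_apply, map_add, normElt_genOp cs hM, add_mul, LinearMap.smul_apply,
    Module.End.one_apply, map_smul, smul_mul_assoc, one_mul]

omit hM in
/-- The inverse of the normalized generator. -/
def normGenInv (i : B) : cs.hecke := cs.normGen i + (-xi) • 1

omit hM in
theorem normGen_mul_normGenInv (i : B) : cs.normGen i * cs.normGenInv i = 1 := by
  rw [normGenInv, mul_add, normGen_sq, mul_smul_comm, mul_one, add_right_comm, ← add_smul,
    add_neg_cancel, zero_smul, zero_add]

omit hM in
theorem normGenInv_mul_normGen (i : B) : cs.normGenInv i * cs.normGen i = 1 := by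
  rw [normGenInv, add_mul, normGen_sq, smul_mul_assoc, one_mul, add_right_comm, ← add_smul,
    add_neg_cancel, zero_smul, zero_add]

omit hM in
/-- The generator `T_s` as a unit of the Hecke algebra. -/
def heckeGenUnit (i : B) : (cs.hecke)ˣ where
  val := cs.heckeGen i
  inv := qHalf (-1) • cs.normGenInv i
  val_inv := by
    rw [mul_smul_comm, ← smul_mul_assoc]
    exact cs.normGen_mul_normGenInv i
  inv_val := by
    rw [smul_mul_assoc, ← mul_smul_comm]
    exact cs.normGenInv_mul_normGen i

omit hM in
theorem isUnit_heckeGen (i : B) : IsUnit (cs.heckeGen i) := ⟨cs.heckeGenUnit i, rfl⟩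

omit hM in
theorem isUnit_heckeT (w : W) : IsUnit (cs.heckeT w) := by
  unfold heckeT
  induction cs.reducedWord w with
  | nil => simp
  | cons i ω ih =>
    rw [List.map_cons, List.prod_cons]
    exact (cs.isUnit_heckeGen i).mul ih

/-- The image of `q^{-ℓ(w)/2} T_w` under the bar involution. -/
def barBasis (w : W) : cs.hecke := qHalf (cs.length w) • Ring.inverse (cs.heckeT w⁻¹)

omit hM in
theorem barBasis_one : cs.barBasis 1 = 1 := by
  simp [barBasis, heckeT_one, qHalf_zero]

/-- The order of factors is reversed twice, once by `w⁻¹` and once by inversion in the algebra, so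
the bar image of a reduced product keeps the original order. -/
theorem barBasis_simple_mul {w : W} {i : B} (h : ¬ cs.IsLeftDescent w i) :
    cs.barBasis (cs.simple i * w) = cs.normGenInv i * cs.barBasis w := by
  have hT : cs.heckeT (cs.simple i * w)⁻¹ = cs.heckeT w⁻¹ * cs.heckeGen i := by
    rw [mul_inv_rev, inv_simple, heckeT_eq_redProd,
      cs.redProd_mul hM (cs.heckeGen_comm hM), cs.redProd_simple hM (cs.heckeGen_comm hM)]
    · rfl
    · rw [← length_inv, mul_inv_rev, inv_simple, inv_inv, length_inv, length_simple,
        cs.length_simple_mul_of_not_isLeftDescent h]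
  have hl : ((cs.length (cs.simple i * w) : ℕ) : ℤ) = 1 + cs.length w := by
    have := cs.length_simple_mul_of_not_isLeftDescent h; omega
  obtain ⟨u, hu⟩ := cs.isUnit_heckeT w⁻¹
  unfold barBasis
  rw [hT, ← hu, show cs.heckeGen i = (cs.heckeGenUnit i : cs.hecke) from rfl, ← Units.val_mul,
    Ring.inverse_unit, Ring.inverse_unit, mul_inv_rev,
    Units.val_mul, show (((cs.heckeGenUnit i)⁻¹ : (cs.hecke)ˣ) : cs.hecke) =
      qHalf (-1) • cs.normGenInv i from rfl, hl, qHalf_add, smul_mul_assoc, mul_smul_comm,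
    smul_smul]
  congr 1
  linear_combination qHalf (cs.length w) * qHalf_mul_neg 1

omit hM in
theorem heckeBar_normElt (f : W →₀ HeckeScalars) :
    cs.heckeBar (cs.normElt f) = f.sum fun w a => bar a • cs.barBasis w := by
  have hc : ∀ w, cs.heckeCoeff (cs.normElt f) w = f w * qHalf (-cs.length w) :=
    cs.heckeCoeff_normElt f
  have hs : (cs.heckeCoeff (cs.normElt f)).support ⊆ f.support := by
    intro w hw
    rw [Finsupp.mem_support_iff] at hw ⊢
    intro h0
    exact hw (by rw [hc, h0, zero_mul])
  unfold heckeBar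
  rw [Finsupp.sum_of_support_subset _ hs _ (by simp [bar_zero]), Finsupp.sum]
  refine Finset.sum_congr rfl fun w _ => ?_
  rw [hc, bar_mul, bar_qHalf, neg_neg, barBasis, smul_smul]

omit hM in
theorem heckeBar_normElt_add (f g : W →₀ HeckeScalars) :
    cs.heckeBar (cs.normElt (f + g)) =
      cs.heckeBar (cs.normElt f) + cs.heckeBar (cs.normElt g) := by
  simp only [heckeBar_normElt]
  exact Finsupp.sum_add_index' (by simp [bar_zero]) (by simp [bar_add, add_smul])

omit hM in
theorem heckeBar_normElt_smul (a : HeckeScalars) (f : W →₀ HeckeScalars) :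
    cs.heckeBar (cs.normElt (a • f)) = bar a • cs.heckeBar (cs.normElt f) := by
  simp only [heckeBar_normElt]
  rw [Finsupp.sum_smul_index (by simp [bar_zero]), Finsupp.smul_sum]
  simp only [bar_mul, smul_smul]

omit hM in
theorem heckeBar_normElt_single (w : W) (a : HeckeScalars) :
    cs.heckeBar (cs.normElt (Finsupp.single w a)) = bar a • cs.barBasis w := by
  rw [heckeBar_normElt, Finsupp.sum_single_index (by simp [bar_zero])]

/-- This is the only case of multiplicativity of the bar involution that is needed. At a descent it
works because `ξ` changes sign and the inverse of `T̃_s` is `T̃_s - ξ`. -/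
theorem heckeBar_normElt_genOp (i : B) (f : W →₀ HeckeScalars) :
    cs.heckeBar (cs.normElt (cs.genOp xi 1 i f)) =
      cs.normGenInv i * cs.heckeBar (cs.normElt f) := by
  induction f using Finsupp.induction_linear with
  | zero => rw [map_zero, heckeBar_normElt]; simp
  | add f g hf hg => rw [map_add, heckeBar_normElt_add, heckeBar_normElt_add, hf, hg, mul_add]
  | single w a =>
    rw [← mul_one a, ← smul_eq_mul, ← Finsupp.smul_single, map_smul, heckeBar_normElt_smul,
      heckeBar_normElt_smul, mul_smul_comm, heckeBar_normElt_single, bar_one, one_smul]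
    congr 1
    by_cases h : cs.IsLeftDescent w i
    · have h' : ¬ cs.IsLeftDescent (cs.simple i * w) i := by
        rw [isLeftDescent_simple_mul_iff]; simpa using h
      have h1 := cs.barBasis_simple_mul hM h'
      rw [simple_mul_simple_cancel_left] at h1
      have h2 : cs.barBasis (cs.simple i * w) = cs.normGen i * cs.barBasis w := by
        rw [h1, ← mul_assoc, normGen_mul_normGenInv, one_mul]
      rw [cs.genOp_single_of_isLeftDescent _ _ h, heckeBar_normElt_add, heckeBar_normElt_smul,
        heckeBar_normElt_smul, heckeBar_normElt_single, heckeBar_normElt_single, bar_one, one_smul,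
        one_smul, one_smul, h2, bar_xi, normGenInv, add_mul, smul_mul_assoc, one_mul, add_comm]
    · rw [cs.genOp_single_of_not_isLeftDescent _ _ h, heckeBar_normElt_single, bar_one, one_smul,
        barBasis_simple_mul cs hM h]

/-- `normElt` as a linear equivalence. -/
def normEquiv : (W →₀ HeckeScalars) ≃ₗ[HeckeScalars] cs.hecke :=
  LinearEquiv.ofBijective cs.normElt ⟨cs.normElt_injective, cs.normElt_surjective hM⟩

/-- The bar involution in normalized coordinates. -/
def barF (f : W →₀ HeckeScalars) : W →₀ HeckeScalars :=
  (cs.normEquiv hM).symm (cs.heckeBar (cs.normElt f))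

theorem normElt_barF (f : W →₀ HeckeScalars) :
    cs.normElt (cs.barF hM f) = cs.heckeBar (cs.normElt f) :=
  (cs.normEquiv hM).apply_symm_apply _

theorem barF_add (f g : W →₀ HeckeScalars) :
    cs.barF hM (f + g) = cs.barF hM f + cs.barF hM g := by
  apply cs.normElt_injective
  rw [map_add, normElt_barF, normElt_barF, normElt_barF, heckeBar_normElt_add]

theorem barF_smul (a : HeckeScalars) (f : W →₀ HeckeScalars) :
    cs.barF hM (a • f) = bar a • cs.barF hM f := by
  apply cs.normElt_injective
  rw [map_smul, normElt_barF, normElt_barF, heckeBar_normElt_smul]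

theorem barF_zero : cs.barF hM 0 = 0 := by
  have := cs.barF_smul hM 0 0
  rwa [zero_smul, bar_zero, zero_smul] at this

theorem barF_single_one : cs.barF hM (Finsupp.single 1 1) = Finsupp.single 1 1 := by
  apply cs.normElt_injective
  rw [normElt_barF, heckeBar_normElt_single, barBasis_one, bar_one, normElt_single, heckeT_one]
  simp [qHalf_zero]

/-- `C_s` is bar-invariant: `T̃_s⁻¹ - q^{-1/2} = T̃_s - ξ - q^{-1/2} = T̃_s - q^{1/2}`. -/
theorem barF_cOp (i : B) (f : W →₀ HeckeScalars) :
    cs.barF hM (cs.cOp i f) = cs.cOp i (cs.barF hM f) := by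
  apply cs.normElt_injective
  rw [normElt_barF, normElt_cOp cs hM i (cs.barF hM f), normElt_barF, cOp, LinearMap.add_apply,
    heckeBar_normElt_add, heckeBar_normElt_genOp cs hM, LinearMap.smul_apply,
    Module.End.one_apply, heckeBar_normElt_smul, normGenInv, add_mul, add_mul, smul_mul_assoc,
    smul_mul_assoc, one_mul, add_assoc, ← add_smul]
  congr 2
  have : bar (-qHalf 1) = -qHalf (-1) := by
    rw [← zero_sub, bar_sub, bar_zero, bar_qHalf, zero_sub]
  rw [this, xi]
  ring

end Bar

end CoxeterSystem


/-! ### Existence and uniqueness of the Kazhdan–Lusztig basis. -/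

namespace HeckeScalars

/-- The elements of `q^{k/2} ℤ[q^{1/2}]`. -/
def lowSub (k : ℤ) : AddSubgroup HeckeScalars where
  carrier := {a | ∀ e < k, a.coeff e = 0}
  add_mem' := by
    intro a b ha hb e he
    change (a + b).coeff e = 0
    rw [AddMonoidAlgebra.coeff_add, Finsupp.add_apply, ha e he, hb e he, add_zero]
  zero_mem' := by intro e _; rfl
  neg_mem' := by
    intro a ha e he
    have : (-a).coeff e = -(a.coeff e) := by simp
    rw [this, ha e he, neg_zero]

theorem mem_lowSub {k : ℤ} {a : HeckeScalars} : a ∈ lowSub k ↔ ∀ e < k, a.coeff e = 0 := Iff.rfl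

theorem lowSub_mono {j k : ℤ} (h : j ≤ k) : lowSub k ≤ lowSub j :=
  fun _ ha e he => ha e (by omega)

theorem qHalf_mul_mem_lowSub {j k : ℤ} {a : HeckeScalars} :
    qHalf j * a ∈ lowSub (j + k) ↔ a ∈ lowSub k := by
  simp only [mem_lowSub, coeff_qHalf_mul]
  constructor
  · intro h e he
    have := h (e + j) (by omega)
    rwa [add_sub_cancel_right] at this
  · intro h e he
    exact h _ (by omega)

theorem intCast_mul_mem_lowSub {k : ℤ} {a : HeckeScalars} (m : ℤ) (h : a ∈ lowSub k) :
    (m : HeckeScalars) * a ∈ lowSub k := by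
  rw [← zsmul_eq_mul]
  exact zsmul_mem h m

theorem mul_mem_lowSub {j k : ℤ} {a b : HeckeScalars} (ha : a ∈ lowSub j) (hb : b ∈ lowSub k) :
    a * b ∈ lowSub (j + k) := by
  have h : a = ∑ e ∈ a.coeff.support, AddMonoidAlgebra.single e (a.coeff e) := by
    conv_lhs => rw [← AddMonoidAlgebra.sum_coeff_single a]
    rfl
  rw [h, Finset.sum_mul]
  refine sum_mem fun e he => ?_
  have hj : j ≤ e := by
    by_contra hlt
    exact (Finsupp.mem_support_iff.1 he) (ha e (by omega))
  intro d hd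
  rw [AddMonoidAlgebra.coeff_single_mul_apply, hb, mul_zero]
  omega

/-- The elements of `q^{k/2} ℤ[q^{-1}]`. -/
def parSub (k : ℤ) : AddSubgroup HeckeScalars where
  carrier := {a | ∀ e, a.coeff e ≠ 0 → e ≤ k ∧ Even (k - e)}
  add_mem' := by
    intro a b ha hb e he
    rw [AddMonoidAlgebra.coeff_add, Finsupp.add_apply] at he
    by_cases h : a.coeff e = 0
    · exact hb e (by rwa [h, zero_add] at he)
    · exact ha e h
  zero_mem' := by intro e he; exact absurd rfl he
  neg_mem' := by
    intro a ha e he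
    have : (-a).coeff e = -(a.coeff e) := by simp
    rw [this, neg_ne_zero] at he
    exact ha e he

theorem parSub_mono {j k : ℤ} (h : j ≤ k) (h' : Even (k - j)) : parSub j ≤ parSub k := by
  intro a ha e he
  obtain ⟨h1, h2⟩ := ha e he
  refine ⟨by omega, ?_⟩
  have := h'.add h2
  rwa [sub_add_sub_cancel] at this

theorem qHalf_mul_mem_parSub {j k : ℤ} {a : HeckeScalars} (h : a ∈ parSub k) :
    qHalf j * a ∈ parSub (j + k) := by
  intro e he
  rw [coeff_qHalf_mul] at he
  obtain ⟨h1, h2⟩ := h _ he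
  refine ⟨by omega, ?_⟩
  convert h2 using 1
  ring

theorem coeff_intCast_mul (m : ℤ) (a : HeckeScalars) (e : ℤ) :
    ((m : HeckeScalars) * a).coeff e = m * a.coeff e := by
  rw [← zsmul_eq_mul]
  exact AddMonoidAlgebra.coeff_smul_apply m a e

theorem eq_zero_of_bar_eq {a : HeckeScalars} (h : bar a = a) (ha : a ∈ lowSub 1) : a = 0 := by
  apply LaurentPolynomial.ext
  intro e
  change a.coeff e = 0
  by_cases he : e < 1
  · exact ha e he
  · rw [← h, coeff_bar]
    exact ha _ (by omega)

end HeckeScalars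

namespace CoxeterSystem

open HeckeScalars

section KLBasis

variable {B : Type*} {M : CoxeterMatrix B} {W : Type*} [Group W] (cs : CoxeterSystem M W)

open Classical in
theorem genOp_apply {R : Type*} [CommSemiring R] (a b : R) (i : B) (f : W →₀ R) (y : W) :
    cs.genOp a b i f y =
      if cs.IsLeftDescent y i then f (cs.simple i * y) + a * f y else b * f (cs.simple i * y) := by
  induction f using Finsupp.induction_linear with
  | zero => simp
  | add f g hf hg =>
    rw [map_add, Finsupp.add_apply, hf, hg]
    simp only [Finsupp.add_apply]
    split_ifs <;> ring
  | single w c =>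
    have hne : ∀ x : W, cs.simple i * x ≠ x := by
      intro x hx
      exact cs.length_simple_mul_ne x i (by rw [hx])
    have hsw : cs.simple i * y = w ↔ cs.simple i * w = y := by
      constructor <;> rintro rfl <;> simp
    have e1 : (Finsupp.single w c : W →₀ R) = c • Finsupp.single w 1 := by simp
    rw [e1, map_smul]
    by_cases hw : cs.IsLeftDescent w i
    · rw [cs.genOp_single_of_isLeftDescent _ _ hw]
      by_cases h1 : w = y
      · subst h1
        simp [hw, (hne w), mul_comm]
      · by_cases h2 : cs.simple i * w = y
        · subst h2
          have : ¬ cs.IsLeftDescent (cs.simple i * w) i := by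
            rw [isLeftDescent_simple_mul_iff]; simpa using hw
          simp [this, Finsupp.single_eq_of_ne' h1, mul_comm]
        · have h3 : w ≠ cs.simple i * y := fun h => h2 (hsw.1 h.symm)
          simp [Finsupp.single_eq_of_ne' h1, Finsupp.single_eq_of_ne' h2,
            Finsupp.single_eq_of_ne' h3]
    · rw [cs.genOp_single_of_not_isLeftDescent _ _ hw]
      by_cases h2 : cs.simple i * w = y
      · subst h2
        have : cs.IsLeftDescent (cs.simple i * w) i := by
          rwa [isLeftDescent_simple_mul_iff]
        simp [this, Finsupp.single_eq_of_ne' (hne w).symm]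
      · have h3 : w ≠ cs.simple i * y := fun h => h2 (hsw.1 h.symm)
        by_cases h1 : w = y
        · subst h1
          simp [hw, Finsupp.single_eq_of_ne' h2, Finsupp.single_eq_of_ne' h3]
        · simp [Finsupp.single_eq_of_ne' h1, Finsupp.single_eq_of_ne' h2,
            Finsupp.single_eq_of_ne' h3]

theorem cOp_apply_of_isLeftDescent {i : B} (f : W →₀ HeckeScalars) {y : W}
    (h : cs.IsLeftDescent y i) :
    cs.cOp i f y = f (cs.simple i * y) - qHalf (-1) * f y := by
  simp only [cOp, LinearMap.add_apply, LinearMap.smul_apply, Module.End.one_apply,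
    Finsupp.add_apply, Finsupp.smul_apply, smul_eq_mul, genOp_apply, if_pos h, xi]
  ring

theorem cOp_apply_of_not_isLeftDescent {i : B} (f : W →₀ HeckeScalars) {y : W}
    (h : ¬ cs.IsLeftDescent y i) :
    cs.cOp i f y = f (cs.simple i * y) - qHalf 1 * f y := by
  simp only [cOp, LinearMap.add_apply, LinearMap.smul_apply, Module.End.one_apply,
    Finsupp.add_apply, Finsupp.smul_apply, smul_eq_mul, genOp_apply, if_neg h]
  ring

theorem cOp_cOp (i : B) (f : W →₀ HeckeScalars) :
    cs.cOp i (cs.cOp i f) = (-(qHalf 1 + qHalf (-1))) • cs.cOp i f := by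
  ext1 y
  have h1 := qHalf_mul_neg 1
  rw [Finsupp.smul_apply, smul_eq_mul]
  by_cases h : cs.IsLeftDescent y i
  · have h' : ¬ cs.IsLeftDescent (cs.simple i * y) i := by
      rw [isLeftDescent_simple_mul_iff]; simpa using h
    rw [cs.cOp_apply_of_isLeftDescent _ h, cs.cOp_apply_of_not_isLeftDescent _ h',
      cs.cOp_apply_of_isLeftDescent _ h, simple_mul_simple_cancel_left]
    linear_combination (-f y) * h1
  · have h' : cs.IsLeftDescent (cs.simple i * y) i := by
      rwa [isLeftDescent_simple_mul_iff]
    rw [cs.cOp_apply_of_not_isLeftDescent _ h, cs.cOp_apply_of_isLeftDescent _ h',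
      cs.cOp_apply_of_not_isLeftDescent _ h, simple_mul_simple_cancel_left]
    linear_combination (-f y) * h1

variable (hM : M.IsRightAngled)
include hM

theorem barF_sum {ι : Type*} (s : Finset ι) (g : ι → W →₀ HeckeScalars) :
    cs.barF hM (∑ z ∈ s, g z) = ∑ z ∈ s, cs.barF hM (g z) := by
  classical
  induction s using Finset.induction_on with
  | empty => simp [barF_zero]
  | insert a s ha ih => rw [Finset.sum_insert ha, Finset.sum_insert ha, barF_add, ih]

/-- Write `T̃_{sw'} = (C_s + q^{1/2}) T̃_{w'}`. Since `C_s` commutes with the involution and raises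
length by at most one, the only coordinate that appears in the new top length is the one at `s w'`.
-/
theorem barF_single_triangular (w : W) :
    cs.barF hM (Finsupp.single w 1) w = 1 ∧
      ∀ y, y ≠ w → cs.length w ≤ cs.length y → cs.barF hM (Finsupp.single w 1) y = 0 := by
  induction hn : cs.length w generalizing w with
  | zero =>
    rw [cs.length_eq_zero_iff] at hn
    subst hn
    rw [barF_single_one]
    refine ⟨by simp, fun y hy _ => Finsupp.single_eq_of_ne hy⟩
  | succ n ih =>
    have hw : w ≠ 1 := by rintro rfl; simp at hn
    obtain ⟨i, hi⟩ := cs.exists_leftDescent_of_ne_one hw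
    have hl := cs.length_simple_mul_of_isLeftDescent hi
    obtain ⟨w', rfl⟩ : ∃ w', w = cs.simple i * w' := ⟨cs.simple i * w, by simp⟩
    rw [simple_mul_simple_cancel_left] at hl
    have hi' : ¬ cs.IsLeftDescent w' i := by rwa [isLeftDescent_simple_mul_iff] at hi
    obtain ⟨ih1, ih2⟩ := ih w' (by omega)
    have e : (Finsupp.single (cs.simple i * w') 1 : W →₀ HeckeScalars) =
        cs.cOp i (Finsupp.single w' 1) + qHalf 1 • Finsupp.single w' 1 := by
      rw [cOp, LinearMap.add_apply, cs.genOp_single_of_not_isLeftDescent _ _ hi',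
        LinearMap.smul_apply, Module.End.one_apply, add_assoc, ← add_smul, neg_add_cancel,
        zero_smul, add_zero]
    have hz : ∀ y, y ≠ w' → n ≤ cs.length y → cs.barF hM (Finsupp.single w' 1) y = 0 := ih2
    have hf : ∀ y, cs.barF hM (Finsupp.single (cs.simple i * w') 1) y =
        cs.cOp i (cs.barF hM (Finsupp.single w' 1)) y +
          qHalf (-1) * cs.barF hM (Finsupp.single w' 1) y := by
      intro y
      rw [e, barF_add, barF_smul, barF_cOp, bar_qHalf]
      simp
    constructor
    · rw [hf, cs.cOp_apply_of_isLeftDescent _ hi, simple_mul_simple_cancel_left, ih1]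
      ring
    · intro y hy hly
      have hy1 : y ≠ w' := by rintro rfl; omega
      have hy2 : cs.simple i * y ≠ w' := by rintro rfl; simp at hy
      have hly2 := cs.length_simple_mul y i
      rw [hf, hz y hy1 (by omega)]
      by_cases hd : cs.IsLeftDescent y i
      · rw [cs.cOp_apply_of_isLeftDescent _ hd, hz _ hy2 (by omega), hz y hy1 (by omega)]
        ring
      · rw [cs.cOp_apply_of_not_isLeftDescent _ hd, hz _ hy2 (by omega), hz y hy1 (by omega)]
        ring

theorem barF_eq_sum (f : W →₀ HeckeScalars) (y : W) :
    cs.barF hM f y = ∑ w ∈ f.support, bar (f w) * cs.barF hM (Finsupp.single w 1) y := by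
  have h : f = ∑ w ∈ f.support, f w • Finsupp.single w (1 : HeckeScalars) := by
    conv_lhs => rw [← Finsupp.sum_single f]
    rw [Finsupp.sum]
    refine Finset.sum_congr rfl fun w _ => by simp
  conv_lhs => rw [h]
  rw [barF_sum, Finsupp.finsetSum_apply]
  refine Finset.sum_congr rfl fun w _ => ?_
  rw [barF_smul, Finsupp.smul_apply, smul_eq_mul]

/-- By triangularity, the coordinate at a longest element of the support is itself bar-invariant;
having only positive powers of `q^{1/2}`, it vanishes. Applied to a difference, this gives
uniqueness of `C_w`. -/
theorem eq_zero_of_barF_eq {f : W →₀ HeckeScalars} (hb : cs.barF hM f = f)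
    (hp : ∀ y, f y ∈ lowSub 1) : f = 0 := by
  by_contra hne
  have hs : f.support.Nonempty := Finsupp.support_nonempty_iff.2 hne
  obtain ⟨y, hy, hmax⟩ := Finset.exists_max_image f.support cs.length hs
  have h1 := cs.barF_eq_sum hM f y
  rw [hb, Finset.sum_eq_single y, (cs.barF_single_triangular hM y).1, mul_one] at h1
  · exact (Finsupp.mem_support_iff.1 hy) (eq_zero_of_bar_eq h1.symm (hp y))
  · intro w hw hwy
    rw [(cs.barF_single_triangular hM w).2 y (Ne.symm hwy) (hmax w hw), mul_zero]
  · intro h; exact absurd hy h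

/-- `f` is the Kazhdan–Lusztig basis element `C_w` in normalized coordinates. -/
structure IsKLElt (w : W) (f : W →₀ HeckeScalars) : Prop where
  bar_eq : cs.barF hM f = f
  self : f w = 1
  pos : ∀ y, y ≠ w → f y ∈ lowSub 1
  le : ∀ y, f y ≠ 0 → cs.BruhatLE y w
  par : ∀ y, f y ∈ parSub (cs.length w - cs.length y)

omit hM in
theorem length_le_of_bruhatLE {x y : W} (h : cs.BruhatLE x y) : cs.length x ≤ cs.length y := by
  rcases h with rfl | h
  · exact le_rfl
  · exact (cs.length_lt_of_bruhatLT h).le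

theorem IsKLElt.eq {w : W} {f g : W →₀ HeckeScalars} (hf : cs.IsKLElt hM w f)
    (hb : cs.barF hM g = g) (hs : g w = 1) (hp : ∀ y, y ≠ w → g y ∈ lowSub 1) : g = f := by
  have h : g + (-1 : HeckeScalars) • f = 0 := by
    apply cs.eq_zero_of_barF_eq hM
    · have h1 : bar (-1) = -1 := by
        have := bar_intCast (-1)
        simpa using this
      rw [barF_add, barF_smul, hb, hf.bar_eq, h1]
    · intro y
      rw [Finsupp.add_apply, Finsupp.smul_apply, smul_eq_mul]
      by_cases hy : y = w
      · subst hy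
        rw [hs, hf.self]
        simp
      · have := add_mem (hp y hy) (neg_mem (hf.pos y hy))
        simpa using this
  ext1 y
  have := DFunLike.congr_fun h y
  rw [Finsupp.add_apply, Finsupp.smul_apply, smul_eq_mul, Finsupp.zero_apply] at this
  linear_combination this

theorem isKLElt_one : cs.IsKLElt hM 1 (Finsupp.single 1 1) where
  bar_eq := cs.barF_single_one hM
  self := by simp
  pos := by
    intro y hy
    rw [Finsupp.single_eq_of_ne hy]
    exact zero_mem _
  le := by
    intro y hy
    by_contra h
    exact hy (Finsupp.single_eq_of_ne fun h' => h (Or.inl h'))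
  par := by
    intro y
    by_cases hy : y = 1
    · subst hy
      rw [Finsupp.single_eq_same]
      intro e he
      rw [← qHalf_zero, qHalf, LaurentPolynomial.T_apply] at he
      have : e = 0 := by
        by_contra h
        exact he (if_neg (Ne.symm h))
      subst this
      simp
    · rw [Finsupp.single_eq_of_ne hy]
      exact zero_mem _

open Classical in
-- The recursion `C_{sw} = C_s C_w - ∑ μ(z,w) C_z`. At `y` with `s y < y`, the contribution
-- `-q^{-1/2} f_y` has a constant term, which the summand for `z = y` cancels. The sum is added here
-- because `f` carries the sign `ε_w ε_z = -1`, so its coefficient of `q^{1/2}` is `-μ(z,w)`.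
theorem isKLElt_step {w : W} {i : B} (hi : ¬ cs.IsLeftDescent w i) {f : W →₀ HeckeScalars}
    (hf : cs.IsKLElt hM w f) (K : W → W →₀ HeckeScalars)
    (hK : ∀ z ∈ f.support, cs.IsLeftDescent z i → cs.IsKLElt hM z (K z)) :
    cs.IsKLElt hM (cs.simple i * w) (cs.cOp i f +
      ∑ z ∈ f.support.filter (fun z => cs.IsLeftDescent z i),
        (((f z).coeff 1 : ℤ) : HeckeScalars) • K z) := by
  have hl := cs.length_simple_mul_of_not_isLeftDescent hi
  have hi' : cs.IsLeftDescent (cs.simple i * w) i := by rwa [isLeftDescent_simple_mul_iff]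
  have hval : ∀ y, (cs.cOp i f + ∑ z ∈ f.support.filter (fun z => cs.IsLeftDescent z i),
        (((f z).coeff 1 : ℤ) : HeckeScalars) • K z) y =
      cs.cOp i f y + ∑ z ∈ f.support.filter (fun z => cs.IsLeftDescent z i),
        (((f z).coeff 1 : ℤ) : HeckeScalars) * K z y := by
    intro y
    rw [Finsupp.add_apply, Finsupp.finsetSum_apply]
    rfl
  have hz : ∀ z ∈ f.support.filter (fun z => cs.IsLeftDescent z i),
      cs.IsKLElt hM z (K z) ∧ cs.BruhatLE z w ∧ z ≠ w := by
    intro z hz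
    rw [Finset.mem_filter] at hz
    refine ⟨hK z hz.1 hz.2, hf.le z (Finsupp.mem_support_iff.1 hz.1), ?_⟩
    rintro rfl
    exact hi hz.2
  have hfw : f (cs.simple i * w) = 0 := by
    by_contra h
    have := cs.length_le_of_bruhatLE (hf.le _ h)
    omega
  refine ⟨?_, ?_, ?_, ?_, ?_⟩
  · rw [barF_add, barF_cOp, hf.bar_eq, barF_sum]
    congr 1
    refine Finset.sum_congr rfl fun z hzs => ?_
    rw [barF_smul, bar_intCast, (hz z hzs).1.bar_eq]
  · rw [hval, cs.cOp_apply_of_isLeftDescent _ hi', simple_mul_simple_cancel_left, hf.self, hfw,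
      Finset.sum_eq_zero]
    · ring
    · intro z hzs
      obtain ⟨h1, h2, -⟩ := hz z hzs
      have : K z (cs.simple i * w) = 0 := by
        by_contra h
        have h3 := cs.length_le_of_bruhatLE (h1.le _ h)
        have h4 := cs.length_le_of_bruhatLE h2
        omega
      rw [this, mul_zero]
  · intro y hy
    have hsy : cs.simple i * y ≠ w := by
      rintro rfl
      simp at hy
    have hp1 := hf.pos _ hsy
    rw [hval]
    by_cases hd : cs.IsLeftDescent y i
    · have hyw : y ≠ w := by rintro rfl; exact hi hd
      have hp2 := hf.pos y hyw
      rw [cs.cOp_apply_of_isLeftDescent _ hd]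
      have hlow : qHalf (-1) * f y - (((f y).coeff 1 : ℤ) : HeckeScalars) ∈ lowSub 1 := by
        intro e he
        have e1 : (qHalf (-1) * f y - (((f y).coeff 1 : ℤ) : HeckeScalars)).coeff e =
            (qHalf (-1) * f y).coeff e - ((((f y).coeff 1 : ℤ) : HeckeScalars)).coeff e := by
          simp
        have e2 := coeff_intCast_mul ((f y).coeff 1) 1 e
        rw [mul_one, ← qHalf_zero, qHalf, LaurentPolynomial.T_apply] at e2
        rw [e1, e2, coeff_qHalf_mul]
        by_cases h0 : e = 0
        · subst h0; simp
        · rw [if_neg (Ne.symm h0), hp2 _ (by omega)]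
          simp
      have hsum : ∑ z ∈ f.support.filter (fun z => cs.IsLeftDescent z i),
            (((f z).coeff 1 : ℤ) : HeckeScalars) * K z y - (((f y).coeff 1 : ℤ) : HeckeScalars)
            ∈ lowSub 1 := by
        by_cases hys : y ∈ f.support
        · have hym : y ∈ f.support.filter (fun z => cs.IsLeftDescent z i) :=
            Finset.mem_filter.2 ⟨hys, hd⟩
          rw [← Finset.add_sum_erase _ _ hym, (hz y hym).1.self, mul_one, add_sub_cancel_left]
          refine sum_mem fun z hzs => ?_
          rw [Finset.mem_erase] at hzs
          exact intCast_mul_mem_lowSub _ ((hz z hzs.2).1.pos y (Ne.symm hzs.1))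
        · rw [Finsupp.notMem_support_iff.1 hys]
          simp only [AddMonoidAlgebra.coeff_zero, Finsupp.coe_zero, Pi.zero_apply, Int.cast_zero,
            sub_zero]
          refine sum_mem fun z hzs => ?_
          refine intCast_mul_mem_lowSub _ ((hz z hzs).1.pos y ?_)
          rintro rfl
          exact hys (Finset.mem_filter.1 hzs).1
      have := add_mem (sub_mem hp1 hlow) hsum
      convert this using 1
      ring
    · rw [cs.cOp_apply_of_not_isLeftDescent _ hd]
      refine add_mem (sub_mem hp1 ?_) (sum_mem fun z hzs => ?_)
      · have : f y ∈ lowSub 0 := by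
          by_cases hyw : y = w
          · subst hyw
            rw [hf.self, ← qHalf_zero]
            intro e he
            rw [qHalf, LaurentPolynomial.T_apply, if_neg (by omega)]
          · exact lowSub_mono (by omega) (hf.pos y hyw)
        have h2 := qHalf_mul_mem_lowSub (j := 1).2 this
        simpa using h2
      · refine intCast_mul_mem_lowSub _ ((hz z hzs).1.pos y ?_)
        rintro rfl
        exact hd (Finset.mem_filter.1 hzs).2
  · intro y hy
    rw [hval] at hy
    have hws := cs.bruhatLT_simple_mul hi
    have up : ∀ x, cs.BruhatLE x w → cs.BruhatLE x (cs.simple i * w) := by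
      rintro x (rfl | hx)
      · exact Or.inr hws
      · exact Or.inr (hx.trans hws)
    by_contra hcon
    apply hy
    have h1 : f y = 0 := by
      by_contra h
      exact hcon (up _ (hf.le y h))
    have h2 : f (cs.simple i * y) = 0 := by
      by_contra h
      have := cs.bruhatLE_simple_mul hM (hf.le _ h) hi
      rw [simple_mul_simple_cancel_left] at this
      exact hcon this
    rw [Finset.sum_eq_zero]
    · by_cases hd : cs.IsLeftDescent y i
      · rw [cs.cOp_apply_of_isLeftDescent _ hd, h1, h2]; simp
      · rw [cs.cOp_apply_of_not_isLeftDescent _ hd, h1, h2]; simp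
    · intro z hzs
      obtain ⟨k1, k2, -⟩ := hz z hzs
      have : K z y = 0 := by
        by_contra h
        refine hcon (up _ ?_)
        rcases k1.le y h with h3 | h3
        · exact h3 ▸ k2
        · rcases k2 with rfl | h4
          · exact Or.inr h3
          · exact Or.inr (h3.trans h4)
      rw [this, mul_zero]
  · intro y
    rw [hval, hl]
    push_cast
    refine add_mem ?_ (sum_mem fun z hzs => ?_)
    · by_cases hd : cs.IsLeftDescent y i
      · have hly : ((cs.length (cs.simple i * y) : ℕ) : ℤ) = cs.length y - 1 := by
          have := cs.length_simple_mul_of_isLeftDescent hd; omega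
        rw [cs.cOp_apply_of_isLeftDescent _ hd]
        refine sub_mem ?_ ?_
        · have := hf.par (cs.simple i * y)
          rw [hly] at this
          convert this using 2
          ring
        · have := qHalf_mul_mem_parSub (j := -1) (hf.par y)
          refine parSub_mono (by omega) ?_ this
          exact ⟨1, by ring⟩
      · have hly : ((cs.length (cs.simple i * y) : ℕ) : ℤ) = cs.length y + 1 := by
          have := cs.length_simple_mul_of_not_isLeftDescent hd; omega
        rw [cs.cOp_apply_of_not_isLeftDescent _ hd]
        refine sub_mem ?_ ?_
        · have := hf.par (cs.simple i * y)
          rw [hly] at this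
          refine parSub_mono (by omega) ?_ this
          exact ⟨1, by ring⟩
        · have := qHalf_mul_mem_parSub (j := 1) (hf.par y)
          convert this using 2
          ring
    · by_cases hm : (f z).coeff 1 = 0
      · rw [hm, Int.cast_zero, zero_mul]; exact zero_mem _
      -- A nonzero coefficient of `q^{1/2}` forces `ℓ(w) - ℓ(z)` to be odd, so `ℓ(z)` and `ℓ(w) + 1`
      -- have equal parity.
      · obtain ⟨h1, h2⟩ := hf.par z 1 hm
        rw [← zsmul_eq_mul]
        refine zsmul_mem ?_ _
        refine parSub_mono (by omega) ?_ ((hz z hzs).1.par y)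
        obtain ⟨k, hk⟩ := h2
        exact ⟨k + 1, by linear_combination hk⟩

theorem exists_isKLElt (w : W) : ∃ f, cs.IsKLElt hM w f := by
  classical
  induction hn : cs.length w using Nat.strong_induction_on generalizing w with
  | _ n ih =>
    by_cases hw : w = 1
    · subst hw
      exact ⟨_, cs.isKLElt_one hM⟩
    · obtain ⟨i, hi⟩ := cs.exists_leftDescent_of_ne_one hw
      have hl := cs.length_simple_mul_of_isLeftDescent hi
      obtain ⟨w', rfl⟩ : ∃ w', w = cs.simple i * w' := ⟨cs.simple i * w, by simp⟩
      rw [simple_mul_simple_cancel_left] at hl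
      have hi' : ¬ cs.IsLeftDescent w' i := by rwa [isLeftDescent_simple_mul_iff] at hi
      obtain ⟨f, hf⟩ := ih _ (by omega) w' rfl
      have hex : ∀ z, ∃ g, cs.length z < n → cs.IsKLElt hM z g := by
        intro z
        by_cases hz : cs.length z < n
        · obtain ⟨g, hg⟩ := ih _ hz z rfl
          exact ⟨g, fun _ => hg⟩
        · exact ⟨0, fun h => absurd h hz⟩
      choose K hK using hex
      refine ⟨_, cs.isKLElt_step hM hi' hf K fun z hz _ => hK z ?_⟩
      have := cs.length_le_of_bruhatLE (hf.le z (Finsupp.mem_support_iff.1 hz))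
      omega

/-- The Kazhdan–Lusztig basis element `C_w` in normalized coordinates. -/
def kl (w : W) : W →₀ HeckeScalars := (cs.exists_isKLElt hM w).choose

theorem isKLElt_kl (w : W) : cs.IsKLElt hM w (cs.kl hM w) := (cs.exists_isKLElt hM w).choose_spec

open Classical in
theorem cOp_kl_of_not_isLeftDescent {w : W} {i : B} (hi : ¬ cs.IsLeftDescent w i) :
    cs.kl hM (cs.simple i * w) = cs.cOp i (cs.kl hM w) +
      ∑ z ∈ (cs.kl hM w).support.filter (fun z => cs.IsLeftDescent z i),
        (((cs.kl hM w z).coeff 1 : ℤ) : HeckeScalars) • cs.kl hM z := by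
  have h := cs.isKLElt_step hM hi (cs.isKLElt_kl hM w) (cs.kl hM)
    (fun z _ _ => cs.isKLElt_kl hM z)
  exact h.eq cs hM (cs.isKLElt_kl hM _).bar_eq (cs.isKLElt_kl hM _).self (cs.isKLElt_kl hM _).pos

/-- Each summand in the recursion for `C_w` is an eigenvector of `C_s`: the first by the quadratic
relation, the others by induction, because they have `s` as a descent. -/
theorem cOp_kl_of_isLeftDescent {w : W} {i : B} (hi : cs.IsLeftDescent w i) :
    cs.cOp i (cs.kl hM w) = (-(qHalf 1 + qHalf (-1))) • cs.kl hM w := by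
  classical
  induction hn : cs.length w using Nat.strong_induction_on generalizing w with
  | _ n ih =>
    have hl := cs.length_simple_mul_of_isLeftDescent hi
    obtain ⟨w', rfl⟩ : ∃ w', w = cs.simple i * w' := ⟨cs.simple i * w, by simp⟩
    rw [simple_mul_simple_cancel_left] at hl
    have hi' : ¬ cs.IsLeftDescent w' i := by rwa [isLeftDescent_simple_mul_iff] at hi
    rw [cs.cOp_kl_of_not_isLeftDescent hM hi', map_add, cOp_cOp, smul_add, map_sum,
      Finset.smul_sum]
    congr 1
    refine Finset.sum_congr rfl fun z hz => ?_
    rw [Finset.mem_filter, Finsupp.mem_support_iff] at hz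
    have := cs.length_le_of_bruhatLE ((cs.isKLElt_kl hM w').le z hz.1)
    rw [map_smul, ih _ (by omega) hz.2 rfl, smul_comm]

/-- If `s` is a left descent of `w` and not of `y`, then `y - w` is an edge only if `w = s y`. -/
theorem kl_coeff_one {w y : W} {i : B} (hw : cs.IsLeftDescent w i) (hy : ¬ cs.IsLeftDescent y i)
    (h : (cs.kl hM w y).coeff 1 ≠ 0) : w = cs.simple i * y := by
  have h1 := DFunLike.congr_fun (cs.cOp_kl_of_isLeftDescent hM hw) y
  rw [cs.cOp_apply_of_not_isLeftDescent _ hy, Finsupp.smul_apply, smul_eq_mul] at h1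
  -- The eigenvector identity at `y` gives `f_y = -q^{1/2} f_{sy}`, and `f_{sy}` has no constant
  -- term unless `s y = w`.
  have h2 : cs.kl hM w y = -(qHalf 1 * cs.kl hM w (cs.simple i * y)) := by
    linear_combination qHalf 1 * h1 - cs.kl hM w y * qHalf_mul_neg 1
  by_contra hne
  apply h
  rw [h2]
  have h3 := coeff_qHalf_mul 1 (cs.kl hM w (cs.simple i * y)) 1
  rw [(cs.isKLElt_kl hM w).pos _ (Ne.symm hne) _ (by omega)] at h3
  simp [h3]

theorem kl_coeff_one_simple_mul {y : W} {i : B} (hy : ¬ cs.IsLeftDescent y i) :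
    (cs.kl hM (cs.simple i * y) y).coeff 1 = -1 := by
  have hw : cs.IsLeftDescent (cs.simple i * y) i := by rwa [isLeftDescent_simple_mul_iff]
  have h1 := DFunLike.congr_fun (cs.cOp_kl_of_isLeftDescent hM hw) y
  rw [cs.cOp_apply_of_not_isLeftDescent _ hy, Finsupp.smul_apply, smul_eq_mul,
    (cs.isKLElt_kl hM _).self] at h1
  have h2 : cs.kl hM (cs.simple i * y) y = -qHalf 1 := by
    linear_combination qHalf 1 * h1 - cs.kl hM (cs.simple i * y) y * qHalf_mul_neg 1
  rw [h2]
  simp [qHalf]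

end KLBasis

end CoxeterSystem


/-! ### Kazhdan–Lusztig polynomials and the function `μ`. -/

namespace HeckeScalars

theorem ofPoly_monomial (k : ℕ) (a : ℤ) :
    ofPoly (Polynomial.monomial k a) = AddMonoidAlgebra.single (2 * k : ℤ) a := by
  rw [ofPoly, Polynomial.aeval_monomial, q, qHalf, LaurentPolynomial.T_pow,
    LaurentPolynomial.single_eq_C_mul_T, LaurentPolynomial.C_eq_algebraMap, mul_comm (k : ℤ) 2]

theorem ofPoly_add (p r : ℤ[X]) : ofPoly (p + r) = ofPoly p + ofPoly r := map_add _ _ _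

theorem ofPoly_zero : ofPoly 0 = 0 := map_zero _

theorem ofPoly_one : ofPoly 1 = 1 := map_one _

theorem ofPoly_sum {ι : Type*} (s : Finset ι) (f : ι → ℤ[X]) :
    ofPoly (∑ i ∈ s, f i) = ∑ i ∈ s, ofPoly (f i) := map_sum _ _ _

theorem coeff_ofPoly (p : ℤ[X]) (k : ℕ) : (ofPoly p).coeff (2 * k) = p.coeff k := by
  induction p using Polynomial.induction_on' with
  | add p r hp hr =>
    rw [ofPoly_add, AddMonoidAlgebra.coeff_add, Finsupp.add_apply, hp, hr, Polynomial.coeff_add]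
  | monomial m a =>
    rw [ofPoly_monomial, AddMonoidAlgebra.coeff_single, Polynomial.coeff_monomial,
      Finsupp.single_apply]
    congr 1
    simp

theorem exists_of_coeff_ofPoly_ne_zero (p : ℤ[X]) {e : ℤ} (h : (ofPoly p).coeff e ≠ 0) :
    ∃ k : ℕ, e = 2 * k := by
  induction p using Polynomial.induction_on' with
  | add p r hp hr =>
    rw [ofPoly_add, AddMonoidAlgebra.coeff_add, Finsupp.add_apply] at h
    by_cases h1 : (ofPoly p).coeff e = 0
    · exact hr (by rwa [h1, zero_add] at h)
    · exact hp h1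
  | monomial m a =>
    rw [ofPoly_monomial, AddMonoidAlgebra.coeff_single, Finsupp.single_apply] at h
    by_contra hne
    exact h (if_neg fun h' => hne ⟨m, h'.symm⟩)

theorem ofPoly_injective : Function.Injective ofPoly := by
  intro p r h
  ext k
  rw [← coeff_ofPoly, h, coeff_ofPoly]

theorem bar_bar (a : HeckeScalars) : bar (bar a) = a := LaurentPolynomial.involutive_invert a

theorem exists_ofPoly_of_mem_parSub {m : ℤ} {a : HeckeScalars} (h : a ∈ parSub m) :
    ∃ p : ℤ[X], qHalf m * bar (ofPoly p) = a := by
  set b := bar (qHalf (-m) * a) with hb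
  have hbe : ∀ e, b.coeff e ≠ 0 → 0 ≤ e ∧ Even e := by
    intro e he
    rw [hb, coeff_bar, coeff_qHalf_mul] at he
    obtain ⟨h1, h2⟩ := h _ he
    refine ⟨by omega, ?_⟩
    convert h2 using 1
    ring
  have hp : ofPoly (∑ e ∈ b.coeff.support,
      Polynomial.monomial (e / 2).toNat (b.coeff e)) = b := by
    rw [ofPoly_sum]
    conv_rhs => rw [← AddMonoidAlgebra.sum_coeff_single b, Finsupp.sum]
    refine Finset.sum_congr rfl fun e he => ?_
    obtain ⟨h1, k, hk⟩ := hbe e (Finsupp.mem_support_iff.1 he)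
    rw [ofPoly_monomial]
    congr 1
    omega
  refine ⟨_, by rw [hp, hb, bar_bar, ← mul_assoc, qHalf_mul_neg, one_mul]⟩

end HeckeScalars

namespace CoxeterSystem

open HeckeScalars

section KLPolynomials

variable {B : Type*} {M : CoxeterMatrix B} {W : Type*} [Group W] (cs : CoxeterSystem M W)

/-- The normalized coefficient at `T_y` of `C_w` attached to a polynomial `P_{y,w}`. -/
def klTerm (w y : W) (P : ℤ[X]) : HeckeScalars :=
  (-1) ^ cs.length w * (-1) ^ cs.length y * (qHalf (cs.length w - cs.length y) * bar (ofPoly P))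

theorem klTerm_zero (w y : W) : cs.klTerm w y 0 = 0 := by
  simp [klTerm, ofPoly_zero, bar_zero]

theorem neg_one_pow_mul_self (m : ℕ) : ((-1 : HeckeScalars) ^ m) * (-1) ^ m = 1 := by
  rw [← mul_pow]; simp

theorem klTerm_self (w : W) : cs.klTerm w w 1 = 1 := by
  rw [klTerm, sub_self, qHalf_zero, ofPoly_one, bar_one, neg_one_pow_mul_self]
  simp

/-- The normalized coordinates of `klCombination w p`. -/
def klCoords (w : W) (p : W →₀ ℤ[X]) : W →₀ HeckeScalars :=
  Finsupp.onFinset p.support (fun y => cs.klTerm w y (p y)) (by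
    intro y hy
    rw [Finsupp.mem_support_iff]
    intro h
    exact hy (by rw [h, klTerm_zero]))

theorem normElt_klCoords (w : W) (p : W →₀ ℤ[X]) :
    cs.normElt (cs.klCoords w p) = cs.klCombination w p := by
  have hs : (cs.klCoords w p).support ⊆ p.support := Finsupp.support_onFinset_subset
  rw [normElt, Finsupp.linearCombination_apply, klCombination,
    Finsupp.sum_of_support_subset _ hs _ (by simp),
    Finsupp.sum, Finset.smul_sum]
  refine Finset.sum_congr rfl fun y _ => ?_
  rw [klCoords, Finsupp.onFinset_apply, klTerm, smul_smul, smul_smul]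
  congr 1
  rw [show (cs.length w : ℤ) - cs.length y = cs.length w + -cs.length y by ring, qHalf_add,
    show (-2 : ℤ) * cs.length y = -cs.length y + -cs.length y by ring, qHalf_add]
  ring

theorem coeff_klTerm_ne_zero_iff (w y : W) (P : ℤ[X]) (e : ℤ) :
    (cs.klTerm w y P).coeff e ≠ 0 ↔
      (ofPoly P).coeff (cs.length w - cs.length y - e) ≠ 0 := by
  have h : ∀ a : HeckeScalars, ((-1) ^ cs.length w * (-1) ^ cs.length y * a).coeff e ≠ 0 ↔
      a.coeff e ≠ 0 := by
    intro a
    rcases neg_one_pow_eq_or HeckeScalars (cs.length w) with h1 | h1 <;>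
      rcases neg_one_pow_eq_or HeckeScalars (cs.length y) with h2 | h2 <;>
      rw [h1, h2] <;> simp
  rw [klTerm, h, coeff_qHalf_mul, coeff_bar, neg_sub]

variable (hM : M.IsRightAngled)
include hM

/-- After normalization the degree bound on `P_{y,w}` says exactly that only positive powers of
`q^{1/2}` occur. Uniqueness therefore covers every admissible family, in particular the one chosen
in `klPoly`. -/
theorem IsKLFamily.klCoords_eq {w : W} {p : W →₀ ℤ[X]} (hp : cs.IsKLFamily w p) :
    cs.klCoords w p = cs.kl hM w := by
  refine (cs.isKLElt_kl hM w).eq cs hM ?_ ?_ ?_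
  · apply cs.normElt_injective
    rw [normElt_barF, normElt_klCoords, hp.bar_eq]
  · rw [klCoords, Finsupp.onFinset_apply, hp.self, klTerm_self]
  · intro y hy
    rw [klCoords, Finsupp.onFinset_apply]
    by_cases hlt : cs.BruhatLT y w
    · intro e he
      by_contra hne
      rw [← ne_eq, coeff_klTerm_ne_zero_iff] at hne
      obtain ⟨k, hk⟩ := exists_of_coeff_ofPoly_ne_zero _ hne
      rw [hk, coeff_ofPoly] at hne
      have h1 := Polynomial.le_natDegree_of_ne_zero hne
      have h2 := hp.degree_le y hlt
      omega
    · rw [hp.eq_zero y hy hlt, klTerm_zero]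
      exact zero_mem _

theorem exists_isKLFamily (w : W) : ∃ p, cs.IsKLFamily w p := by
  have hk := cs.isKLElt_kl hM w
  have hex : ∀ y, ∃ P : ℤ[X], cs.klTerm w y P = cs.kl hM w y := by
    intro y
    have h1 : (-1) ^ cs.length w * (-1) ^ cs.length y * cs.kl hM w y ∈
        parSub (cs.length w - cs.length y) := by
      have := hk.par y
      rcases neg_one_pow_eq_or HeckeScalars (cs.length w) with h1 | h1 <;>
        rcases neg_one_pow_eq_or HeckeScalars (cs.length y) with h2 | h2 <;>
        rw [h1, h2] <;> simpa using this
    obtain ⟨P, hP⟩ := exists_ofPoly_of_mem_parSub h1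
    refine ⟨P, ?_⟩
    rw [klTerm, hP]
    linear_combination (cs.kl hM w y) * neg_one_pow_mul_self (cs.length w) *
      (((-1) ^ cs.length y) * (-1) ^ cs.length y) +
      (cs.kl hM w y) * neg_one_pow_mul_self (cs.length y)
  choose P hP using hex
  have hP0 : ∀ y, cs.kl hM w y = 0 → P y = 0 := by
    intro y hy
    ext k
    rw [Polynomial.coeff_zero]
    by_contra hne
    rw [← coeff_ofPoly] at hne
    have := (cs.coeff_klTerm_ne_zero_iff w y (P y) (cs.length w - cs.length y - 2 * k)).2
      (by convert hne using 2; ring)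
    rw [hP, hy] at this
    exact this rfl
  let p : W →₀ ℤ[X] := Finsupp.onFinset (cs.kl hM w).support P (by
    intro y hy
    rw [Finsupp.mem_support_iff]
    exact fun h => hy (hP0 y h))
  have hpk : cs.klCoords w p = cs.kl hM w := by
    ext1 y
    rw [klCoords, Finsupp.onFinset_apply]
    exact hP y
  refine ⟨p, ?_, ?_, ?_, ?_⟩
  · change P w = 1
    have h1 := hP w
    rw [hk.self, ← cs.klTerm_self w] at h1
    unfold klTerm at h1
    rw [sub_self, qHalf_zero, neg_one_pow_mul_self, one_mul, one_mul, one_mul, one_mul] at h1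
    exact ofPoly_injective (by rw [← bar_bar (ofPoly (P w)), h1, bar_bar])
  · intro y hy hlt
    refine hP0 y ?_
    by_contra h
    rcases hk.le y h with h1 | h1
    · exact hy h1
    · exact hlt h1
  · intro y hlt
    change 2 * (P y).natDegree + _ + _ ≤ _
    have hlen := cs.length_lt_of_bruhatLT hlt
    by_cases h0 : P y = 0
    · rw [h0, Polynomial.natDegree_zero]
      omega
    · have hne : (P y).coeff (P y).natDegree ≠ 0 := by
        rw [Polynomial.coeff_natDegree, Polynomial.leadingCoeff_ne_zero]
        exact h0
      rw [← coeff_ofPoly] at hne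
      have h2 := (cs.coeff_klTerm_ne_zero_iff w y (P y)
        (cs.length w - cs.length y - 2 * (P y).natDegree)).2 (by convert hne using 2; ring)
      rw [hP] at h2
      by_contra hcon
      refine h2 (hk.pos y ?_ _ (by omega))
      rintro rfl
      omega
  · rw [← normElt_klCoords, hpk, ← normElt_barF cs hM, hk.bar_eq]

theorem klTerm_klPoly (w y : W) : cs.klTerm w y (cs.klPoly y w) = cs.kl hM w y := by
  have h := cs.exists_isKLFamily hM w
  have h1 := h.choose_spec.klCoords_eq cs hM
  have h2 := DFunLike.congr_fun h1 y
  rw [klCoords, Finsupp.onFinset_apply] at h2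
  rw [← h2, klPoly, dif_pos h]

theorem klPoly_degree_le {y w : W} (h : cs.BruhatLT y w) :
    2 * (cs.klPoly y w).natDegree + cs.length y + 1 ≤ cs.length w := by
  have h1 := cs.exists_isKLFamily hM w
  rw [klPoly, dif_pos h1]
  exact h1.choose_spec.degree_le y h

/-- The extremal degree `(ℓ(w) - ℓ(y) - 1)/2` becomes the exponent one of `q^{1/2}` after
normalization. -/
theorem klPrec_iff (y w : W) : cs.KLPrec y w ↔ (cs.kl hM w y).coeff 1 ≠ 0 := by
  rw [← klTerm_klPoly, coeff_klTerm_ne_zero_iff]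
  constructor
  · rintro ⟨hlt, d, hd, hl⟩
    rw [show (cs.length w : ℤ) - cs.length y - 1 = 2 * d by omega, coeff_ofPoly]
    rw [← Polynomial.natDegree_eq_of_degree_eq_some hd, Polynomial.coeff_natDegree,
      Polynomial.leadingCoeff_ne_zero]
    intro h0
    rw [h0, Polynomial.degree_zero] at hd
    exact absurd hd.symm (WithBot.coe_ne_bot)
  · intro h
    have hk := cs.isKLElt_kl hM w
    have h1 : (cs.kl hM w y).coeff 1 ≠ 0 := by
      rwa [← klTerm_klPoly, coeff_klTerm_ne_zero_iff]
    have hlt : cs.BruhatLT y w := by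
      rcases hk.le y (by intro h0; exact h1 (by rw [h0]; rfl)) with rfl | h2
      · rw [hk.self, ← qHalf_zero, qHalf, LaurentPolynomial.T_apply] at h1
        simp at h1
      · exact h2
    obtain ⟨k, hk⟩ := exists_of_coeff_ofPoly_ne_zero _ h
    rw [hk, coeff_ofPoly] at h
    have h2 := cs.klPoly_degree_le hM hlt
    have h3 := Polynomial.le_natDegree_of_ne_zero h
    refine ⟨hlt, k, ?_, by omega⟩
    rw [Polynomial.degree_eq_natDegree (by rintro h0; rw [h0] at h; exact h rfl)]
    congr 1
    omega

theorem klMu_ne_zero_iff (y w : W) :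
    cs.klMu y w ≠ 0 ↔ (cs.kl hM w y).coeff 1 ≠ 0 ∨ (cs.kl hM y w).coeff 1 ≠ 0 := by
  have key : ∀ y w, cs.KLPrec y w → (cs.klPoly y w).leadingCoeff ≠ 0 := by
    rintro y w ⟨-, d, hd, -⟩
    rw [Polynomial.leadingCoeff_ne_zero]
    intro h0
    rw [h0, Polynomial.degree_zero] at hd
    exact absurd hd.symm (WithBot.coe_ne_bot)
  rw [← klPrec_iff, ← klPrec_iff]
  unfold klMu
  split_ifs with h1 h2
  · simpa [h1] using key _ _ h1
  · simpa [h2] using key _ _ h2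
  · simp [h1, h2]

theorem klMu_simple_mul_ne_zero {w : W} {i : B} (h : ¬ cs.IsLeftDescent w i) :
    cs.klMu (cs.simple i * w) w ≠ 0 ∧ cs.klMu w (cs.simple i * w) ≠ 0 := by
  have := cs.kl_coeff_one_simple_mul hM h
  rw [klMu_ne_zero_iff cs hM, klMu_ne_zero_iff cs hM, this]
  simp

theorem wEdge_simple_mul {w : W} {i : B} (h : ¬ cs.IsLeftDescent w i) :
    cs.WEdge (cs.simple i * w) w :=
  ⟨(cs.klMu_simple_mul_ne_zero hM h).1, fun hsub =>
    h (hsub (show cs.IsLeftDescent (cs.simple i * w) i by rwa [isLeftDescent_simple_mul_iff]))⟩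

end KLPolynomials

end CoxeterSystem


/-! ### Structure constants, left ideals and left equivalence. -/

namespace CoxeterMatrix

/-- No three distinct generators commute pairwise. -/
def IsTwoDimensional {B : Type*} (M : CoxeterMatrix B) : Prop :=
  ∀ i j k, M i j = 2 → M j k = 2 → M i k = 2 → False

end CoxeterMatrix

namespace HeckeScalars

theorem xi_mem_lowSub : xi ∈ lowSub (-1) := by
  intro e he
  have : xi.coeff e = (qHalf 1).coeff e - (qHalf (-1)).coeff e := by simp [xi]
  rw [this, qHalf, qHalf, LaurentPolynomial.T_apply, LaurentPolynomial.T_apply, if_neg (by omega),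
    if_neg (by omega), sub_zero]

theorem one_mem_lowSub : (1 : HeckeScalars) ∈ lowSub 0 := by
  rw [← qHalf_zero]
  intro e he
  rw [qHalf, LaurentPolynomial.T_apply, if_neg (by omega)]

theorem coeff_xi_sq : (xi ^ 2).coeff (-2) = 1 := by
  have : xi ^ 2 = qHalf 2 + qHalf (-2) + (-2 : ℤ) * qHalf 0 := by
    rw [show (2 : ℤ) = 1 + 1 by norm_num, show (-(1 + 1) : ℤ) = -1 + -1 by norm_num, qHalf_add,
      qHalf_add, qHalf_zero, xi]
    push_cast
    linear_combination (-2 : HeckeScalars) * qHalf_mul_neg 1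
  rw [this, AddMonoidAlgebra.coeff_add, Finsupp.add_apply, AddMonoidAlgebra.coeff_add,
    Finsupp.add_apply, coeff_intCast_mul, qHalf, qHalf, qHalf, LaurentPolynomial.T_apply,
    LaurentPolynomial.T_apply, LaurentPolynomial.T_apply]
  norm_num

/-- The specialization `X ↦ q^{1/2} - q^{-1/2}`. -/
def evalXi : Polynomial ℕ →+* HeckeScalars :=
  Polynomial.eval₂RingHom (Nat.castRingHom HeckeScalars) xi

/-- Only `ξ²` reaches the exponent `-2`, with coefficient one, so the coefficient of `X²` can be
read off after specialization. -/
theorem evalXi_mem_lowSub {p : Polynomial ℕ} (h : p.natDegree ≤ 2) :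
    evalXi p ∈ lowSub (-2) ∧ (evalXi p).coeff (-2) = p.coeff 2 := by
  have h1 : evalXi p = ((p.coeff 2 : ℤ) : HeckeScalars) * xi ^ 2 +
      (((p.coeff 1 : ℤ) : HeckeScalars) * xi + ((p.coeff 0 : ℤ) : HeckeScalars) * 1) := by
    rw [evalXi, Polynomial.coe_eval₂RingHom, Polynomial.eval₂_eq_sum_range' _ (n := 3) (by omega),
      Finset.sum_range_succ, Finset.sum_range_succ, Finset.sum_range_one]
    simp
    ring
  have m2 : xi ^ 2 ∈ lowSub (-2) := by
    rw [pow_two]; exact mul_mem_lowSub xi_mem_lowSub xi_mem_lowSub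
  have m1 : ((p.coeff 1 : ℤ) : HeckeScalars) * xi + ((p.coeff 0 : ℤ) : HeckeScalars) * 1 ∈
      lowSub (-1) :=
    add_mem (intCast_mul_mem_lowSub _ xi_mem_lowSub)
      (intCast_mul_mem_lowSub _ (lowSub_mono (by omega) one_mem_lowSub))
  rw [h1]
  refine ⟨add_mem (intCast_mul_mem_lowSub _ m2) (lowSub_mono (by omega) m1), ?_⟩
  rw [AddMonoidAlgebra.coeff_add, Finsupp.add_apply, coeff_intCast_mul, coeff_xi_sq,
    m1 _ (by omega)]
  simp

end HeckeScalars

namespace CoxeterSystem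

open HeckeScalars

section StructureConstants

variable {B : Type*} {M : CoxeterMatrix B} {W : Type*} [Group W] (cs : CoxeterSystem M W)

/-- Left multiplication by the normalized generator, with `X` in place of `q^{1/2} - q^{-1/2}`. -/
def polyOp (i : B) : Module.End (Polynomial ℕ) (W →₀ Polynomial ℕ) := cs.genOp Polynomial.X 1 i

/-- Lifting the normalized multiplication to `ℕ[X]` records that the structure constants are
polynomials in `ξ` with natural coefficients, which excludes cancellation. -/
theorem evalXi_polyOp (ω : List B) (y z : W) :
    ((ω.map (cs.genOp xi 1)).prod (Finsupp.single y 1)) z =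
      evalXi (((ω.map cs.polyOp).prod (Finsupp.single y 1)) z) := by
  classical
  induction ω generalizing z with
  | nil =>
    simp only [List.map_nil, List.prod_nil, Module.End.one_apply]
    by_cases h : y = z
    · subst h; simp
    · simp [Finsupp.single_eq_of_ne' h]
  | cons i ω ih =>
    simp only [List.map_cons, List.prod_cons, Module.End.mul_apply]
    rw [polyOp, genOp_apply, genOp_apply, ih, ih]
    have hX : evalXi Polynomial.X = xi := by simp [evalXi]
    split_ifs
    · rw [map_add evalXi, map_mul evalXi, hX]
    · rw [one_mul, one_mul]

theorem exists_polyOp_single (i : B) (z : W) :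
    ∃ h, cs.polyOp i (Finsupp.single z 1) = Finsupp.single (cs.simple i * z) 1 + h := by
  by_cases hd : cs.IsLeftDescent z i
  · exact ⟨(Polynomial.X : Polynomial ℕ) • Finsupp.single z 1, by
      rw [polyOp, cs.genOp_single_of_isLeftDescent _ _ hd, one_smul, add_comm]⟩
  · exact ⟨0, by rw [polyOp, cs.genOp_single_of_not_isLeftDescent _ _ hd, add_zero]⟩

theorem exists_polyOp_prod_single (ω : List B) (z : W) :
    ∃ h, (ω.map cs.polyOp).prod (Finsupp.single z 1) =
      Finsupp.single (cs.wordProd ω * z) 1 + h := by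
  induction ω with
  | nil => exact ⟨0, by simp⟩
  | cons i ω ih =>
    obtain ⟨h, hh⟩ := ih
    obtain ⟨h', hh'⟩ := cs.exists_polyOp_single i (cs.wordProd ω * z)
    refine ⟨h' + cs.polyOp i h, ?_⟩
    rw [List.map_cons, List.prod_cons, Module.End.mul_apply, hh, map_add, hh', wordProd_cons,
      mul_assoc, add_assoc]

variable (hM : M.IsRightAngled)
include hM

theorem isRightDescent_mul_simple_of_commute {w : W} {i j : B} (h : M i j = 2) :
    cs.IsRightDescent (w * cs.simple i) j ↔ cs.IsRightDescent w j := by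
  rw [← isLeftDescent_inv_iff, ← isLeftDescent_inv_iff, mul_inv_rev, inv_simple,
    cs.isLeftDescent_simple_mul_of_commute hM h]

theorem redProd_polyOp_of_common_descent {x y : W} {r : B} (hx : cs.IsRightDescent x r)
    (hy : cs.IsLeftDescent y r) :
    cs.redProd cs.polyOp x (Finsupp.single y 1) =
      (Polynomial.X : Polynomial ℕ) •
          cs.redProd cs.polyOp (x * cs.simple r) (Finsupp.single y 1) +
        cs.redProd cs.polyOp (x * cs.simple r) (Finsupp.single (cs.simple r * y) 1) := by
  have hc : ∀ i j, M i j = 2 → cs.polyOp i * cs.polyOp j = cs.polyOp j * cs.polyOp i :=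
    fun i j h => cs.genOp_comm hM _ _ h
  have hl := cs.isRightDescent_iff.1 hx
  have h1 : cs.redProd cs.polyOp x = cs.redProd cs.polyOp (x * cs.simple r) * cs.polyOp r := by
    conv_lhs => rw [← cs.simple_mul_simple_cancel_right (w := x) r]
    rw [cs.redProd_mul hM hc, cs.redProd_simple hM hc]
    rw [simple_mul_simple_cancel_right, length_simple]
    exact hl.symm
  rw [h1, Module.End.mul_apply, polyOp, cs.genOp_single_of_isLeftDescent _ _ hy, map_add,
    map_smul, one_smul]

omit hM in
theorem redProd_polyOp_of_reduced {x y : W}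
    (h : cs.length (x * y) = cs.length x + cs.length y) :
    cs.redProd cs.polyOp x (Finsupp.single y 1) = Finsupp.single (x * y) 1 := by
  have := cs.genOp_single_of_reduced Polynomial.X (1 : Polynomial ℕ) (ω := cs.reducedWord x)
    (y := y) (by rw [wordProd_reducedWord, length_reducedWord, h])
  rw [wordProd_reducedWord] at this
  exact this

omit hM [Group W] in
theorem natDegree_single_one_le (x z : W) (k : ℕ) :
    ((Finsupp.single x (1 : Polynomial ℕ)) z).natDegree ≤ k := by
  by_cases h : x = z
  · subst h; simp
  · simp [Finsupp.single_eq_of_ne' h]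

variable (hC : M.IsTwoDimensional)
include hC

theorem natDegree_redProd_polyOp_le_one {x y : W} {s : B} (hx : ¬ cs.IsRightDescent x s)
    (hy : cs.IsLeftDescent y s) (z : W) :
    (cs.redProd cs.polyOp x (Finsupp.single y 1) z).natDegree ≤ 1 := by
  induction hn : cs.length y generalizing x y with
  | zero =>
    rw [cs.length_eq_zero_iff] at hn
    subst hn
    exact absurd hy (cs.not_isLeftDescent_one s)
  | succ n ih =>
    by_cases hred : cs.length (x * y) = cs.length x + cs.length y
    · rw [cs.redProd_polyOp_of_reduced hred]
      exact natDegree_single_one_le _ _ _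
    · have hle := cs.length_mul_le x y
      obtain ⟨r, hrx, hry⟩ := cs.exists_common_descent hM (x := x) (y := y) (by omega)
      have hrs : r ≠ s := by rintro rfl; exact hx hrx
      have hM2 := cs.eq_two_of_isLeftDescent hM hry hy hrs
      have hl1 := cs.isRightDescent_iff.1 hrx
      have hl2 := cs.length_simple_mul_of_isLeftDescent hry
      have hrx' : ¬ cs.IsRightDescent (x * cs.simple r) r := by
        rw [← isRightDescent_iff_not_isRightDescent_mul]; exact hrx
      -- A second common descent `j` would commute with both `r` and `s`, and these commute with
      -- each other: three pairwise commuting generators.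
      have hred' : cs.length (x * cs.simple r * y) = cs.length (x * cs.simple r) + cs.length y := by
        by_contra hne
        have hle' := cs.length_mul_le (x * cs.simple r) y
        obtain ⟨j, hjx, hjy⟩ := cs.exists_common_descent hM (x := x * cs.simple r) (y := y)
          (by omega)
        have hjr : j ≠ r := by rintro rfl; exact hrx' hjx
        have hj2 := cs.eq_two_of_isLeftDescent hM hry hjy (Ne.symm hjr)
        rw [cs.isRightDescent_mul_simple_of_commute hM hj2] at hjx
        have hjs : j ≠ s := by rintro rfl; exact hx hjx
        exact hC r j s hj2 (cs.eq_two_of_isLeftDescent hM hjy hy hjs) hM2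
      rw [cs.redProd_polyOp_of_common_descent hM hrx hry, cs.redProd_polyOp_of_reduced hred',
        Finsupp.add_apply, Finsupp.smul_apply, smul_eq_mul]
      refine (Polynomial.natDegree_add_le _ _).trans (max_le ?_ ?_)
      · refine Polynomial.natDegree_mul_le.trans ?_
        have := natDegree_single_one_le (x * cs.simple r * y) z 0
        have h2 := Polynomial.natDegree_X_le (R := ℕ)
        omega
      · refine ih ?_ ?_ (by omega)
        · rwa [cs.isRightDescent_mul_simple_of_commute hM hM2]
        · rwa [cs.isLeftDescent_simple_mul_of_commute hM hM2]

/-- The structure constants of the Hecke algebra have degree at most `2`. -/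
theorem natDegree_redProd_polyOp_le_two (x y z : W) :
    (cs.redProd cs.polyOp x (Finsupp.single y 1) z).natDegree ≤ 2 := by
  induction hn : cs.length y generalizing x y with
  | zero =>
    rw [cs.length_eq_zero_iff] at hn
    subst hn
    rw [cs.redProd_polyOp_of_reduced (by simp)]
    exact natDegree_single_one_le _ _ _
  | succ n ih =>
    by_cases hred : cs.length (x * y) = cs.length x + cs.length y
    · rw [cs.redProd_polyOp_of_reduced hred]
      exact natDegree_single_one_le _ _ _
    · have hle := cs.length_mul_le x y
      obtain ⟨r, hrx, hry⟩ := cs.exists_common_descent hM (x := x) (y := y) (by omega)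
      have hl2 := cs.length_simple_mul_of_isLeftDescent hry
      have hrx' : ¬ cs.IsRightDescent (x * cs.simple r) r := by
        rw [← isRightDescent_iff_not_isRightDescent_mul]; exact hrx
      rw [cs.redProd_polyOp_of_common_descent hM hrx hry,
        Finsupp.add_apply, Finsupp.smul_apply, smul_eq_mul]
      refine (Polynomial.natDegree_add_le _ _).trans (max_le ?_ ?_)
      -- Once removed from `x`, the letter `r` is a descent of `y` only, so the product that carries
      -- the factor `X` falls under the degree-one bound.
      · refine Polynomial.natDegree_mul_le.trans ?_
        have := cs.natDegree_redProd_polyOp_le_one hM hC hrx' hry z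
        have h2 := Polynomial.natDegree_X_le (R := ℕ)
        omega
      · exact ih _ _ (by omega)

end StructureConstants

section LeftIdeals

variable {B : Type*} {M : CoxeterMatrix B} {W : Type*} [Group W] (cs : CoxeterSystem M W)
variable (hM : M.IsRightAngled)
include hM

/-- The span of the `C_z` with `z ≤_L w`. -/
def klIdeal (w : W) : Submodule HeckeScalars (W →₀ HeckeScalars) :=
  Submodule.span HeckeScalars (cs.kl hM '' {z | cs.LeL z w})

/-- At an ascent, `C_s C_z` involves only `C_{sz}` and those `C_y` with an edge from `y` to `z`. The
relations generating `≤_L` are shaped to make this span a left ideal. -/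
theorem cOp_mem_klIdeal {w : W} (i : B) {f : W →₀ HeckeScalars} (hf : f ∈ cs.klIdeal hM w) :
    cs.cOp i f ∈ cs.klIdeal hM w := by
  classical
  induction hf using Submodule.span_induction with
  | mem f hf =>
    obtain ⟨z, hz, rfl⟩ := hf
    by_cases hd : cs.IsLeftDescent z i
    · rw [cs.cOp_kl_of_isLeftDescent hM hd]
      exact Submodule.smul_mem _ _ (Submodule.subset_span ⟨z, hz, rfl⟩)
    · have h1 := cs.cOp_kl_of_not_isLeftDescent hM hd
      have h2 : cs.kl hM (cs.simple i * z) ∈ cs.klIdeal hM w :=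
        Submodule.subset_span ⟨_, Relation.ReflTransGen.head (cs.wEdge_simple_mul hM hd) hz, rfl⟩
      have h3 : ∑ y ∈ (cs.kl hM z).support.filter (fun y => cs.IsLeftDescent y i),
          (((cs.kl hM z y).coeff 1 : ℤ) : HeckeScalars) • cs.kl hM y ∈ cs.klIdeal hM w := by
        refine Submodule.sum_mem _ fun y hy => ?_
        by_cases hm : (cs.kl hM z y).coeff 1 = 0
        · rw [hm, Int.cast_zero, zero_smul]; exact Submodule.zero_mem _
        · refine Submodule.smul_mem _ _ (Submodule.subset_span ⟨y, ?_, rfl⟩)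
          refine Relation.ReflTransGen.head ⟨(cs.klMu_ne_zero_iff hM y z).2 (Or.inl hm), ?_⟩ hz
          exact fun hsub => hd (hsub (Finset.mem_filter.1 hy).2)
      rw [h1] at h2
      exact (Submodule.add_mem_iff_left _ h3).1 h2
  | zero => rw [map_zero]; exact Submodule.zero_mem _
  | add f g _ _ hf hg => rw [map_add]; exact Submodule.add_mem _ hf hg
  | smul a f _ hf => rw [map_smul]; exact Submodule.smul_mem _ _ hf

theorem genOp_prod_mem_klIdeal {w : W} (ω : List B) {f : W →₀ HeckeScalars}
    (hf : f ∈ cs.klIdeal hM w) : (ω.map (cs.genOp xi 1)).prod f ∈ cs.klIdeal hM w := by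
  induction ω with
  | nil => simpa using hf
  | cons i ω ih =>
    rw [List.map_cons, List.prod_cons, Module.End.mul_apply]
    generalize (ω.map (cs.genOp xi 1)).prod f = g at ih
    have : cs.genOp xi 1 i g = cs.cOp i g + qHalf 1 • g := by
      rw [cOp, LinearMap.add_apply, LinearMap.smul_apply, Module.End.one_apply, add_assoc,
        ← add_smul, neg_add_cancel, zero_smul, add_zero]
    rw [this]
    exact Submodule.add_mem _ (cs.cOp_mem_klIdeal hM i ih) (Submodule.smul_mem _ _ ih)

/-- If `f` lies in the ideal of `w`, has coordinates in `q^{k/2} ℤ[q^{1/2}]`, and a leading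
coordinate at `c`, then `c ≤_L w`. -/
theorem leL_of_mem_klIdeal {w c : W} {k : ℤ} {f : W →₀ HeckeScalars} (hf : f ∈ cs.klIdeal hM w)
    (hlow : ∀ z, f z ∈ lowSub k) (hc : (f c).coeff k ≠ 0) : cs.LeL c w := by
  classical
  rw [klIdeal, Finsupp.mem_span_image_iff_linearCombination] at hf
  obtain ⟨g, hg, rfl⟩ := hf
  have hval : ∀ z, Finsupp.linearCombination HeckeScalars (cs.kl hM) g z =
      ∑ y ∈ g.support, g y * cs.kl hM y z := by
    intro z
    rw [Finsupp.linearCombination_apply, Finsupp.sum, Finsupp.finsetSum_apply]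
    rfl
  -- Take a longest `z` whose coefficient at `C_z` violates the bound. All contributions of longer
  -- elements at `z` satisfy it, so the coordinate of `f` at `z` would violate it too.
  have hgood : ∀ z, g z ∈ lowSub k := by
    by_contra hcon
    push Not at hcon
    obtain ⟨z₀, hz₀⟩ := hcon
    have hne : (g.support.filter fun z => g z ∉ lowSub k).Nonempty := by
      refine ⟨z₀, Finset.mem_filter.2 ⟨?_, hz₀⟩⟩
      rw [Finsupp.mem_support_iff]
      intro h0
      exact hz₀ (by rw [h0]; exact zero_mem _)
    obtain ⟨z, hz, hmax⟩ := Finset.exists_max_image _ cs.length hne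
    rw [Finset.mem_filter] at hz
    apply hz.2
    have h1 := hval z
    rw [← Finset.add_sum_erase _ _ hz.1, (cs.isKLElt_kl hM z).self, mul_one] at h1
    have h2 : ∑ y ∈ g.support.erase z, g y * cs.kl hM y z ∈ lowSub k := by
      refine sum_mem fun y hy => ?_
      rw [Finset.mem_erase] at hy
      by_cases h0 : cs.kl hM y z = 0
      · rw [h0, mul_zero]; exact zero_mem _
      · have hgy : g y ∈ lowSub k := by
          by_contra hbad
          have h3 := hmax y (Finset.mem_filter.2 ⟨hy.2, hbad⟩)
          rcases (cs.isKLElt_kl hM y).le z h0 with h4 | h4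
          · exact hy.1 h4.symm
          · have := cs.length_lt_of_bruhatLT h4
            omega
        exact lowSub_mono (by omega)
          (mul_mem_lowSub hgy ((cs.isKLElt_kl hM y).pos z (Ne.symm hy.1)))
    have h3 : g z = Finsupp.linearCombination HeckeScalars (cs.kl hM) g z -
        ∑ y ∈ g.support.erase z, g y * cs.kl hM y z := by rw [h1]; ring
    rw [h3]
    exact sub_mem (hlow z) h2
  by_contra hLe
  have hcs : c ∉ g.support := fun h => hLe ((Finsupp.mem_supported _ _).1 hg h)
  apply hc
  rw [hval]
  -- Without `C_c`, every contribution at `c` gains a factor in `q^{1/2} ℤ[q^{1/2}]`, and nothing of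
  -- exponent `k` remains.
  have : ∑ y ∈ g.support, g y * cs.kl hM y c ∈ lowSub (k + 1) := by
    refine sum_mem fun y hy => ?_
    refine mul_mem_lowSub (hgood y) ((cs.isKLElt_kl hM y).pos c ?_)
    rintro rfl
    exact hcs hy
  exact this k (by omega)

variable (hC : M.IsTwoDimensional)
include hC

/-- If `c` has two left descents and the product `x c` is reduced, then `c ≤_L x c`. -/
theorem leL_mul_of_two_descents {c x : W} {a b : B} (ha : cs.IsLeftDescent c a)
    (hb : cs.IsLeftDescent c b) (hab : a ≠ b)
    (hx : cs.length (x * c) = cs.length x + cs.length c) : cs.LeL c (x * c) := by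
  classical
  have hab2 := cs.eq_two_of_isLeftDescent hM ha hb hab
  -- Multiplication by `T̃_{x₀}` first undoes `x` and then applies the two descents of `c`, each of
  -- which contributes a factor `ξ` at `T̃_c`.
  set x₀ : W := cs.simple a * cs.simple b * x⁻¹ with hx₀
  set ω := a :: b :: cs.reducedWord x⁻¹ with hω
  have hωx : cs.wordProd ω = x₀ := by
    rw [hω, wordProd_cons, wordProd_cons, wordProd_reducedWord, hx₀, mul_assoc]
  have hba : cs.IsLeftDescent (cs.simple a * c) b := by
    rwa [cs.isLeftDescent_simple_mul_of_commute hM hab2]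
  have hl1 := cs.length_simple_mul_of_isLeftDescent ha
  have hl2 := cs.length_simple_mul_of_isLeftDescent hba
  -- The degree bound needs a reduced word. Here `x₀⁻¹` times an element of length `ℓ(c) - 2` has
  -- length `ℓ(x) + ℓ(c)`, which forces `ℓ(x₀) = ℓ(x) + 2`.
  have hred : cs.IsReduced ω := by
    unfold IsReduced
    have h1 := cs.length_mul_le x₀⁻¹ (cs.simple b * (cs.simple a * c))
    have h2 : x₀⁻¹ * (cs.simple b * (cs.simple a * c)) = x * c := by
      rw [hx₀, mul_inv_rev, mul_inv_rev, inv_inv, inv_simple, inv_simple]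
      have := cs.simple_commute hab2
      calc x * (cs.simple b * cs.simple a) * (cs.simple b * (cs.simple a * c))
          = x * (cs.simple b * ((cs.simple a * cs.simple b) * (cs.simple a * c))) := by group
        _ = x * (cs.simple b * ((cs.simple b * cs.simple a) * (cs.simple a * c))) := by rw [this]
        _ = x * c := by simp [mul_assoc]
    rw [h2, length_inv] at h1
    have h3 := cs.length_wordProd_le ω
    have h4 : ω.length = cs.length x + 2 := by
      rw [hω, List.length_cons, List.length_cons, length_reducedWord, length_inv]
    rw [hωx] at h3 ⊢
    omega
  have hc2 : ∀ i j, M i j = 2 → cs.polyOp i * cs.polyOp j = cs.polyOp j * cs.polyOp i :=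
    fun i j h => cs.genOp_comm hM _ _ h
  have hdeg : ∀ y z, (((ω.map cs.polyOp).prod (Finsupp.single y 1)) z).natDegree ≤ 2 := by
    intro y z
    rw [← cs.redProd_wordProd hM hc2 hred]
    exact cs.natDegree_redProd_polyOp_le_two hM hC _ _ _
  -- Passing from `x c` to `c` and then staying at `c` twice yields `X²`; the remaining terms have
  -- natural coefficients and can only add to it.
  have hcoef : (((ω.map cs.polyOp).prod (Finsupp.single (x * c) 1)) c).coeff 2 ≠ 0 := by
    obtain ⟨h, hh⟩ := cs.exists_polyOp_prod_single (cs.reducedWord x⁻¹) (x * c)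
    rw [wordProd_reducedWord, inv_mul_cancel_left] at hh
    rw [hω, List.map_cons, List.prod_cons, List.map_cons, List.prod_cons, Module.End.mul_apply,
      Module.End.mul_apply, hh, map_add, map_add, polyOp, polyOp,
      cs.genOp_single_of_isLeftDescent _ _ hb, map_add, map_smul,
      cs.genOp_single_of_isLeftDescent _ _ ha]
    simp only [smul_add, smul_smul, Finsupp.add_apply, Finsupp.smul_apply, Finsupp.single_eq_same,
      smul_eq_mul, mul_one, Polynomial.coeff_add, ← pow_two, Polynomial.coeff_X_pow]
    simp
  set w := x * c with hw
  set f := (ω.map (cs.genOp xi 1)).prod (cs.kl hM w) with hf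
  have hfm : f ∈ cs.klIdeal hM w :=
    cs.genOp_prod_mem_klIdeal hM ω (Submodule.subset_span ⟨w, Relation.ReflTransGen.refl, rfl⟩)
  have hfv : ∀ z, f z = ∑ y ∈ (cs.kl hM w).support, cs.kl hM w y *
      evalXi (((ω.map cs.polyOp).prod (Finsupp.single y 1)) z) := by
    intro z
    have h1 : cs.kl hM w = ∑ y ∈ (cs.kl hM w).support,
        cs.kl hM w y • Finsupp.single y (1 : HeckeScalars) := by
      conv_lhs => rw [← Finsupp.sum_single (cs.kl hM w)]
      rw [Finsupp.sum]
      refine Finset.sum_congr rfl fun w _ => by simp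
    rw [hf]
    conv_lhs => rw [h1]
    rw [map_sum, Finsupp.finsetSum_apply]
    refine Finset.sum_congr rfl fun y _ => ?_
    rw [map_smul, Finsupp.smul_apply, smul_eq_mul, evalXi_polyOp]
  have hws : w ∈ (cs.kl hM w).support := by
    rw [Finsupp.mem_support_iff, (cs.isKLElt_kl hM w).self]; exact one_ne_zero
  -- A lower term of `C_w` has its coefficient in `q^{1/2} ℤ[q^{1/2}]`, and its structure constants
  -- have exponents at least `-2`; the product has exponents at least `-1`.
  have hrest : ∀ z, ∑ y ∈ (cs.kl hM w).support.erase w, cs.kl hM w y *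
      evalXi (((ω.map cs.polyOp).prod (Finsupp.single y 1)) z) ∈ lowSub (-1) := by
    intro z
    refine sum_mem fun y hy => ?_
    have := mul_mem_lowSub ((cs.isKLElt_kl hM w).pos y (Finset.mem_erase.1 hy).1)
      (evalXi_mem_lowSub (hdeg y z)).1
    exact lowSub_mono (by norm_num) this
  refine cs.leL_of_mem_klIdeal hM (k := -2) hfm ?_ ?_
  · intro z
    rw [hfv, ← Finset.add_sum_erase _ _ hws, (cs.isKLElt_kl hM w).self, one_mul]
    exact add_mem (evalXi_mem_lowSub (hdeg w z)).1 (lowSub_mono (by norm_num) (hrest z))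
  · rw [hfv, ← Finset.add_sum_erase _ _ hws, (cs.isKLElt_kl hM w).self, one_mul,
      AddMonoidAlgebra.coeff_add, Finsupp.add_apply, hrest c _ (by norm_num), add_zero,
      (evalXi_mem_lowSub (hdeg w c)).2]
    exact_mod_cast hcoef

omit hC in
theorem leL_mul {c x : W} (hx : cs.length (x * c) = cs.length x + cs.length c) :
    cs.LeL (x * c) c := by
  induction hn : cs.length x generalizing x with
  | zero =>
    rw [cs.length_eq_zero_iff] at hn
    subst hn
    rw [one_mul]
    exact Relation.ReflTransGen.refl
  | succ n ih =>
    have hx1 : x ≠ 1 := by rintro rfl; simp at hn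
    obtain ⟨i, hi⟩ := cs.exists_leftDescent_of_ne_one hx1
    have hl := cs.length_simple_mul_of_isLeftDescent hi
    have h1 := cs.length_mul_le (cs.simple i * x) c
    have h2 := cs.length_simple_mul (cs.simple i * (x * c)) i
    rw [simple_mul_simple_cancel_left] at h2
    rw [mul_assoc] at h1
    have h3 := ih (x := cs.simple i * x) (by rw [mul_assoc]; omega) (by omega)
    have hnd : ¬ cs.IsLeftDescent (cs.simple i * x * c) i := by
      unfold IsLeftDescent
      rw [mul_assoc, simple_mul_simple_cancel_left]
      omega
    have h4 := cs.wEdge_simple_mul hM hnd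
    rw [mul_assoc, simple_mul_simple_cancel_left] at h4
    rw [mul_assoc] at h3
    exact Relation.ReflTransGen.head h4 h3

theorem equivL_mul_of_two_descents {c x : W} {a b : B} (ha : cs.IsLeftDescent c a)
    (hb : cs.IsLeftDescent c b) (hab : a ≠ b)
    (hx : cs.length (x * c) = cs.length x + cs.length c) : cs.EquivL (x * c) c :=
  ⟨cs.leL_mul hM hx, cs.leL_mul_of_two_descents hM hC ha hb hab hx⟩

end LeftIdeals

end CoxeterSystem


/-! ### Lines and their left cells. -/

namespace CoxeterSystem

section Lines

variable {B : Type*} {M : CoxeterMatrix B} {W : Type*} [Group W] (cs : CoxeterSystem M W)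

theorem exists_isReduced_cons {w : W} {i : B} (h : cs.IsLeftDescent w i) :
    ∃ ω, cs.IsReduced (i :: ω) ∧ cs.wordProd (i :: ω) = w := by
  obtain ⟨ω, hω, hw⟩ := cs.exists_isReduced (cs.simple i * w)
  refine ⟨ω, ?_, by rw [wordProd_cons, ← hw, simple_mul_simple_cancel_left]⟩
  rw [isReduced_cons_iff]
  refine ⟨hω, ?_⟩
  rw [← hw, isLeftDescent_simple_mul_iff]
  simpa using h

theorem isLeftDescent_of_isReduced_cons {i : B} {ω : List B} (h : cs.IsReduced (i :: ω)) :
    cs.IsLeftDescent (cs.wordProd (i :: ω)) i := by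
  rw [wordProd_cons, isLeftDescent_simple_mul_iff]
  exact (cs.isReduced_cons_iff.1 h).2

theorem eq_nil_of_isReduced {ω : List B} (h : cs.IsReduced ω) (h1 : cs.wordProd ω = 1) :
    ω = [] := by
  rw [← List.length_eq_zero_iff, ← h.eq, h1, length_one]

theorem isReduced_left_of_append {α β : List B} (h : cs.IsReduced (α ++ β)) : cs.IsReduced α := by
  have := h.take α.length
  simpa using this

theorem isReduced_right_of_append {α β : List B} (h : cs.IsReduced (α ++ β)) :
    cs.IsReduced β := by
  have := h.drop α.length
  simpa using this

theorem isLine_one : cs.IsLine 1 :=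
  ⟨[], ⟨by simp [IsReduced], by simp⟩, fun _ h => cs.eq_nil_of_isReduced h.1 h.2⟩

theorem IsLine.eq_of_isLeftDescent {w : W} (h : cs.IsLine w) {i j : B}
    (hi : cs.IsLeftDescent w i) (hj : cs.IsLeftDescent w j) : i = j := by
  obtain ⟨α, hα⟩ := cs.exists_isReduced_cons hi
  obtain ⟨β, hβ⟩ := cs.exists_isReduced_cons hj
  have := h.unique hα hβ
  exact (List.cons.inj this).1

theorem isLine_inv {w : W} (h : cs.IsLine w) : cs.IsLine w⁻¹ := by
  obtain ⟨ω, ⟨hω, hw⟩, huniq⟩ := h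
  refine ⟨ω.reverse, ⟨hω.reverse, by rw [wordProd_reverse, hw]⟩, ?_⟩
  rintro α ⟨hα, hα'⟩
  have := huniq α.reverse ⟨hα.reverse, by rw [wordProd_reverse, hα', inv_inv]⟩
  rw [← this, List.reverse_reverse]

theorem isLine_inv_iff {w : W} : cs.IsLine w⁻¹ ↔ cs.IsLine w :=
  ⟨fun h => by simpa using cs.isLine_inv h, cs.isLine_inv⟩

theorem IsLine.eq_of_isRightDescent {w : W} (h : cs.IsLine w) {i j : B}
    (hi : cs.IsRightDescent w i) (hj : cs.IsRightDescent w j) : i = j := by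
  rw [← isLeftDescent_inv_iff] at hi hj
  exact (cs.isLine_inv h).eq_of_isLeftDescent cs hi hj

theorem isLine_of_simple_mul {w : W} {i : B} (hi : ¬ cs.IsLeftDescent w i)
    (h : cs.IsLine (cs.simple i * w)) : cs.IsLine w := by
  obtain ⟨α, hα, hα'⟩ := cs.exists_isReduced w
  refine ⟨α, ⟨hα, hα'.symm⟩, ?_⟩
  rintro β ⟨hβ, hβ'⟩
  have h1 : cs.IsReduced (i :: α) := cs.isReduced_cons_iff.2 ⟨hα, by rwa [← hα']⟩
  have h2 : cs.IsReduced (i :: β) := cs.isReduced_cons_iff.2 ⟨hβ, by rwa [hβ']⟩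
  have := h.unique ⟨h2, by rw [wordProd_cons, hβ']⟩ ⟨h1, by rw [wordProd_cons, ← hα']⟩
  exact (List.cons.inj this).2

theorem isLine_simple (i : B) (hM : M.IsRightAngled) : cs.IsLine (cs.simple i) := by
  refine ⟨[i], ⟨by simp [IsReduced], by simp⟩, ?_⟩
  rintro ω ⟨hω, hw⟩
  have hl : ω.length = 1 := by rw [← hω.eq, hw, length_simple]
  obtain ⟨j, rfl⟩ := List.length_eq_one_iff.1 hl
  rw [wordProd_singleton] at hw
  rw [cs.simple_injective_of_isRightAngled hM hw]

theorem not_wEdge_one (w : W) : ¬ cs.WEdge 1 w := by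
  rintro ⟨-, h⟩
  exact h fun i hi => absurd hi (cs.not_isLeftDescent_one i)

theorem LeL.eq_one {w : W} (h : cs.LeL 1 w) : w = 1 := by
  rcases Relation.ReflTransGen.cases_head h with h | ⟨z, h, -⟩
  · exact h.symm
  · exact absurd h (cs.not_wEdge_one z)

theorem LeLR.eq_one {w : W} (h : cs.LeLR 1 w) : w = 1 := by
  induction h with
  | refl => rfl
  | tail _ h ih =>
    subst ih
    rcases h with h | h
    · exact LeL.eq_one cs h
    · unfold LeR at h
      rw [inv_one] at h
      exact inv_eq_one.1 (LeL.eq_one cs h)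

variable (hM : M.IsRightAngled)
include hM

/-- A reduced expression of `s_i w` starting with another letter would make that letter a descent of
`w` commuting with `i`. -/
theorem isLine_simple_mul {w : W} {i : B} (hi : ¬ cs.IsLeftDescent w i) (hw : cs.IsLine w)
    (h : ∀ j, cs.IsLeftDescent w j → M i j ≠ 2) : cs.IsLine (cs.simple i * w) := by
  obtain ⟨α, ⟨hα, hα'⟩, huniq⟩ := hw
  refine ⟨i :: α, ⟨cs.isReduced_cons_iff.2 ⟨hα, by rwa [hα']⟩, by rw [wordProd_cons, hα']⟩, ?_⟩
  rintro β ⟨hβ, hβ'⟩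
  cases β with
  | nil =>
    rw [wordProd_nil] at hβ'
    have := cs.length_simple_mul_of_not_isLeftDescent hi
    rw [← hβ', length_one] at this
    omega
  | cons j β =>
    have hj := cs.isLeftDescent_of_isReduced_cons hβ
    rw [hβ'] at hj
    by_cases hij : i = j
    · subst hij
      rw [wordProd_cons, mul_right_inj] at hβ'
      rw [huniq β ⟨(cs.isReduced_cons_iff.1 hβ).1, hβ'⟩]
    · obtain ⟨h1, h2⟩ := cs.isLeftDescent_of_simple_mul hM hi hj hij
      exact absurd h1 (h j h2)

/-- Elements which are not lines are closed under passing down an edge of the W-graph. -/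
theorem not_isLine_of_wEdge {y w : W} (h : cs.WEdge y w) (hw : ¬ cs.IsLine w) :
    ¬ cs.IsLine y := by
  intro hy
  obtain ⟨hmu, hsub⟩ := h
  obtain ⟨s, hsy, hsw⟩ := Set.not_subset.1 hsub
  change cs.IsLeftDescent y s at hsy
  change ¬ cs.IsLeftDescent w s at hsw
  have hw1 : w ≠ 1 := by rintro rfl; exact hw cs.isLine_one
  obtain ⟨t, ht⟩ := cs.exists_leftDescent_of_ne_one hw1
  -- If `y` were a line, `s` would be its only descent, so `t` is not one and the edge must be
  -- multiplication by `t` or by `s`. In the first case `t` cannot commute with `s`, since `s` would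
  -- then remain a descent of `w = t y`; so `w` would be a line.
  have hty : ¬ cs.IsLeftDescent y t := by
    intro hty
    rw [hy.eq_of_isLeftDescent cs hsy hty] at hsw
    exact hsw ht
  rcases (cs.klMu_ne_zero_iff hM y w).1 hmu with h1 | h1
  · have h2 := cs.kl_coeff_one hM ht hty h1
    apply hw
    rw [h2]
    refine cs.isLine_simple_mul hM hty hy fun j hj hM2 => hsw ?_
    rw [h2, cs.isLeftDescent_simple_mul_of_commute hM]
    · exact hsy
    · rwa [hy.eq_of_isLeftDescent cs hsy hj]
  · have h2 := cs.kl_coeff_one hM hsy hsw h1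
    rw [h2] at hy
    exact hw (cs.isLine_of_simple_mul hsw hy)

theorem not_isLine_of_leL {y w : W} (h : cs.LeL y w) (hw : ¬ cs.IsLine w) : ¬ cs.IsLine y := by
  induction h using Relation.ReflTransGen.head_induction_on with
  | refl => exact hw
  | head h _ ih => exact cs.not_isLine_of_wEdge hM h ih

theorem not_isLine_of_leLR {y w : W} (h : cs.LeLR y w) (hw : ¬ cs.IsLine w) :
    ¬ cs.IsLine y := by
  induction h using Relation.ReflTransGen.head_induction_on with
  | refl => exact hw
  | head h _ ih =>
    rcases h with h | h
    · exact cs.not_isLine_of_leL hM h ih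
    · rw [← isLine_inv_iff] at ih ⊢
      exact cs.not_isLine_of_leL hM h ih

theorem EquivLR.isLine_iff {y w : W} (h : cs.EquivLR y w) : cs.IsLine y ↔ cs.IsLine w :=
  ⟨fun hy => by_contra fun hw => cs.not_isLine_of_leLR hM h.1 hw hy,
    fun hw => by_contra fun hy => cs.not_isLine_of_leLR hM h.2 hy hw⟩

omit hM in
theorem EquivLR.eq_one_iff {y w : W} (h : cs.EquivLR y w) : y = 1 ↔ w = 1 := by
  constructor
  · rintro rfl; exact LeLR.eq_one cs h.1
  · rintro rfl; exact LeLR.eq_one cs h.2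

omit hM in
theorem EquivL.equivLR {y w : W} (h : cs.EquivL y w) : cs.EquivLR y w :=
  ⟨.single (Or.inl h.1), .single (Or.inl h.2)⟩

omit hM in
theorem EquivL.equivLR_inv {y w : W} (h : cs.EquivL y⁻¹ w⁻¹) : cs.EquivLR y w :=
  ⟨.single (Or.inr h.1), .single (Or.inr h.2)⟩

omit hM in
theorem EquivL.symm {y w : W} (h : cs.EquivL y w) : cs.EquivL w y := ⟨h.2, h.1⟩

omit hM in
theorem EquivL.trans {x y z : W} (h : cs.EquivL x y) (h' : cs.EquivL y z) : cs.EquivL x z :=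
  ⟨Relation.ReflTransGen.trans h.1 h'.1, Relation.ReflTransGen.trans h'.2 h.2⟩

omit hM in
theorem EquivL.refl (x : W) : cs.EquivL x x :=
  ⟨Relation.ReflTransGen.refl, Relation.ReflTransGen.refl⟩

omit hM in
theorem EquivLR.symm {y w : W} (h : cs.EquivLR y w) : cs.EquivLR w y := ⟨h.2, h.1⟩

omit hM in
theorem EquivLR.trans {x y z : W} (h : cs.EquivLR x y) (h' : cs.EquivLR y z) : cs.EquivLR x z :=
  ⟨Relation.ReflTransGen.trans h.1 h'.1, Relation.ReflTransGen.trans h'.2 h.2⟩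

omit hM in
theorem EquivLR.refl (x : W) : cs.EquivLR x x :=
  ⟨Relation.ReflTransGen.refl, Relation.ReflTransGen.refl⟩

/-- Edges of the W-graph between non-unit lines. -/
theorem exists_simple_mul_of_wEdge {x y : W} (h : cs.WEdge x y) (hx : cs.IsLine x)
    (hy1 : y ≠ 1) :
    (∃ i, ¬ cs.IsLeftDescent y i ∧ x = cs.simple i * y) ∨
      ∃ i, ¬ cs.IsLeftDescent x i ∧ y = cs.simple i * x := by
  obtain ⟨hmu, hsub⟩ := h
  obtain ⟨s, hsx, hsy⟩ := Set.not_subset.1 hsub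
  change cs.IsLeftDescent x s at hsx
  change ¬ cs.IsLeftDescent y s at hsy
  obtain ⟨t, ht⟩ := cs.exists_leftDescent_of_ne_one hy1
  have htx : ¬ cs.IsLeftDescent x t := by
    intro htx
    rw [hx.eq_of_isLeftDescent cs hsx htx] at hsy
    exact hsy ht
  rcases (cs.klMu_ne_zero_iff hM x y).1 hmu with h1 | h1
  · exact Or.inr ⟨t, htx, cs.kl_coeff_one hM ht htx h1⟩
  · exact Or.inl ⟨s, hsy, cs.kl_coeff_one hM hsx hsy h1⟩

/-- The only descent of the line `s_i y` is `i`, which is not a descent of `y`. The edge therefore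
also exists in the upward direction. -/
theorem wEdge_of_isLine {y : W} {i : B} (hi : ¬ cs.IsLeftDescent y i)
    (h : cs.IsLine (cs.simple i * y)) (hy1 : y ≠ 1) : cs.WEdge y (cs.simple i * y) := by
  refine ⟨(cs.klMu_simple_mul_ne_zero hM hi).2, fun hsub => ?_⟩
  obtain ⟨t, ht⟩ := cs.exists_leftDescent_of_ne_one hy1
  have h1 : cs.IsLeftDescent (cs.simple i * y) t := hsub ht
  have h2 : cs.IsLeftDescent (cs.simple i * y) i := by rwa [isLeftDescent_simple_mul_iff]
  rw [h.eq_of_isLeftDescent cs h1 h2] at ht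
  exact hi ht

theorem equivL_of_isLine {y : W} {i : B} (hi : ¬ cs.IsLeftDescent y i)
    (h : cs.IsLine (cs.simple i * y)) (hy1 : y ≠ 1) : cs.EquivL (cs.simple i * y) y :=
  ⟨.single (cs.wEdge_simple_mul hM hi), .single (cs.wEdge_of_isLine hM hi h hy1)⟩

omit hM in
theorem isRightDescent_simple_mul {y : W} {i k : B} (hi : ¬ cs.IsLeftDescent y i)
    (hk : cs.IsRightDescent y k) : cs.IsRightDescent (cs.simple i * y) k := by
  have h1 := cs.length_simple_mul_of_not_isLeftDescent hi
  have h2 := cs.length_mul_le (cs.simple i) (y * cs.simple k)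
  rw [length_simple] at h2
  unfold IsRightDescent at hk ⊢
  rw [mul_assoc]
  omega

omit hM in
theorem isRightDescent_of_simple_mul {y : W} {i k : B} (hi : ¬ cs.IsLeftDescent y i)
    (h : cs.IsLine (cs.simple i * y)) (hy1 : y ≠ 1)
    (hk : cs.IsRightDescent (cs.simple i * y) k) : cs.IsRightDescent y k := by
  obtain ⟨l, hl⟩ := cs.exists_rightDescent_of_ne_one hy1
  rwa [h.eq_of_isRightDescent cs hk (cs.isRightDescent_simple_mul hi hl)]

/-- Lines ending in `i`. -/
def lineSet (i : B) : Set W := {w | cs.IsLine w ∧ cs.IsRightDescent w i}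

omit hM in
theorem ne_one_of_isRightDescent {w : W} {i : B} (h : cs.IsRightDescent w i) : w ≠ 1 := by
  rintro rfl
  exact cs.not_isRightDescent_one i h

theorem equivL_simple_of_mem_lineSet {w : W} {i : B} (hw : w ∈ cs.lineSet i) :
    cs.EquivL w (cs.simple i) := by
  induction hn : cs.length w generalizing w with
  | zero =>
    rw [cs.length_eq_zero_iff] at hn
    exact absurd hn (cs.ne_one_of_isRightDescent hw.2)
  | succ n ih =>
    obtain ⟨j, hj⟩ := cs.exists_leftDescent_of_ne_one (cs.ne_one_of_isRightDescent hw.2)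
    have hl := cs.length_simple_mul_of_isLeftDescent hj
    obtain ⟨y, rfl⟩ : ∃ y, w = cs.simple j * y := ⟨cs.simple j * w, by simp⟩
    rw [simple_mul_simple_cancel_left] at hl
    have hj' : ¬ cs.IsLeftDescent y j := by rwa [isLeftDescent_simple_mul_iff] at hj
    by_cases hy1 : y = 1
    · subst hy1
      have h1 : cs.IsRightDescent (cs.simple j * 1) j := by
        simp [IsRightDescent]
      rw [hw.1.eq_of_isRightDescent cs hw.2 h1, mul_one]
      exact EquivL.refl cs _
    · have h1 : y ∈ cs.lineSet i :=
        ⟨cs.isLine_of_simple_mul hj' hw.1, cs.isRightDescent_of_simple_mul hj' hw.1 hy1 hw.2⟩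
      exact (cs.equivL_of_isLine hM hj' hw.1 hy1).trans cs (ih h1 (by omega))

omit hM in
theorem simple_mem_lineSet (hM : M.IsRightAngled) (i : B) : cs.simple i ∈ cs.lineSet i :=
  ⟨cs.isLine_simple i hM, by simp [IsRightDescent]⟩

/-- A step in the W-graph between lines keeps the last letter. -/
theorem mem_lineSet_of_wEdge {x y : W} (h : cs.WEdge x y) (hx : cs.IsLine x) (hx1 : x ≠ 1) {i : B}
    (hy : y ∈ cs.lineSet i) : x ∈ cs.lineSet i := by
  refine ⟨hx, ?_⟩
  rcases cs.exists_simple_mul_of_wEdge hM h hx (cs.ne_one_of_isRightDescent hy.2) with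
    ⟨j, hj, rfl⟩ | ⟨j, hj, rfl⟩
  · exact cs.isRightDescent_simple_mul hj hy.2
  · exact cs.isRightDescent_of_simple_mul hj hy.1 hx1 hy.2

theorem EquivL.isLine_iff {x y : W} (h : cs.EquivL x y) : cs.IsLine x ↔ cs.IsLine y :=
  (h.equivLR cs).isLine_iff cs hM

/-- A chain of edges between equivalent elements stays in their class, hence among non-unit lines,
where an edge changes only the left end. -/
theorem mem_lineSet_of_equivL {x y : W} (h : cs.EquivL x y) {i : B} (hy : y ∈ cs.lineSet i) :
    x ∈ cs.lineSet i := by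
  obtain ⟨h1, h2⟩ := h
  induction h1 using Relation.ReflTransGen.head_induction_on with
  | refl => exact hy
  | head hxz hzy ih =>
    rename_i x z
    have hx : cs.EquivL x y := ⟨.head hxz hzy, h2⟩
    refine cs.mem_lineSet_of_wEdge hM hxz ((hx.isLine_iff cs hM).2 hy.1) ?_
      (ih (h2.trans (.single hxz)))
    intro h1
    exact cs.ne_one_of_isRightDescent hy.2 (((hx.equivLR cs).eq_one_iff cs).1 h1)

theorem equivL_simple_iff {w : W} {i : B} : cs.EquivL w (cs.simple i) ↔ w ∈ cs.lineSet i :=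
  ⟨fun h => cs.mem_lineSet_of_equivL hM h (cs.simple_mem_lineSet hM i),
    cs.equivL_simple_of_mem_lineSet hM⟩

end Lines

end CoxeterSystem


/-! ### Cores, segments and left precells. -/

namespace CoxeterSystem

section Precells

variable {B : Type*} {M : CoxeterMatrix B} {W : Type*} [Group W] (cs : CoxeterSystem M W)

/-- `a` is the longest common prefix of the reduced expressions of `w = a c`, and `c` has two
different left descents. -/
structure HasCore (a : List B) (c w : W) : Prop where
  mul_eq : cs.wordProd a * c = w
  length_eq : cs.length w = a.length + cs.length c
  isPrefix_of_isReduced : ∀ ω, cs.IsReduced ω → cs.wordProd ω = w → a <+: ω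
  exists_descents : ∃ i j, i ≠ j ∧ cs.IsLeftDescent c i ∧ cs.IsLeftDescent c j

variable {cs} in
theorem HasCore.isReduced_append {a : List B} {c w : W} (h : cs.HasCore a c w) {β : List B}
    (hβ : cs.IsReduced β) (hc : cs.wordProd β = c) :
    cs.IsReduced (a ++ β) ∧ cs.wordProd (a ++ β) = w := by
  have h1 : cs.wordProd (a ++ β) = w := by rw [wordProd_append, hc, h.mul_eq]
  refine ⟨?_, h1⟩
  rw [IsReduced, h1, h.length_eq, List.length_append, ← hβ.eq, hc]

variable {cs} in
-- The two descents of the core give reduced expressions that diverge right after `a`, so one of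
-- them avoids any prescribed next letter. In this form the maximality of `a` is used below.
theorem HasCore.exists_ne {a : List B} {c w : W} (h : cs.HasCore a c w) (k : B) :
    ∃ i β, i ≠ k ∧ cs.IsReduced (a ++ i :: β) ∧ cs.wordProd (a ++ i :: β) = w := by
  have key : ∀ i, cs.IsLeftDescent c i → ∃ β, cs.IsReduced (a ++ i :: β) ∧
      cs.wordProd (a ++ i :: β) = w := fun i hi => by
    obtain ⟨β, h1, h2⟩ := cs.exists_isReduced_cons hi
    exact ⟨β, h.isReduced_append h1 h2⟩
  obtain ⟨i, j, hij, hi, hj⟩ := h.exists_descents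
  by_cases hik : i = k
  · obtain ⟨β, hβ⟩ := key j hj
    exact ⟨j, β, fun hjk => hij (hik.trans hjk.symm), hβ⟩
  · obtain ⟨β, hβ⟩ := key i hi
    exact ⟨i, β, hik, hβ⟩

variable {cs} in
theorem HasCore.not_isLine {a : List B} {c w : W} (h : cs.HasCore a c w) : ¬ cs.IsLine w := by
  intro hw
  obtain ⟨i, -, -, hi, -⟩ := h.exists_descents
  obtain ⟨α, hα, hα'⟩ := cs.exists_isReduced_cons hi
  obtain ⟨j, β, hj, hβ⟩ := h.exists_ne i
  have := hw.unique (h.isReduced_append hα hα') hβ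
  simp at this
  exact hj this.1.symm

variable {cs} in
theorem HasCore.nil {c : W} {i j : B} (hij : i ≠ j) (hi : cs.IsLeftDescent c i)
    (hj : cs.IsLeftDescent c j) : cs.HasCore [] c c :=
  ⟨by simp, by simp, fun _ _ _ => List.nil_prefix, i, j, hij, hi, hj⟩

variable {cs} in
theorem HasCore.core {a : List B} {c w : W} (h : cs.HasCore a c w) : cs.HasCore [] c c := by
  obtain ⟨i, j, hij, hi, hj⟩ := h.exists_descents
  exact .nil hij hi hj

variable {cs} in
theorem HasCore.isPrefix {a a' : List B} {c c' w : W} (h : cs.HasCore a c w)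
    (h' : cs.HasCore a' c' w) : a <+: a' := by
  obtain ⟨β, hβ, hβ'⟩ := cs.exists_isReduced c
  have h1 := h.isReduced_append hβ hβ'.symm
  rcases List.prefix_or_prefix_of_prefix (h.isPrefix_of_isReduced _ h1.1 h1.2)
    (h'.isPrefix_of_isReduced _ h1.1 h1.2) with h2 | ⟨r, rfl⟩
  · exact h2
  · cases r with
    | nil => simp
    | cons k r =>
      obtain ⟨i, α, hik, hα, hα'⟩ := h'.exists_ne k
      have h3 := h.isPrefix_of_isReduced _ hα hα'
      rw [List.prefix_append_right_inj, List.cons_prefix_cons] at h3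
      exact absurd h3.1.symm hik

variable {cs} in
theorem HasCore.core_eq {a a' : List B} {c c' w : W} (h : cs.HasCore a c w)
    (h' : cs.HasCore a' c' w) : c = c' := by
  have h1 : a = a' := (h.isPrefix h').eq_of_length_le (h'.isPrefix h).length_le
  have := h.mul_eq.trans h'.mul_eq.symm
  rwa [h1, mul_right_inj] at this

/-- Strip first letters as long as they are forced. The process stops at an element with two
descents, since otherwise the whole word would be forced and `w` would be a line. -/
theorem exists_hasCore {w : W} (hw : ¬ cs.IsLine w) : ∃ a c, cs.HasCore a c w := by
  induction hn : cs.length w generalizing w with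
  | zero =>
    rw [cs.length_eq_zero_iff] at hn
    exact absurd (hn ▸ cs.isLine_one) hw
  | succ n ih =>
    have hw1 : w ≠ 1 := by rintro rfl; simp at hn
    obtain ⟨i, hi⟩ := cs.exists_leftDescent_of_ne_one hw1
    by_cases hj : ∃ j, i ≠ j ∧ cs.IsLeftDescent w j
    · obtain ⟨j, hij, hj⟩ := hj
      exact ⟨[], w, .nil hij hi hj⟩
    · push Not at hj
      have hcons : ∀ ω, cs.IsReduced ω → cs.wordProd ω = w →
          ∃ ω', ω = i :: ω' ∧ cs.IsReduced ω' ∧ cs.wordProd ω' = cs.simple i * w := by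
        intro ω hω hw'
        cases ω with
        | nil => exact absurd hw'.symm (by simpa using hw1)
        | cons j ω =>
          have h1 := cs.isLeftDescent_of_isReduced_cons hω
          rw [hw'] at h1
          obtain rfl : i = j := by_contra fun hij => hj j hij h1
          refine ⟨ω, rfl, (cs.isReduced_cons_iff.1 hω).1, ?_⟩
          rw [← hw', wordProd_cons, simple_mul_simple_cancel_left]
      have hl := cs.length_simple_mul_of_isLeftDescent hi
      have hnl : ¬ cs.IsLine (cs.simple i * w) := by
        rintro ⟨α, ⟨hα, hα'⟩, huniq⟩
        obtain ⟨ω, h1, h2⟩ := cs.exists_isReduced w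
        refine hw ⟨ω, ⟨h1, h2.symm⟩, ?_⟩
        rintro β ⟨hβ, hβ'⟩
        obtain ⟨ω', rfl, h3⟩ := hcons ω h1 h2.symm
        obtain ⟨β', rfl, h4⟩ := hcons β hβ hβ'
        rw [huniq _ h3, huniq _ h4]
      obtain ⟨a, c, h⟩ := ih hnl (by omega)
      have h5 : cs.wordProd (i :: a) * c = w := by
        rw [wordProd_cons, mul_assoc, h.mul_eq, simple_mul_simple_cancel_left]
      have h6 := h.length_eq
      refine ⟨i :: a, c, h5, by rw [List.length_cons]; omega, ?_, h.exists_descents⟩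
      · intro ω hω hω'
        obtain ⟨ω', rfl, h7, h8⟩ := hcons ω hω hω'
        rw [List.cons_prefix_cons]
        exact ⟨rfl, h.isPrefix_of_isReduced ω' h7 h8⟩

/-- A common prefix of all reduced expressions represents a line. -/
theorem isLine_of_isPrefix {a b : List B} (h : cs.IsReduced (a ++ b))
    (hp : ∀ ω, cs.IsReduced ω → cs.wordProd ω = cs.wordProd (a ++ b) → a <+: ω) :
    cs.IsLine (cs.wordProd a) := by
  refine ⟨a, ⟨cs.isReduced_left_of_append h, rfl⟩, ?_⟩
  rintro α ⟨hα, hα'⟩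
  have hlen : α.length = a.length := by
    rw [← hα.eq, hα', (cs.isReduced_left_of_append h).eq]
  have h1 : cs.wordProd (α ++ b) = cs.wordProd (a ++ b) := by
    rw [wordProd_append, wordProd_append, hα']
  have h2 : cs.IsReduced (α ++ b) := by
    rw [IsReduced, h1, h.eq, List.length_append, List.length_append, hlen]
  have h3 := hp _ h2 h1
  exact ((List.prefix_of_prefix_length_le h3 (List.prefix_append α b) hlen.ge).eq_of_length
    hlen.symm).symm

theorem IsRigidSubword.isPrefix {a b : List B} (h : cs.IsRigidSubword [] a b) {ω : List B}
    (hω : cs.IsReduced ω) (hω' : cs.wordProd ω = cs.wordProd (a ++ b)) : a <+: ω := by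
  obtain ⟨a', b', rfl, h1, -⟩ := h.2.2.2 ω hω (by simpa using hω')
  rw [List.append_assoc] at hω
  rw [wordProd_nil] at h1
  rw [cs.eq_nil_of_isReduced (cs.isReduced_left_of_append hω) h1]
  simp

theorem isRigidSubword_nil {a b : List B} (ha : a ≠ []) (h : cs.IsReduced (a ++ b))
    (hp : ∀ ω, cs.IsReduced ω → cs.wordProd ω = cs.wordProd (a ++ b) → a <+: ω) :
    cs.IsRigidSubword [] a b := by
  refine ⟨by simpa using h, ha, cs.isLine_of_isPrefix h hp, ?_⟩
  intro ω hω hω'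
  rw [List.nil_append] at hω'
  obtain ⟨b', rfl⟩ := hp ω hω hω'
  refine ⟨[], b', by simp, rfl, ?_⟩
  rwa [wordProd_append, wordProd_append, mul_right_inj] at hω'

/-- If the remainder had a single descent `k`, every reduced expression would continue `a` by `k`,
and the segment could be extended. -/
theorem hasCore_of_isSegment {a b : List B} (h : cs.IsSegment [] a b) (hb : b ≠ []) :
    cs.HasCore a (cs.wordProd b) (cs.wordProd (a ++ b)) := by
  have hred : cs.IsReduced (a ++ b) := by simpa using h.1.1
  have hpre := fun ω => h.1.isPrefix cs (ω := ω)
  have hbr := cs.isReduced_right_of_append hred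
  refine ⟨(cs.wordProd_append a b).symm, ?_, hpre, ?_⟩
  · rw [hred.eq, hbr.eq, List.length_append]
  · cases b with
    | nil => exact absurd rfl hb
    | cons k b =>
      by_contra hcon
      push Not at hcon
      have hk := cs.isLeftDescent_of_isReduced_cons hbr
      have h1 : cs.IsRigidSubword [] (a ++ [k]) b := by
        refine cs.isRigidSubword_nil (by simp) (by simpa using hred) ?_
        intro ω hω hω'
        rw [List.append_assoc, List.singleton_append] at hω'
        obtain ⟨β, rfl⟩ := hpre ω hω hω'
        rw [List.prefix_append_right_inj]
        have hβr := cs.isReduced_right_of_append hω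
        rw [wordProd_append, wordProd_append, mul_right_inj] at hω'
        cases β with
        | nil =>
          rw [wordProd_nil] at hω'
          rw [← hω'] at hk
          exact absurd hk (cs.not_isLeftDescent_one k)
        | cons j β =>
          have hj := cs.isLeftDescent_of_isReduced_cons hβr
          rw [hω'] at hj
          obtain rfl : k = j := by_contra fun hkj => hcon k j hkj hk hj
          simp
      have h2 := h.2 [] [] [k] b rfl rfl (by simpa using h1)
      simp at h2

variable {cs} in
-- A longer rigid prefix would prescribe the letter after `a`, which the two descents of the core
-- leave open.
theorem HasCore.isSegment {a b : List B} {c w : W} (h : cs.HasCore a c w) (ha : a ≠ [])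
    (hb : cs.IsReduced b) (hbc : cs.wordProd b = c) : cs.IsSegment [] a b := by
  obtain ⟨h1, h2⟩ := h.isReduced_append hb hbc
  refine ⟨cs.isRigidSubword_nil ha h1 fun ω hω hω' => h.isPrefix_of_isReduced ω hω (hω'.trans h2), ?_⟩
  intro a₁ a₂ b₁ b₂ h3 h4 h5
  obtain ⟨rfl, rfl⟩ := List.append_eq_nil_iff.1 h3.symm
  refine ⟨rfl, ?_⟩
  cases b₁ with
  | nil => rfl
  | cons k b₁ =>
    subst h4
    obtain ⟨i, α, hik, hα, hα'⟩ := h.exists_ne k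
    have h6 := h5.isPrefix cs hα (by rw [hα', ← h2]; simp)
    rw [List.nil_append, List.prefix_append_right_inj, List.cons_prefix_cons] at h6
    exact absurd h6.1.symm hik

theorem exists_eq_simple_of_length_eq_one {w : W} (h : cs.length w = 1) :
    ∃ i, w = cs.simple i := by
  obtain ⟨ω, hω, hω'⟩ := cs.exists_isReduced w
  rw [hω', hω.eq] at h
  obtain ⟨i, rfl⟩ := List.length_eq_one_iff.1 h
  exact ⟨i, by simpa using hω'⟩

theorem isPrecellExtension_cases {wL w : W} (h : cs.IsPrecellExtension wL w) (h1 : wL ≠ 1) :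
    (∃ i, wL = cs.simple i ∧ w ∈ cs.lineSet i) ∨ w = wL ∨ ∃ a, cs.HasCore a wL w := by
  obtain ⟨a, b, hred, hw, hb, h2, h3⟩ := h
  by_cases hl : cs.length wL = 1
  · obtain ⟨i, hi⟩ := cs.exists_eq_simple_of_length_eq_one hl
    refine Or.inl ⟨i, hi, h3 hl, ?_⟩
    have h4 := cs.length_wordProd_le a
    have h5 := hred.eq
    rw [List.length_append, ← (cs.isReduced_right_of_append hred).eq, hb, hl, hw] at h5
    rw [IsRightDescent, h5, ← hw, wordProd_append, hb, hi, simple_mul_simple_cancel_right]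
    omega
  · have h5 : cs.length wL ≠ 0 := by rwa [Ne, cs.length_eq_zero_iff]
    rcases h2 (by omega) with rfl | h2
    · right; left
      rw [← hw, ← hb, List.nil_append]
    · right; right
      refine ⟨a, ?_⟩
      rw [← hw, ← hb]
      exact cs.hasCore_of_isSegment h2 (by rintro rfl; exact h1 (by rw [← hb, wordProd_nil]))

variable (hM : M.IsRightAngled)
include hM

theorem isPrecellExtension_of_hasCore {a : List B} {c w : W} (h : cs.HasCore a c w) :
    cs.IsPrecellExtension c w := by
  obtain ⟨b, hb, hb'⟩ := cs.exists_isReduced c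
  obtain ⟨h1, h2⟩ := h.isReduced_append hb hb'.symm
  refine ⟨a, b, h1, h2, hb'.symm, fun _ => ?_, fun hl => ?_⟩
  · by_cases ha : a = []
    · exact Or.inl ha
    · exact Or.inr (h.isSegment ha hb hb'.symm)
  · obtain ⟨i, rfl⟩ := cs.exists_eq_simple_of_length_eq_one hl
    exact absurd (cs.isLine_simple i hM) h.core.not_isLine

omit hM in
variable {cs} in
theorem HasCore.core_ne_one {a : List B} {c w : W} (h : cs.HasCore a c w) : c ≠ 1 := by
  rintro rfl
  exact h.core.not_isLine cs.isLine_one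

/-- By uniqueness of cores, two distinct members of the precell of a non-line can share only their
core as `w_L`. -/
theorem leftPrecell_of_hasCore {a : List B} {c w : W} (h : cs.HasCore a c w) :
    cs.leftPrecell w = {y | ∃ a', cs.HasCore a' c y} := by
  ext y
  constructor
  · rintro (⟨-, rfl⟩ | ⟨wL, h1, hy, hw⟩)
    · exact absurd cs.isLine_one h.not_isLine
    · rcases cs.isPrecellExtension_cases hw h1 with ⟨i, -, hi⟩ | rfl | ⟨a₁, ha₁⟩
      · exact absurd hi.1 h.not_isLine
      · rcases cs.isPrecellExtension_cases hy h1 with ⟨i, rfl, -⟩ | rfl | ⟨a₂, ha₂⟩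
        · exact absurd (cs.isLine_simple i hM) h.not_isLine
        · exact ⟨a, h⟩
        · exact ⟨a₂, h.core_eq ha₂.core ▸ ha₂⟩
      · obtain rfl := h.core_eq ha₁
        rcases cs.isPrecellExtension_cases hy h1 with ⟨i, rfl, -⟩ | rfl | h2
        · exact absurd (cs.isLine_simple i hM) h.core.not_isLine
        · exact ⟨[], h.core⟩
        · exact h2
  · rintro ⟨a', h'⟩
    exact Or.inr ⟨c, h.core_ne_one, cs.isPrecellExtension_of_hasCore hM h',
      cs.isPrecellExtension_of_hasCore hM h⟩

theorem isCanonicalRep_of_hasCore {a : List B} {c w : W} (h : cs.HasCore a c w) :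
    cs.IsCanonicalRep (cs.leftPrecell w) c := by
  rw [cs.leftPrecell_of_hasCore hM h]
  refine ⟨⟨[], h.core⟩, ?_⟩
  rintro y ⟨a', h'⟩ hyc
  rw [h'.length_eq]
  have : a' ≠ [] := by
    rintro rfl
    exact hyc (by rw [← h'.mul_eq, wordProd_nil, one_mul])
  have := List.length_pos_iff.2 this
  omega

theorem ncard_leftDescents_eq_two (hC : M.IsTwoDimensional) {c : W} {i j : B} (hij : i ≠ j)
    (hi : cs.IsLeftDescent c i) (hj : cs.IsLeftDescent c j) : (cs.leftDescents c).ncard = 2 := by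
  have : cs.leftDescents c = {i, j} := by
    ext k
    simp only [Set.mem_insert_iff, Set.mem_singleton_iff]
    constructor
    · intro hk
      by_contra! hcon
      exact hC i j k (cs.eq_two_of_isLeftDescent hM hi hj hij)
        (cs.eq_two_of_isLeftDescent hM hj hk hcon.2.symm)
        (cs.eq_two_of_isLeftDescent hM hi hk hcon.1.symm)
    · rintro (rfl | rfl)
      exacts [hi, hj]
  rw [this, Set.ncard_pair hij]

theorem leftPrecell_subset_not_isLine {w : W} (hw : ¬ cs.IsLine w) :
    cs.leftPrecell w ⊆ {y | ¬ cs.IsLine y} := by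
  obtain ⟨a, c, h⟩ := cs.exists_hasCore hw
  rw [cs.leftPrecell_of_hasCore hM h]
  rintro y ⟨a', h'⟩
  exact h'.not_isLine

theorem hasPrecellDim_two (hC : M.IsTwoDimensional) {w : W} (hw : ¬ cs.IsLine w) :
    cs.HasPrecellDim (cs.leftPrecell w) 2 := by
  obtain ⟨a, c, h⟩ := cs.exists_hasCore hw
  obtain ⟨i, j, hij, hi, hj⟩ := h.exists_descents
  exact ⟨c, h.core_ne_one, cs.isCanonicalRep_of_hasCore hM h,
    cs.ncard_leftDescents_eq_two hM hC hij hi hj⟩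

omit hM in
theorem isPrecellExtension_of_mem_lineSet {w : W} {i : B} (hw : w ∈ cs.lineSet i) :
    cs.IsPrecellExtension (cs.simple i) w := by
  obtain ⟨a, ha, ha'⟩ := cs.exists_isReduced (w * cs.simple i)
  have h1 : cs.wordProd (a ++ [i]) = w := by
    rw [wordProd_append, ← ha', wordProd_singleton, simple_mul_simple_cancel_right]
  have h2 := cs.isRightDescent_iff.1 hw.2
  refine ⟨a, [i], ?_, h1, wordProd_singleton _ _, fun h => ?_, fun _ => hw.1⟩
  · rw [IsReduced, h1, List.length_append, ← ha.eq, ← ha', List.length_singleton, h2]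
  · rw [length_simple] at h
    omega

theorem leftPrecell_of_mem_lineSet {w : W} {i : B} (hw : w ∈ cs.lineSet i) :
    cs.leftPrecell w = cs.lineSet i := by
  ext y
  constructor
  · rintro (⟨-, rfl⟩ | ⟨wL, h1, hy, hw'⟩)
    · exact absurd hw.2 (cs.not_isRightDescent_one i)
    · rcases cs.isPrecellExtension_cases hw' h1 with ⟨j, rfl, hj⟩ | rfl | ⟨a₁, ha₁⟩
      · obtain rfl := hw.1.eq_of_isRightDescent cs hw.2 hj.2
        rcases cs.isPrecellExtension_cases hy h1 with ⟨k, hk, hy'⟩ | rfl | ⟨a₂, ha₂⟩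
        · rwa [cs.simple_injective_of_isRightAngled hM hk]
        · exact cs.simple_mem_lineSet hM _
        · exact absurd (cs.isLine_simple _ hM) ha₂.core.not_isLine
      · rcases cs.isPrecellExtension_cases hy h1 with ⟨k, rfl, hy'⟩ | rfl | ⟨a₂, ha₂⟩
        · rwa [hw.1.eq_of_isRightDescent cs hw.2 (cs.simple_mem_lineSet hM k).2]
        · exact hw
        · exact absurd hw.1 ha₂.core.not_isLine
      · exact absurd hw.1 ha₁.not_isLine
  · intro hy
    refine Or.inr ⟨cs.simple i, ?_, cs.isPrecellExtension_of_mem_lineSet hy,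
      cs.isPrecellExtension_of_mem_lineSet hw⟩
    exact cs.ne_one_of_isRightDescent (cs.simple_mem_lineSet hM i).2

theorem hasPrecellDim_lineSet (i : B) : cs.HasPrecellDim (cs.lineSet i) 1 := by
  refine ⟨cs.simple i, cs.ne_one_of_isRightDescent (cs.simple_mem_lineSet hM i).2,
    ⟨cs.simple_mem_lineSet hM i, ?_⟩, ?_⟩
  · intro w hw hne
    rw [length_simple]
    have h0 : cs.length w ≠ 0 := by
      rw [Ne, cs.length_eq_zero_iff]
      exact cs.ne_one_of_isRightDescent hw.2
    have h1 : cs.length w ≠ 1 := by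
      intro h1
      obtain ⟨j, rfl⟩ := cs.exists_eq_simple_of_length_eq_one h1
      exact hne (by rw [hw.1.eq_of_isRightDescent cs hw.2 (cs.simple_mem_lineSet hM j).2])
    omega
  · have hi : cs.IsLeftDescent (cs.simple i) i := by simp [IsLeftDescent]
    rw [Set.ncard_eq_one]
    refine ⟨i, Set.eq_singleton_iff_unique_mem.2 ⟨hi, fun j hj => ?_⟩⟩
    exact (cs.isLine_simple i hM).eq_of_isLeftDescent cs hj hi

theorem isTypeOneCell_iff {C : Set W} : cs.IsTypeOneCell C ↔ ∃ i, C = cs.lineSet i := by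
  have hp := fun i => cs.leftPrecell_of_mem_lineSet hM (cs.simple_mem_lineSet hM i)
  constructor
  · rintro ⟨-, i, rfl, -⟩
    exact ⟨i, hp i⟩
  · rintro ⟨i, rfl⟩
    refine ⟨⟨cs.simple i, ?_⟩, i, (hp i).symm, ?_⟩
    · ext w
      exact (cs.equivL_simple_iff hM).symm
    · rw [hp i]
      exact cs.hasPrecellDim_lineSet hM i

theorem sUnion_isTypeOneCell : ⋃₀ {C | cs.IsTypeOneCell C} = {w | cs.IsLine w ∧ w ≠ 1} := by
  ext w
  simp only [Set.mem_sUnion, Set.mem_ofPred_eq, cs.isTypeOneCell_iff hM]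
  constructor
  · rintro ⟨_, ⟨i, rfl⟩, hw⟩
    exact ⟨hw.1, cs.ne_one_of_isRightDescent hw.2⟩
  · rintro ⟨hw, hw1⟩
    obtain ⟨i, hi⟩ := cs.exists_rightDescent_of_ne_one hw1
    exact ⟨_, ⟨i, rfl⟩, hw, hi⟩

theorem isOfDim_one : cs.IsOfDim {w | cs.IsLine w ∧ w ≠ 1} 1 := by
  rintro w ⟨hw, hw1⟩
  obtain ⟨i, hi⟩ := cs.exists_rightDescent_of_ne_one hw1
  rw [cs.leftPrecell_of_mem_lineSet hM ⟨hw, hi⟩]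
  exact ⟨fun y hy => ⟨hy.1, cs.ne_one_of_isRightDescent hy.2⟩, cs.hasPrecellDim_lineSet hM i⟩

theorem isOfDim_two (hC : M.IsTwoDimensional) : cs.IsOfDim {w | ¬ cs.IsLine w} 2 :=
  fun _ hw => ⟨cs.leftPrecell_subset_not_isLine hM hw, cs.hasPrecellDim_two hM hC hw⟩

/-- Elements starting with two different commuting letters. -/
theorem isLeftDescent_pair {i j : B} {u : List B} (hij : M i j = 2)
    (h : cs.IsReduced (i :: j :: u)) :
    cs.IsLeftDescent (cs.wordProd (i :: j :: u)) i ∧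
      cs.IsLeftDescent (cs.wordProd (i :: j :: u)) j := by
  refine ⟨cs.isLeftDescent_of_isReduced_cons h, ?_⟩
  rw [wordProd_cons, cs.isLeftDescent_simple_mul_of_commute hM hij]
  exact cs.isLeftDescent_of_isReduced_cons (cs.isReduced_cons_iff.1 h).1

omit hM in
theorem ne_of_isReduced_cons_cons {i j : B} {u : List B} (h : cs.IsReduced (i :: j :: u)) :
    i ≠ j := by
  rintro rfl
  have h1 := cs.isReduced_cons_iff.1 h
  exact h1.2 (cs.isLeftDescent_of_isReduced_cons h1.1)

theorem eq_two_of_commute {i j : B} (hij : i ≠ j) (h : Commute (cs.simple i) (cs.simple j)) :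
    M i j = 2 := by
  have hj : ¬ cs.IsLeftDescent (cs.simple j) i := fun h1 =>
    hij ((cs.isLine_simple j hM).eq_of_isLeftDescent cs h1 (by simp [IsLeftDescent]))
  have hi : ¬ cs.IsLeftDescent (cs.simple i) j := fun h1 =>
    hij ((cs.isLine_simple i hM).eq_of_isLeftDescent cs (by simp [IsLeftDescent]) h1)
  refine cs.eq_two_of_isLeftDescent hM (w := cs.simple i * cs.simple j) ?_ ?_ hij
  · rwa [isLeftDescent_simple_mul_iff]
  · rwa [h.eq, isLeftDescent_simple_mul_iff]

/-- Every element which is not a line ends in `t₁ t₂ u`, where `t₁ ≠ t₂` commute and `u` is trivial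
or a segment. -/
theorem exists_isSegment_of_not_isLine {w : W} (hw : ¬ cs.IsLine w) :
    ∃ (x : W) (i j : B) (u : List B), M i j = 2 ∧ cs.IsReduced (i :: j :: u) ∧
      w = x * cs.wordProd (i :: j :: u) ∧
      cs.length w = cs.length x + cs.length (cs.wordProd (i :: j :: u)) ∧
      (u = [] ∨ cs.IsSegment [i, j] u []) := by
  -- Cores sit behind a common prefix, so pass to the inverse: `w⁻¹ = a · s_i s_j γ` gives `w = γ⁻¹
  -- · s_i s_j a⁻¹`, and the reversal of `a` is the candidate for the segment.
  rw [← isLine_inv_iff] at hw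
  obtain ⟨a, c, h⟩ := cs.exists_hasCore hw
  obtain ⟨i, j, hij, hi, hj⟩ := h.exists_descents
  have hM2 := cs.eq_two_of_isLeftDescent hM hi hj hij
  have hcomm := cs.simple_commute hM2
  have hi' : ¬ cs.IsLeftDescent (cs.simple i * c) i := by
    rwa [isLeftDescent_simple_mul_iff, not_not]
  have hj' : cs.IsLeftDescent (cs.simple i * c) j := by
    rwa [cs.isLeftDescent_simple_mul_of_commute hM hM2]
  have hl1 := cs.length_simple_mul_of_isLeftDescent hi
  have hl2 := cs.length_simple_mul_of_isLeftDescent hj'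
  obtain ⟨γ, hγ, hγ'⟩ := cs.exists_isReduced (cs.simple j * (cs.simple i * c))
  have hc : c = cs.wordProd (i :: j :: γ) := by
    rw [wordProd_cons, wordProd_cons, ← hγ']
    simp
  have hγl := hγ.eq
  rw [← hγ'] at hγl
  have hwx : w = (cs.wordProd γ)⁻¹ * cs.wordProd (i :: j :: a.reverse) := by
    rw [← inv_inj, ← h.mul_eq, hc]
    simp only [wordProd_cons, mul_inv_rev, wordProd_reverse, inv_inv, inv_simple]
    rw [mul_assoc (cs.wordProd a), mul_assoc, ← mul_assoc (cs.simple i), hcomm]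
  have hwl := h.length_eq
  rw [length_inv] at hwl
  have h1 := cs.length_wordProd_le (i :: j :: a.reverse)
  have h2 := cs.length_mul_le (cs.wordProd γ)⁻¹ (cs.wordProd (i :: j :: a.reverse))
  rw [← hwx, length_inv, hγ.eq] at h2
  simp only [List.length_cons, List.length_reverse] at h1
  have hred : cs.IsReduced (i :: j :: a.reverse) := by
    rw [IsReduced]
    simp only [List.length_cons, List.length_reverse]
    omega
  refine ⟨(cs.wordProd γ)⁻¹, i, j, a.reverse, hM2, hred, hwx, ?_, ?_⟩
  · rw [length_inv, hγ.eq, hred.eq]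
    simp only [List.length_cons, List.length_reverse]
    omega
  · by_cases ha : a = []
    · left; simp [ha]
    right
    -- The reverse of a reduced word for `s_i s_j a⁻¹`, prolonged by `γ`, is a reduced word for
    -- `w⁻¹` and must begin with `a`.
    have hsuffix : ∀ ω, cs.IsReduced ω → cs.wordProd ω = cs.wordProd (i :: j :: a.reverse) →
        a.reverse <:+ ω := by
      intro ω hω hω'
      have h3 : cs.wordProd (ω.reverse ++ γ) = w⁻¹ := by
        rw [hwx, wordProd_append, wordProd_reverse, hω', mul_inv_rev, inv_inv]
      have h4 : ω.length = (i :: j :: a.reverse).length := by rw [← hω.eq, hω', hred.eq]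
      simp only [List.length_cons, List.length_reverse] at h4
      have h5 : cs.IsReduced (ω.reverse ++ γ) := by
        rw [IsReduced, h3, length_inv, List.length_append, List.length_reverse]
        omega
      have h6 := h.isPrefix_of_isReduced _ h5 h3
      have h7 : a <+: ω.reverse := List.prefix_of_prefix_length_le h6 (List.prefix_append _ _)
        (by rw [List.length_reverse]; omega)
      rw [← List.reverse_prefix, List.reverse_reverse]
      exact h7
    have hline : cs.IsLine (cs.wordProd a.reverse) := by
      rw [wordProd_reverse, isLine_inv_iff]
      have h8 := h.isReduced_append (cs.reducedWord_isReduced c) (cs.wordProd_reducedWord c)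
      exact cs.isLine_of_isPrefix h8.1 fun ω hω hω' =>
        h.isPrefix_of_isReduced ω hω (hω'.trans h8.2)
    refine ⟨⟨by simpa using hred, by simpa using ha, hline, ?_⟩, ?_⟩
    · intro ω hω hω'
      rw [List.append_nil, List.cons_append, List.singleton_append] at hω'
      obtain ⟨d, rfl⟩ := hsuffix ω hω hω'
      refine ⟨d, [], by simp, ?_, rfl⟩
      rw [wordProd_append, wordProd_cons, wordProd_cons, ← mul_assoc, mul_left_inj] at hω'
      rw [hω']
      simp [wordProd_cons]
    · intro a₁ a₂ b₁ b₂ h3 h4 h5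
      obtain ⟨rfl, rfl⟩ := List.append_eq_nil_iff.1 h4.symm
      refine ⟨?_, rfl⟩
      -- The words starting with `i j` and `j i` show that the letter in front of the reversal of
      -- `a` is not determined, so the segment cannot grow to the left.
      have h6 : cs.wordProd (j :: i :: a.reverse) = cs.wordProd (i :: j :: a.reverse) := by
        rw [wordProd_cons, wordProd_cons, wordProd_cons, wordProd_cons, ← mul_assoc, ← mul_assoc,
          hcomm]
      have h7 : cs.IsReduced (j :: i :: a.reverse) := by
        rw [IsReduced, h6, hred.eq]
        simp
      have h8 : cs.wordProd (j :: i :: a.reverse) =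
          cs.wordProd (a₁ ++ (a₂ ++ a.reverse ++ []) ++ []) := by
        rw [h6]
        congr 1
        rw [List.append_nil, List.append_nil, ← List.append_assoc, ← h3]
        rfl
      obtain ⟨a', b', h9, -, h10⟩ := h5.2.2.2 _ h7 h8
      have hb' : b' = [] := by
        refine cs.eq_nil_of_isReduced ?_ h10
        rw [h9] at h7
        exact cs.isReduced_right_of_append h7
      subst hb'
      rw [List.append_nil, List.append_nil, ← List.append_assoc] at h9
      have h11 : [j, i] = a' ++ a₂ := by
        rw [← List.append_left_inj a.reverse, ← h9]
        rfl
      rcases List.eq_nil_or_concat a₂ with rfl | ⟨r, k, rfl⟩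
      · rfl
      · rw [List.concat_eq_append, ← List.append_assoc] at h3 h11
        have e1 := (List.append_inj' (show [i] ++ [j] = _ from h3) rfl).2
        have e2 := (List.append_inj' (show [j] ++ [i] = _ from h11) rfl).2
        exact absurd (List.cons.inj (e2.trans e1.symm)).1 hij

/-- Both `z` and `s_i z` are reduced products ending in the same element with two left descents, and
both are left equivalent to it. -/
theorem equivL_simple_mul_of_not_isLine (hC : M.IsTwoDimensional) {z : W} {i : B}
    (hz : ¬ cs.IsLine z) (hi : ¬ cs.IsLeftDescent z i) : cs.EquivL (cs.simple i * z) z := by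
  obtain ⟨x, k, l, u, hkl, hred, hzx, hl, -⟩ := cs.exists_isSegment_of_not_isLine hM hz
  obtain ⟨h1, h2⟩ := cs.isLeftDescent_pair hM hkl hred
  have hne := cs.ne_of_isReduced_cons_cons hred
  have h3 := cs.equivL_mul_of_two_descents hM hC h1 h2 hne (x := x) (by rw [← hzx, hl])
  have h4 := cs.length_simple_mul_of_not_isLeftDescent hi
  have h5 := cs.length_mul_le (cs.simple i * x) (cs.wordProd (k :: l :: u))
  have h6 := cs.length_mul_le (cs.simple i) x
  rw [length_simple] at h6
  rw [mul_assoc, ← hzx] at h5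
  have h7 := cs.equivL_mul_of_two_descents hM hC h1 h2 hne (x := cs.simple i * x)
    (by rw [mul_assoc, ← hzx]; omega)
  rw [mul_assoc, ← hzx] at h7
  rw [← hzx] at h3
  exact h7.trans cs (h3.symm cs)

theorem not_isLine_of_isTypeTwoCell {C : Set W} (h : cs.IsTypeTwoCell C) :
    ∃ w, ¬ cs.IsLine w ∧ C = {y | cs.EquivL y w} := by
  obtain ⟨wL, i, j, u, rfl, -, hred, rfl, hcomm, -⟩ := h
  refine ⟨_, fun hw => ?_, rfl⟩
  have hne := cs.ne_of_isReduced_cons_cons hred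
  obtain ⟨h1, h2⟩ := cs.isLeftDescent_pair hM (cs.eq_two_of_commute hM hne hcomm) hred
  exact hne (hw.eq_of_isLeftDescent cs h1 h2)

theorem sUnion_isTypeTwoCell (hC : M.IsTwoDimensional) :
    ⋃₀ {C | cs.IsTypeTwoCell C} = {w | ¬ cs.IsLine w} := by
  ext w
  simp only [Set.mem_sUnion, Set.mem_ofPred_eq]
  constructor
  · rintro ⟨C, hC', hw⟩
    obtain ⟨z, hz, rfl⟩ := cs.not_isLine_of_isTypeTwoCell hM hC'
    rwa [EquivL.isLine_iff cs hM hw]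
  · intro hw
    obtain ⟨x, i, j, u, hij, hred, hwx, hl, hu⟩ := cs.exists_isSegment_of_not_isLine hM hw
    have hne := cs.ne_of_isReduced_cons_cons hred
    obtain ⟨h1, h2⟩ := cs.isLeftDescent_pair hM hij hred
    refine ⟨_, ⟨_, i, j, u, rfl, cs.isCanonicalRep_of_hasCore hM (.nil hne h1 h2), hred, rfl,
      cs.simple_commute hij, hu⟩, ?_⟩
    have h3 := cs.equivL_mul_of_two_descents hM hC h1 h2 hne (x := x) (by rw [← hwx, hl])
    rwa [← hwx] at h3

end Precells

end CoxeterSystem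


/-! ### Criteria for acyclicity and for infinitely many cycles. -/

namespace SimpleGraph

variable {V : Type*} {G : SimpleGraph V}

/-- A graph with a height function is acyclic if adjacent vertices have different heights and each
vertex has at most one lower neighbour. -/
theorem isAcyclic_of_height (f : V → ℕ) (hne : ∀ x y, G.Adj x y → f x ≠ f y)
    (huniq : ∀ x y z, G.Adj x y → G.Adj x z → f y < f x → f z < f x → y = z) : G.IsAcyclic := by
  classical
  intro v c hc
  -- Rotate the cycle to a highest vertex: its two neighbours on the cycle are distinct and both
  -- lower.
  obtain ⟨m, hm, hmax⟩ := Finset.exists_max_image c.support.toFinset f ⟨v, by simp⟩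
  rw [List.mem_toFinset] at hm
  have hc' := hc.rotate hm
  have hsupp : ∀ x ∈ (c.rotate m hm).support, f x ≤ f m := by
    intro x hx
    refine hmax x ?_
    rw [List.mem_toFinset]
    rw [Walk.rotate, Walk.mem_support_append_iff] at hx
    exact hx.elim (fun h => c.support_dropUntil_subset_support _ h) fun h => c.support_takeUntil_subset_support _ h
  have h1 := (c.rotate m hm).adj_snd hc'.not_nil
  have h2 := ((c.rotate m hm).adj_penultimate hc'.not_nil).symm
  have h3 := hsupp _ ((c.rotate m hm).getVert_mem_support 1)
  have h4 := hsupp _ ((c.rotate m hm).getVert_mem_support ((c.rotate m hm).length - 1))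
  exact hc'.snd_ne_penultimate (huniq m _ _ h1 h2 (lt_of_le_of_ne h3 (hne _ _ h1).symm)
    (lt_of_le_of_ne h4 (hne _ _ h2).symm))

/-- A cycle meets finitely many vertices, so finitely many edge sets cannot cover an infinite vertex
set. -/
theorem hasInfinitelyManyCycles_of_forall [Infinite V]
    (h : ∀ v, ∃ c : G.Walk v v, c.IsCycle) : G.HasInfinitelyManyCycles := by
  intro hfin
  refine Set.infinite_univ (α := V) ((hfin.biUnion (t := fun E => {v | ∃ e ∈ E, v ∈ e})
    ?_).subset ?_)
  · rintro _ ⟨v, c, -, rfl⟩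
    refine (List.finite_toSet c.support).subset ?_
    rintro x ⟨e, he, hx⟩
    exact Walk.mem_support_of_mem_edges he hx
  · intro v _
    obtain ⟨c, hc⟩ := h v
    refine Set.mem_biUnion (x := {e | e ∈ c.edges}) ⟨v, c, hc, rfl⟩ ⟨s(v, c.snd), ?_, by simp⟩
    cases c with
    | nil => exact absurd hc (by simp)
    | cons h p => simp

theorem exists_isCycle_of_square {a b c d : V} (hab : G.Adj a b) (hbc : G.Adj b c)
    (hcd : G.Adj c d) (hda : G.Adj d a) (hac : a ≠ c) (hbd : b ≠ d) :
    ∃ w : G.Walk a a, w.IsCycle := by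
  refine ⟨.cons hab (.cons hbc (.cons hcd (.cons hda .nil))), ?_⟩
  have h1 := hab.ne
  have h2 := hbc.ne
  have h3 := hcd.ne
  have h4 := hda.ne
  rw [Walk.cons_isCycle_iff]
  simp [Walk.cons_isPath_iff]
  grind

end SimpleGraph

/-! ### The trivial representation. -/

namespace CoxeterSystem

open HeckeScalars

section TrivialRepresentation

variable {B : Type*} {M : CoxeterMatrix B} {W : Type*} [Group W] (cs : CoxeterSystem M W)

/-- The linear form `T_w ↦ q^{ℓ(w)}`. -/
def indexForm : (W →₀ HeckeScalars) →ₗ[HeckeScalars] HeckeScalars :=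
  Finsupp.linearCombination HeckeScalars fun w => q ^ cs.length w

theorem indexForm_single (w : W) : cs.indexForm (Finsupp.single w 1) = q ^ cs.length w := by
  simp [indexForm]

theorem indexForm_heckeLeft (i : B) (f : W →₀ HeckeScalars) :
    cs.indexForm (cs.heckeLeft i f) = q * cs.indexForm f := by
  have h : cs.indexForm ∘ₗ cs.heckeLeft i = q • cs.indexForm := by
    refine Finsupp.lhom_ext' fun w => LinearMap.ext_ring ?_
    simp only [LinearMap.comp_apply, Finsupp.lsingle_apply, LinearMap.smul_apply, smul_eq_mul,
      indexForm_single]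
    rw [heckeLeft, Finsupp.linearCombination_single, one_smul]
    split_ifs with hw
    · rw [map_add, map_smul, map_smul, indexForm_single, indexForm_single,
        ← cs.length_simple_mul_of_isLeftDescent hw, smul_eq_mul, smul_eq_mul]
      ring
    · rw [indexForm_single, cs.length_simple_mul_of_not_isLeftDescent hw]
      ring
  exact LinearMap.congr_fun h f

/-- Each generator scales the form by `q`. Induction over the generated algebra then makes it
multiplicative, which is what the character `indexHom` requires. -/
theorem indexForm_hecke (h : cs.hecke) (f : W →₀ HeckeScalars) :
    cs.indexForm ((h : Module.End HeckeScalars (W →₀ HeckeScalars)) f) =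
      cs.indexForm (cs.heckeCoeff h) * cs.indexForm f := by
  obtain ⟨h, hh⟩ := h
  unfold heckeCoeff
  induction hh using Algebra.adjoin_induction generalizing f with
  | mem x hx =>
    obtain ⟨i, rfl⟩ := hx
    simp [indexForm_heckeLeft, indexForm_single]
  | algebraMap r =>
    simp only [Module.algebraMap_end_apply, map_smul, indexForm_single, length_one, pow_zero,
      smul_eq_mul, mul_one]
  | add x y _ _ hx hy =>
    simp only [LinearMap.add_apply, map_add] at hx hy ⊢
    rw [hx, hy, add_mul]
  | mul x y _ _ hx hy =>
    simp only [Module.End.mul_apply] at hx hy ⊢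
    rw [hx, hy, hx (y _), mul_assoc]

/-- The index representation `T_w ↦ q^{ℓ(w)}` of the Hecke algebra. -/
def indexHom : cs.hecke →ₐ[HeckeScalars] HeckeScalars :=
  AlgHom.ofLinearMap
    { toFun := fun h => cs.indexForm (cs.heckeCoeff h)
      map_add' := fun x y => by simp [heckeCoeff]
      map_smul' := fun r x => by simp [heckeCoeff] }
    (by simp [heckeCoeff, indexForm_single])
    (fun x y => cs.indexForm_hecke x (cs.heckeCoeff y))

theorem wGraphTau_one (i : B) : cs.wGraphTau {1} i = q • LinearMap.id := by
  have h1 : ∀ y : ({1} : Set W), i ∉ cs.leftDescents (y : W) := by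
    rintro ⟨_, rfl⟩
    exact cs.not_isLeftDescent_one i
  refine Finsupp.lhom_ext' fun x => LinearMap.ext_ring ?_
  simp only [LinearMap.comp_apply, Finsupp.lsingle_apply, wGraphTau,
    Finsupp.linearCombination_single, one_smul, if_neg (h1 _), LinearMap.smul_apply,
    LinearMap.id_apply]
  simp [h1]

theorem givesTrivialRepresentation_one : cs.GivesTrivialRepresentation {1} := by
  refine ⟨Set.ncard_singleton 1, (Algebra.ofId _ _).comp cs.indexHom, fun i => ?_, fun w => ?_⟩
  · rw [wGraphTau_one]
    change algebraMap _ _ (cs.indexForm (cs.heckeLeft i (Finsupp.single 1 1))) = _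
    rw [indexForm_heckeLeft, indexForm_single, length_one, pow_zero, mul_one,
      Algebra.algebraMap_eq_smul_one]
    rfl
  · change algebraMap _ _ (cs.indexForm (cs.heckeCoeff (cs.heckeT w))) = _
    rw [cs.heckeCoeff_heckeT, indexForm_single, Algebra.algebraMap_eq_smul_one]
    rfl

end TrivialRepresentation

/-! ### W-graphs of lines and of non-lines. -/

section Graphs

variable {B : Type*} {M : CoxeterMatrix B} {W : Type*} [Group W] (cs : CoxeterSystem M W)

theorem wGraph_adj_of_wEdge {X : Set W} {x y : X} (h : cs.WEdge x y) (hne : (x : W) ≠ y) :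
    (cs.wGraph X).Adj x y := by
  rw [wGraph, SimpleGraph.fromRel_adj]
  exact ⟨fun h' => hne (congrArg _ h'), Or.inl h⟩

variable (hM : M.IsRightAngled)
include hM

theorem wGraph_adj_simple_mul {X : Set W} {x y : X} {i : B} (h : ¬ cs.IsLeftDescent (y : W) i)
    (hx : (x : W) = cs.simple i * y) : (cs.wGraph X).Adj x y := by
  refine cs.wGraph_adj_of_wEdge (hx ▸ cs.wEdge_simple_mul hM h) fun h' => ?_
  have := cs.length_simple_mul_of_not_isLeftDescent h
  rw [← hx, h'] at this
  omega

theorem exists_simple_mul_of_wGraph_adj {X : Set W} (hX : ∀ w ∈ X, cs.IsLine w ∧ w ≠ 1) {x y : X}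
    (h : (cs.wGraph X).Adj x y) :
    (∃ i, ¬ cs.IsLeftDescent (y : W) i ∧ (x : W) = cs.simple i * y) ∨
      ∃ i, ¬ cs.IsLeftDescent (x : W) i ∧ (y : W) = cs.simple i * x := by
  rw [wGraph, SimpleGraph.fromRel_adj] at h
  rcases h.2 with h | h
  · exact cs.exists_simple_mul_of_wEdge hM h (hX x x.2).1 (hX y y.2).2
  · exact (cs.exists_simple_mul_of_wEdge hM h (hX y y.2).1 (hX x x.2).2).symm

/-- Length serves as the height: from a line the only way down is to delete its unique first letter.
-/
theorem wGraph_isAcyclic {X : Set W} (hX : ∀ w ∈ X, cs.IsLine w ∧ w ≠ 1) :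
    (cs.wGraph X).IsAcyclic := by
  have key : ∀ x y : X, (cs.wGraph X).Adj x y → cs.length (y : W) < cs.length (x : W) →
      ∃ i, cs.IsLeftDescent (x : W) i ∧ (y : W) = cs.simple i * x := by
    intro x y h hlt
    rcases cs.exists_simple_mul_of_wGraph_adj hM hX h with ⟨i, hi, hx⟩ | ⟨i, hi, hy⟩
    · refine ⟨i, ?_, by rw [hx, simple_mul_simple_cancel_left]⟩
      rwa [hx, isLeftDescent_simple_mul_iff]
    · have := cs.length_simple_mul_of_not_isLeftDescent hi
      rw [← hy] at this
      omega
  refine SimpleGraph.isAcyclic_of_height (fun x : X => cs.length (x : W)) ?_ ?_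
  · intro x y h
    rcases cs.exists_simple_mul_of_wGraph_adj hM hX h with ⟨i, hi, hx⟩ | ⟨i, hi, hy⟩
    · have := cs.length_simple_mul_of_not_isLeftDescent hi
      rw [← hx] at this
      omega
    · have := cs.length_simple_mul_of_not_isLeftDescent hi
      rw [← hy] at this
      omega
  · intro x y z hy hz hly hlz
    obtain ⟨i, hi, hy'⟩ := key x y hy hly
    obtain ⟨j, hj, hz'⟩ := key x z hz hlz
    apply Subtype.ext
    rw [hy', hz', (hX x x.2).1.eq_of_isLeftDescent cs hi hj]

theorem reachable_simple {X : Set W} {i : B} (hX : cs.lineSet i ⊆ X) {w : W}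
    (hw : w ∈ cs.lineSet i) :
    (cs.wGraph X).Reachable ⟨w, hX hw⟩ ⟨cs.simple i, hX (cs.simple_mem_lineSet hM i)⟩ := by
  induction hn : cs.length w generalizing w with
  | zero =>
    rw [cs.length_eq_zero_iff] at hn
    exact absurd hn (cs.ne_one_of_isRightDescent hw.2)
  | succ n ih =>
    obtain ⟨j, hj⟩ := cs.exists_leftDescent_of_ne_one (cs.ne_one_of_isRightDescent hw.2)
    have hl := cs.length_simple_mul_of_isLeftDescent hj
    obtain ⟨y, rfl⟩ : ∃ y, w = cs.simple j * y := ⟨cs.simple j * w, by simp⟩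
    rw [simple_mul_simple_cancel_left] at hl
    have hj' : ¬ cs.IsLeftDescent y j := by rwa [isLeftDescent_simple_mul_iff] at hj
    by_cases hy1 : y = 1
    · subst hy1
      have h1 : cs.IsRightDescent (cs.simple j * 1) j := by
        simp [IsRightDescent]
      obtain rfl := hw.1.eq_of_isRightDescent cs hw.2 h1
      simp only [mul_one]
      exact SimpleGraph.Reachable.refl _
    · have h1 : y ∈ cs.lineSet i :=
        ⟨cs.isLine_of_simple_mul hj' hw.1, cs.isRightDescent_of_simple_mul hj' hw.1 hy1 hw.2⟩
      refine SimpleGraph.Reachable.trans (v := ⟨y, hX h1⟩) ?_ (ih h1 (by omega))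
      exact (cs.wGraph_adj_simple_mul hM (x := ⟨cs.simple j * y, hX hw⟩) (y := ⟨y, hX h1⟩)
        hj' rfl).reachable

theorem wGraph_lineSet_isTree (i : B) : (cs.wGraph (cs.lineSet i)).IsTree := by
  refine ⟨?_, cs.wGraph_isAcyclic hM fun w hw => ⟨hw.1, cs.ne_one_of_isRightDescent hw.2⟩⟩
  rw [SimpleGraph.connected_iff_exists_forall_reachable]
  exact ⟨⟨cs.simple i, cs.simple_mem_lineSet hM i⟩, fun w =>
    (cs.reachable_simple hM (le_refl (cs.lineSet i)) w.2).symm⟩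

theorem reachable_iff_equivL (x y : {w | cs.IsLine w ∧ w ≠ 1}) :
    (cs.wGraph {w | cs.IsLine w ∧ w ≠ 1}).Reachable x y ↔ cs.EquivL (x : W) y := by
  constructor
  · rintro ⟨p⟩
    induction p with
    | nil => exact EquivL.refl cs _
    | @cons x y z h p ih =>
      refine EquivL.trans cs ?_ ih
      rcases cs.exists_simple_mul_of_wGraph_adj hM (fun _ hw => hw) h with
        ⟨i, hi, hx⟩ | ⟨i, hi, hy⟩
      · rw [hx]
        exact cs.equivL_of_isLine hM hi (hx ▸ x.2.1) y.2.2
      · rw [hy]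
        exact (cs.equivL_of_isLine hM hi (hy ▸ y.2.1) x.2.2).symm cs
  · intro h
    obtain ⟨i, hi⟩ := cs.exists_rightDescent_of_ne_one y.2.2
    have hy : (y : W) ∈ cs.lineSet i := ⟨y.2.1, hi⟩
    have hx := cs.mem_lineSet_of_equivL hM h hy
    have hX : cs.lineSet i ⊆ {w | cs.IsLine w ∧ w ≠ 1} := fun w hw =>
      ⟨hw.1, cs.ne_one_of_isRightDescent hw.2⟩
    exact (cs.reachable_simple hM hX hx).trans (cs.reachable_simple hM hX hy).symm

omit hM in
theorem infinite_of_forall_exists {X : Set W} (hne : X.Nonempty)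
    (h : ∀ x ∈ X, ∃ i, ¬ cs.IsLeftDescent x i ∧ cs.simple i * x ∈ X) : X.Infinite := by
  intro hfin
  obtain ⟨x, hx, hmax⟩ := Set.exists_max_image X cs.length hfin hne
  obtain ⟨i, hi, hix⟩ := h x hx
  have h1 := hmax _ hix
  rw [cs.length_simple_mul_of_not_isLeftDescent hi] at h1
  omega

/-- Commuting ascents give squares in the W-graph. -/
theorem hasInfinitelyManyCycles {X : Set W} (hne : X.Nonempty)
    (hX : ∀ x ∈ X, ∀ i, ¬ cs.IsLeftDescent x i → cs.simple i * x ∈ X)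
    (h : ∀ x ∈ X, ∃ i j, M i j = 2 ∧ ¬ cs.IsLeftDescent x i ∧ ¬ cs.IsLeftDescent x j) :
    (cs.wGraph X).HasInfinitelyManyCycles := by
  have : Infinite X := (cs.infinite_of_forall_exists hne fun x hx => by
    obtain ⟨i, j, -, hi, -⟩ := h x hx
    exact ⟨i, hi, hX x hx i hi⟩).to_subtype
  refine SimpleGraph.hasInfinitelyManyCycles_of_forall ?_
  rintro ⟨x, hx⟩
  obtain ⟨i, j, hij, hi, hj⟩ := h x hx
  have hcomm := cs.simple_commute hij
  have hji : M j i = 2 := by rwa [M.symmetric]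
  have hi' : ¬ cs.IsLeftDescent (cs.simple j * x) i := by
    rwa [cs.isLeftDescent_simple_mul_of_commute hM hji]
  have hj' : ¬ cs.IsLeftDescent (cs.simple i * x) j := by
    rwa [cs.isLeftDescent_simple_mul_of_commute hM hij]
  have hix := hX x hx i hi
  have hjx := hX x hx j hj
  have hjix := hX _ hix j hj'
  refine SimpleGraph.exists_isCycle_of_square (b := ⟨cs.simple i * x, hix⟩)
    (c := ⟨cs.simple j * (cs.simple i * x), hjix⟩) (d := ⟨cs.simple j * x, hjx⟩)
    (cs.wGraph_adj_simple_mul hM hi rfl).symm (cs.wGraph_adj_simple_mul hM hj' rfl).symm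
    (cs.wGraph_adj_simple_mul hM hi' ?_) (cs.wGraph_adj_simple_mul hM hj rfl) ?_ ?_
  · change cs.simple j * (cs.simple i * x) = cs.simple i * (cs.simple j * x)
    rw [← mul_assoc, ← mul_assoc, hcomm]
  · intro heq
    have h1 := cs.length_simple_mul_of_not_isLeftDescent hi
    have h2 := cs.length_simple_mul_of_not_isLeftDescent hj'
    rw [← Subtype.mk.inj heq] at h2
    omega
  · intro heq
    have h1 := mul_right_cancel (Subtype.mk.inj heq)
    obtain rfl := cs.simple_injective_of_isRightAngled hM h1
    simp at hij

end Graphs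

/-! ### Links inside the two-sided cells. -/

section TwoSidedCells

variable {B : Type*} {M : CoxeterMatrix B} {W : Type*} [Group W] (cs : CoxeterSystem M W)
  (hM : M.IsRightAngled)
include hM

theorem isLeftDescent_simple_iff {i j : B} : cs.IsLeftDescent (cs.simple i) j ↔ j = i := by
  constructor
  · intro h
    exact (cs.isLine_simple i hM).eq_of_isLeftDescent cs h (by simp [IsLeftDescent])
  · rintro rfl
    simp [IsLeftDescent]

theorem isLeftDescent_simple_mul_simple_iff {i j k : B} (h : M i j = 2) :
    cs.IsLeftDescent (cs.simple i * cs.simple j) k ↔ k = i ∨ k = j := by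
  have hij : i ≠ j := by rintro rfl; simp at h
  have hi : ¬ cs.IsLeftDescent (cs.simple j) i := by rwa [cs.isLeftDescent_simple_iff hM]
  constructor
  · intro hk
    by_cases hki : i = k
    · exact Or.inl hki.symm
    · exact Or.inr ((cs.isLeftDescent_simple_iff hM).1 (cs.isLeftDescent_of_simple_mul hM hi hk hki).2)
  · rintro (rfl | rfl)
    · rwa [isLeftDescent_simple_mul_iff]
    · rw [cs.isLeftDescent_simple_mul_of_commute hM h, cs.isLeftDescent_simple_iff hM]

/-- The element `s_i s_j` is a line, left equivalent to `s_j` and, after inversion, right equivalent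
to `s_i`. -/
theorem equivLR_simple_of_ne_two {i j : B} (hij : i ≠ j) (h : M i j ≠ 2) :
    cs.EquivLR (cs.simple i) (cs.simple j) := by
  have key : ∀ i j, i ≠ j → M i j ≠ 2 → cs.EquivL (cs.simple i * cs.simple j) (cs.simple j) := by
    intro i j hij h
    have hi : ¬ cs.IsLeftDescent (cs.simple j) i := by rwa [cs.isLeftDescent_simple_iff hM]
    refine cs.equivL_of_isLine hM hi ?_ ?_
    · refine cs.isLine_simple_mul hM hi (cs.isLine_simple j hM) fun k hk => ?_
      rw [cs.isLeftDescent_simple_iff hM] at hk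
      rwa [hk]
    · exact cs.ne_one_of_isRightDescent (cs.simple_mem_lineSet hM j).2
  have h1 := key i j hij h
  have h2 := key j i hij.symm (by rwa [M.symmetric])
  refine EquivLR.trans cs (EquivLR.symm cs (EquivL.equivLR_inv cs ?_)) (h1.equivLR cs)
  simpa using h2

theorem not_isLine_simple_mul_simple {i j : B} (h : M i j = 2) :
    ¬ cs.IsLine (cs.simple i * cs.simple j) := by
  intro hl
  have := hl.eq_of_isLeftDescent cs ((cs.isLeftDescent_simple_mul_simple_iff hM h).2 (Or.inl rfl))
    ((cs.isLeftDescent_simple_mul_simple_iff hM h).2 (Or.inr rfl))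
  subst this
  simp at h

variable (hC : M.IsTwoDimensional)
include hC

/-- An element starting with two commuting letters `i`, `j` is right equivalent to `s_i s_j`. -/
theorem equivLR_simple_mul_simple {i j : B} {x : W} (h : M i j = 2)
    (hx : cs.length (cs.simple i * cs.simple j * x) = 2 + cs.length x) :
    cs.EquivLR (cs.simple i * cs.simple j * x) (cs.simple i * cs.simple j) := by
  have hij : i ≠ j := by rintro rfl; simp at h
  have hcomm := cs.simple_commute h
  have hl : cs.length (cs.simple i * cs.simple j) = 2 := by
    rw [cs.length_simple_mul_of_not_isLeftDescent, length_simple]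
    rwa [cs.isLeftDescent_simple_iff hM]
  have hinv : (cs.simple i * cs.simple j)⁻¹ = cs.simple i * cs.simple j := by
    rw [mul_inv_rev, inv_simple, inv_simple, hcomm]
  refine EquivL.equivLR_inv cs ?_
  rw [mul_inv_rev, hinv]
  refine cs.equivL_mul_of_two_descents hM hC
    ((cs.isLeftDescent_simple_mul_simple_iff hM h).2 (Or.inl rfl))
    ((cs.isLeftDescent_simple_mul_simple_iff hM h).2 (Or.inr rfl)) hij ?_
  rw [← length_inv, mul_inv_rev, inv_inv, hinv, hx, hl, length_inv, add_comm]

/-- Left equivalence removes everything before a commuting pair of letters, and right equivalence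
everything after it. -/
theorem exists_equivLR_of_not_isLine {w : W} (hw : ¬ cs.IsLine w) :
    ∃ i j, M i j = 2 ∧ cs.EquivLR w (cs.simple i * cs.simple j) := by
  obtain ⟨x, i, j, u, hij, hred, hwx, hl, -⟩ := cs.exists_isSegment_of_not_isLine hM hw
  obtain ⟨h1, h2⟩ := cs.isLeftDescent_pair hM hij hred
  have h3 := cs.equivL_mul_of_two_descents hM hC h1 h2 (cs.ne_of_isReduced_cons_cons hred)
    (x := x) (by rw [← hwx, hl])
  rw [← hwx] at h3
  refine ⟨i, j, hij, (h3.equivLR cs).trans cs ?_⟩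
  have h4 := hred.eq
  have h5 : cs.IsReduced u := (cs.isReduced_cons_iff.1 (cs.isReduced_cons_iff.1 hred).1).1
  have h6 : cs.wordProd (i :: j :: u) = cs.simple i * cs.simple j * cs.wordProd u := by
    rw [wordProd_cons, wordProd_cons, mul_assoc]
  rw [h6] at h4 ⊢
  refine cs.equivLR_simple_mul_simple hM hC hij ?_
  rw [h4, h5.eq]
  simp only [List.length_cons]
  omega

/-- Two commuting pairs with a common member are linked by a path of three letters. -/
theorem equivLR_of_common_letter {i j k : B} (hij : M i j = 2) (hjk : M j k = 2) (hik : i ≠ k) :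
    cs.EquivLR (cs.simple i * cs.simple j) (cs.simple j * cs.simple k) := by
  have hi : ¬ cs.IsLeftDescent (cs.simple j * cs.simple k) i := by
    rw [cs.isLeftDescent_simple_mul_simple_iff hM hjk]
    rintro (rfl | rfl)
    · simp at hij
    · exact hik rfl
  have hj : ¬ cs.IsLeftDescent (cs.simple k) j := by
    rw [cs.isLeftDescent_simple_iff hM]
    rintro rfl
    simp at hjk
  have h1 := cs.equivL_simple_mul_of_not_isLine hM hC (cs.not_isLine_simple_mul_simple hM hjk) hi
  refine EquivLR.trans cs (EquivLR.symm cs ?_) (h1.equivLR cs)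
  rw [← mul_assoc]
  refine cs.equivLR_simple_mul_simple hM hC hij ?_
  rw [mul_assoc, cs.length_simple_mul_of_not_isLeftDescent hi,
    cs.length_simple_mul_of_not_isLeftDescent hj, length_simple]

end TwoSidedCells

end CoxeterSystem


/-! ### The polygon group. -/

section Polygon

variable {n : ℕ} (hn : 5 ≤ n)
include hn

theorem ZMod.natCast_ne_zero_of_lt_five {k : ℕ} (hk : k ≠ 0) (hk5 : k < 5) : (k : ZMod n) ≠ 0 := by
  rw [Ne, ZMod.natCast_eq_zero_iff]
  intro h
  have := Nat.le_of_dvd (Nat.pos_of_ne_zero hk) h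
  omega

theorem polygonMatrix_eq_two_iff {i j : ZMod n} :
    polygonMatrix n i j = 2 ↔ j = i + 1 ∨ i = j + 1 := by
  have h1 := ZMod.natCast_ne_zero_of_lt_five hn (k := 1) (by omega) (by omega)
  rw [Nat.cast_one] at h1
  change (if i = j then 1 else if j = i + 1 ∨ i = j + 1 then 2 else 0) = 2 ↔ _
  by_cases hij : i = j
  · subst hij
    simp [h1]
  · rw [if_neg hij]
    split_ifs with h <;> simp [h]

omit hn in
theorem polygonMatrix_isRightAngled : (polygonMatrix n).IsRightAngled := by
  intro i j hij
  change (if i = j then 1 else if j = i + 1 ∨ i = j + 1 then 2 else 0) = 2 ∨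
    (if i = j then 1 else if j = i + 1 ∨ i = j + 1 then 2 else 0) = 0
  rw [if_neg hij]
  split_ifs <;> simp

/-- Three pairwise adjacent residues would force `1 = 0` or `3 = 0` modulo `n`. -/
theorem polygonMatrix_isTwoDimensional : (polygonMatrix n).IsTwoDimensional := by
  have h1 := ZMod.natCast_ne_zero_of_lt_five hn (k := 1) (by omega) (by omega)
  have h3 := ZMod.natCast_ne_zero_of_lt_five hn (k := 3) (by omega) (by omega)
  push_cast at h1 h3
  intro i j k hij hjk hik
  rw [polygonMatrix_eq_two_iff hn] at hij hjk hik
  rcases hij with a | a <;> rcases hjk with b | b <;> rcases hik with c | c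
  · exact h1 (by linear_combination c - a - b)
  · exact h3 (by linear_combination - a - b - c)
  · exact h1 (by linear_combination a - b - c)
  · exact h1 (by linear_combination b - a - c)
  · exact h1 (by linear_combination b - a - c)
  · exact h1 (by linear_combination a - b - c)
  · exact h3 (by linear_combination - a - b - c)
  · exact h1 (by linear_combination c - a - b)

theorem polygonMatrix_add_one (i : ZMod n) : polygonMatrix n i (i + 1) = 2 :=
  (polygonMatrix_eq_two_iff hn).2 (Or.inl rfl)

/-- Generators at cyclic distance two or three do not commute. -/
theorem polygonMatrix_add_ne_two (i : ZMod n) {k : ℕ} (hk : 2 ≤ k) (hk' : k ≤ 3) :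
    i + k ≠ i ∧ polygonMatrix n i (i + k) ≠ 2 := by
  -- The residues `k - 1`, `k`, `k + 1` lie between one and four; the value four is where `n ≥ 5` is
  -- needed.
  have h1 := ZMod.natCast_ne_zero_of_lt_five hn (k := k) (by omega) (by omega)
  have h2 := ZMod.natCast_ne_zero_of_lt_five hn (k := k - 1) (by omega) (by omega)
  have h3 := ZMod.natCast_ne_zero_of_lt_five hn (k := k + 1) (by omega) (by omega)
  rw [Nat.cast_sub (by omega)] at h2
  push_cast at h2 h3
  rw [Ne, Ne, polygonMatrix_eq_two_iff hn]
  refine ⟨fun h => h1 (by linear_combination h), ?_⟩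
  rintro (h | h)
  · exact h2 (by linear_combination h)
  · exact h3 (by linear_combination -h)

namespace CoxeterSystem

variable {W : Type*} [Group W] (cs : CoxeterSystem (polygonMatrix n) W)

/-- Letters at distance two and three from a descent do not commute with it, so they are ascents;
being adjacent, they commute with each other. -/
theorem exists_commuting_ascents (w : W) :
    ∃ i j, polygonMatrix n i j = 2 ∧ ¬ cs.IsLeftDescent w i ∧ ¬ cs.IsLeftDescent w j := by
  by_cases h : ∃ d, cs.IsLeftDescent w d
  · obtain ⟨d, hd⟩ := h
    have key : ∀ k : ℕ, 2 ≤ k → k ≤ 3 → ¬ cs.IsLeftDescent w (d + k) := by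
      intro k hk hk' h
      obtain ⟨h1, h2⟩ := polygonMatrix_add_ne_two hn d hk hk'
      exact h2 (cs.eq_two_of_isLeftDescent polygonMatrix_isRightAngled hd h h1.symm)
    refine ⟨d + (2 : ℕ), d + (3 : ℕ), (polygonMatrix_eq_two_iff hn).2 (Or.inl ?_),
      key 2 le_rfl (by omega), key 3 (by omega) le_rfl⟩
    push_cast
    ring
  · push Not at h
    exact ⟨0, 0 + 1, polygonMatrix_add_one hn 0, h _, h _⟩

/-- A line with first letter `d` is prolonged to a longer line by the letter `d + 2`, which does not
commute with `d`. -/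
theorem lineSet_infinite (i : ZMod n) : (cs.lineSet i).Infinite := by
  refine cs.infinite_of_forall_exists
    ⟨cs.simple i, cs.simple_mem_lineSet polygonMatrix_isRightAngled i⟩ ?_
  rintro w ⟨hw, hwi⟩
  obtain ⟨d, hd⟩ := cs.exists_leftDescent_of_ne_one (cs.ne_one_of_isRightDescent hwi)
  obtain ⟨h1, h2⟩ := polygonMatrix_add_ne_two hn d (k := 2) le_rfl (by omega)
  have h3 : ¬ cs.IsLeftDescent w (d + (2 : ℕ)) := fun h => h1 (hw.eq_of_isLeftDescent cs h hd)
  refine ⟨d + (2 : ℕ), h3, ?_, cs.isRightDescent_simple_mul h3 hwi⟩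
  refine cs.isLine_simple_mul polygonMatrix_isRightAngled h3 hw fun j hj => ?_
  rwa [hw.eq_of_isLeftDescent cs hj hd, (polygonMatrix n).symmetric]

theorem equivLR_simple_polygon (i j : ZMod n) : cs.EquivLR (cs.simple i) (cs.simple j) := by
  have hM : (polygonMatrix n).IsRightAngled := polygonMatrix_isRightAngled
  -- The neighbours `i` and `i + 1` commute, but both fail to commute with `i + 3`.
  have key : ∀ i : ZMod n, cs.EquivLR (cs.simple i) (cs.simple (i + 1)) := by
    intro i
    obtain ⟨h1, h2⟩ := polygonMatrix_add_ne_two hn i (k := 3) (by omega) le_rfl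
    obtain ⟨h3, h4⟩ := polygonMatrix_add_ne_two hn (i + 1) (k := 2) le_rfl (by omega)
    have h5 : i + 1 + ((2 : ℕ) : ZMod n) = i + (3 : ℕ) := by push_cast; ring
    rw [h5] at h3 h4
    exact (cs.equivLR_simple_of_ne_two hM h1.symm h2).trans cs
      ((cs.equivLR_simple_of_ne_two hM h3.symm h4).symm cs)
  by_cases hij : i = j
  · subst hij
    exact EquivLR.refl cs _
  by_cases h : polygonMatrix n i j = 2
  · rcases (polygonMatrix_eq_two_iff hn).1 h with rfl | rfl
    · exact key i
    · exact (key j).symm cs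
  · exact cs.equivLR_simple_of_ne_two hM hij h

theorem equivLR_of_isLine_polygon {x y : W} (hx : cs.IsLine x) (hx1 : x ≠ 1) (hy : cs.IsLine y)
    (hy1 : y ≠ 1) : cs.EquivLR x y := by
  have hM : (polygonMatrix n).IsRightAngled := polygonMatrix_isRightAngled
  obtain ⟨i, hi⟩ := cs.exists_rightDescent_of_ne_one hx1
  obtain ⟨j, hj⟩ := cs.exists_rightDescent_of_ne_one hy1
  have h1 := (cs.equivL_simple_of_mem_lineSet hM ⟨hx, hi⟩).equivLR cs
  have h2 := (cs.equivL_simple_of_mem_lineSet hM ⟨hy, hj⟩).equivLR cs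
  exact (h1.trans cs (cs.equivLR_simple_polygon hn i j)).trans cs (h2.symm cs)

/-- Consecutive sides of the polygon share a letter, so the pairs are linked by walking around it.
-/
theorem equivLR_pair_zero (i : ZMod n) :
    cs.EquivLR (cs.simple i * cs.simple (i + 1)) (cs.simple 0 * cs.simple (0 + 1)) := by
  have : NeZero n := ⟨by omega⟩
  obtain ⟨k, rfl⟩ := ZMod.natCast_zmod_surjective i
  induction k with
  | zero =>
    rw [Nat.cast_zero]
    exact EquivLR.refl cs _
  | succ k ih =>
    refine EquivLR.trans cs (EquivLR.symm cs ?_) ih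
    rw [Nat.cast_succ]
    refine cs.equivLR_of_common_letter polygonMatrix_isRightAngled
      (polygonMatrix_isTwoDimensional hn) (polygonMatrix_add_one hn _) (polygonMatrix_add_one hn _)
      ?_
    have h := (polygonMatrix_add_ne_two hn (k : ZMod n) (k := 2) le_rfl (by omega)).1
    intro h'
    apply h
    rw [Nat.cast_ofNat, ← one_add_one_eq_two, ← add_assoc]
    exact h'.symm

theorem equivLR_of_not_isLine_polygon {x y : W} (hx : ¬ cs.IsLine x) (hy : ¬ cs.IsLine y) :
    cs.EquivLR x y := by
  have key : ∀ w, ¬ cs.IsLine w → cs.EquivLR w (cs.simple 0 * cs.simple (0 + 1)) := by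
    intro w hw
    obtain ⟨i, j, hij, h⟩ := cs.exists_equivLR_of_not_isLine polygonMatrix_isRightAngled
      (polygonMatrix_isTwoDimensional hn) hw
    refine h.trans cs ?_
    have hcomm := cs.simple_commute hij
    rcases (polygonMatrix_eq_two_iff hn).1 hij with rfl | rfl
    · exact cs.equivLR_pair_zero hn i
    · rw [hcomm]
      exact cs.equivLR_pair_zero hn j
  exact (key x hx).trans cs ((key y hy).symm cs)

theorem twoSidedCells_polygon :
    {X | cs.IsTwoSidedCell X} = {{1}, {w | cs.IsLine w ∧ w ≠ 1}, {w | ¬ cs.IsLine w}} := by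
  have hM : (polygonMatrix n).IsRightAngled := polygonMatrix_isRightAngled
  have h0 : {y | cs.EquivLR y 1} = {1} := by
    ext y
    constructor
    · intro h
      exact (EquivLR.eq_one_iff cs h).2 rfl
    · rintro rfl
      exact EquivLR.refl cs _
  have h1 : ∀ w, cs.IsLine w → w ≠ 1 →
      {y | cs.EquivLR y w} = {w | cs.IsLine w ∧ w ≠ 1} := by
    intro w hw hw1
    ext y
    constructor
    · intro h
      exact ⟨(EquivLR.isLine_iff cs hM h).2 hw, fun hy => hw1 ((EquivLR.eq_one_iff cs h).1 hy)⟩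
    · rintro ⟨hy, hy1⟩
      exact cs.equivLR_of_isLine_polygon hn hy hy1 hw hw1
  have h2 : ∀ w, ¬ cs.IsLine w → {y | cs.EquivLR y w} = {w | ¬ cs.IsLine w} := by
    intro w hw
    ext y
    constructor
    · intro h hy
      exact hw ((EquivLR.isLine_iff cs hM h).1 hy)
    · intro hy
      exact cs.equivLR_of_not_isLine_polygon hn hy hw
  ext X
  simp only [Set.mem_insert_iff, Set.mem_singleton_iff]
  constructor
  · rintro ⟨w, rfl⟩
    by_cases hw : cs.IsLine w
    · by_cases hw1 : w = 1
      · subst hw1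
        exact Or.inl h0
      · exact Or.inr (Or.inl (h1 w hw hw1))
    · exact Or.inr (Or.inr (h2 w hw))
  · rintro (rfl | rfl | rfl)
    · exact ⟨1, h0.symm⟩
    · exact ⟨cs.simple 0, (h1 _ (cs.isLine_simple 0 hM)
        (cs.ne_one_of_isRightDescent (cs.simple_mem_lineSet hM 0).2)).symm⟩
    · exact ⟨_, (h2 _ (cs.not_isLine_simple_mul_simple hM (polygonMatrix_add_one hn 0))).symm⟩

theorem ncard_twoSidedCells_polygon : {X | cs.IsTwoSidedCell X}.ncard = 3 := by
  have hM : (polygonMatrix n).IsRightAngled := polygonMatrix_isRightAngled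
  refine Set.ncard_eq_three.2 ⟨_, _, _, fun h => ?_, fun h => ?_, fun h => ?_,
    cs.twoSidedCells_polygon hn⟩
  · exact (h.subset (Set.mem_singleton 1)).2 rfl
  · exact (h.subset (Set.mem_singleton 1)) cs.isLine_one
  · have h1 : cs.simple 0 ∈ {w | cs.IsLine w ∧ w ≠ 1} := ⟨cs.isLine_simple 0 hM,
      cs.ne_one_of_isRightDescent (cs.simple_mem_lineSet hM 0).2⟩
    exact (h.subset h1) h1.1

theorem hasInfinitelyManyCycles_leftCell {w : W} (hw : ¬ cs.IsLine w) :
    (cs.wGraph {y | cs.EquivL y w}).HasInfinitelyManyCycles := by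
  have hM : (polygonMatrix n).IsRightAngled := polygonMatrix_isRightAngled
  refine cs.hasInfinitelyManyCycles hM ⟨w, EquivL.refl cs w⟩ ?_
    fun x _ => cs.exists_commuting_ascents hn x
  intro x hx i hi
  refine EquivL.trans cs ?_ hx
  exact cs.equivL_simple_mul_of_not_isLine hM (polygonMatrix_isTwoDimensional hn)
    (fun h => hw ((EquivL.isLine_iff cs hM hx).1 h)) hi

theorem hasInfinitelyManyCycles_not_isLine :
    (cs.wGraph {w | ¬ cs.IsLine w}).HasInfinitelyManyCycles := by
  have hM : (polygonMatrix n).IsRightAngled := polygonMatrix_isRightAngled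
  refine cs.hasInfinitelyManyCycles hM
    ⟨_, cs.not_isLine_simple_mul_simple hM (polygonMatrix_add_one hn 0)⟩ ?_
    fun x _ => cs.exists_commuting_ascents hn x
  intro x hx i hi h
  exact hx (cs.isLine_of_simple_mul hi h)

end CoxeterSystem

end Polygon

end

theorem mainTheorem2 (n : ℕ) (hn : 5 ≤ n) (unitCell cellOne cellTwo : Set (PolygonGroup n))
    (h₀ : unitCell = {1})
    (h₁ : cellOne = ⋃₀ {C | (polygonSystem n).IsTypeOneCell C})
    (h₂ : cellTwo = ⋃₀ {C | (polygonSystem n).IsTypeTwoCell C}) :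
    -- the partition into two-sided cells has exactly the three members
    {X | (polygonSystem n).IsTwoSidedCell X} = {unitCell, cellOne, cellTwo} ∧
    {X | (polygonSystem n).IsTwoSidedCell X}.ncard = 3 ∧
    -- the unit cell
    (polygonSystem n).GivesTrivialRepresentation unitCell ∧
    -- the union of the left cells of type (i)
    (polygonSystem n).IsOfDim cellOne 1 ∧
    (∀ C, (polygonSystem n).IsTypeOneCell C →
      C.Infinite ∧ ((polygonSystem n).wGraph C).IsTree) ∧
    ((polygonSystem n).wGraph cellOne).IsAcyclic ∧
    (∀ x y : cellOne, ((polygonSystem n).wGraph cellOne).Reachable x y ↔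
      (polygonSystem n).EquivL (x : PolygonGroup n) y) ∧
    -- the union of the left cells of type (ii)
    (polygonSystem n).IsOfDim cellTwo 2 ∧
    (∀ C, (polygonSystem n).IsTypeTwoCell C →
      ((polygonSystem n).wGraph C).HasInfinitelyManyCycles) ∧
    ((polygonSystem n).wGraph cellTwo).HasInfinitelyManyCycles := by
  have hM : (polygonMatrix n).IsRightAngled := polygonMatrix_isRightAngled
  have hC := polygonMatrix_isTwoDimensional hn
  -- The two unions of left cells become the non-unit lines and the non-lines, for which all claims
  -- are already available.
  rw [(polygonSystem n).sUnion_isTypeOneCell hM] at h₁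
  rw [(polygonSystem n).sUnion_isTypeTwoCell hM hC] at h₂
  subst h₀ h₁ h₂
  refine ⟨(polygonSystem n).twoSidedCells_polygon hn,
    (polygonSystem n).ncard_twoSidedCells_polygon hn,
    (polygonSystem n).givesTrivialRepresentation_one, (polygonSystem n).isOfDim_one hM, ?_,
    (polygonSystem n).wGraph_isAcyclic hM fun _ hw => hw,
    (polygonSystem n).reachable_iff_equivL hM, (polygonSystem n).isOfDim_two hM hC, ?_,
    (polygonSystem n).hasInfinitelyManyCycles_not_isLine hn⟩
  · intro C hCell
    obtain ⟨i, rfl⟩ := ((polygonSystem n).isTypeOneCell_iff hM).1 hCell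
    exact ⟨(polygonSystem n).lineSet_infinite hn i, (polygonSystem n).wGraph_lineSet_isTree hM i⟩
  · intro C hCell
    obtain ⟨w, hw, rfl⟩ := (polygonSystem n).not_isLine_of_isTypeTwoCell hM hCell
    exact (polygonSystem n).hasInfinitelyManyCycles_leftCell hn hw
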